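/- **Setting.** Let $V=\{1,\dots,N\}$, $N\ge 1$, carry symmetric conductances $\omega_{\{x,y\}}\in[0,\infty)$ with $\omega_{\{x,x\}}=0$ such that the graph with edges $\{x,y\}$, $\omega_{\{x,y\}}\ne0$, is connected, and site parameters $\alpha_x\in\{1,2,\dots\}$. Let $\omega_L,\omega_R\ge0$ with $\omega_L\vee\omega_R>0$, and $\alpha_L,\alpha_R>0$. Let $\sigma\in\{-1,0,1\}$, put $\varTheta=[0,1]$ if $\sigma=-1$ and $\varTheta=[0,\infty)$ if $\sigma\in\{0,1\}$, and let $\theta_L,\theta_R\in\varTheta$. Let $\mathcal X=\prod_{x\in V}\{0,\dots,\alpha_x\}$ if $\sigma=-1$ and $\mathcal X=\mathbb N_0^V$ otherwise, and let $\{\eta_t\}$ be the Markov chain on $\mathcal X$ in which, for $x\neq y$, a particle jumps from $x$ to $y$ at rate $\omega_{\{x,y\}}\,\eta(x)(\alpha_y+\sigma\eta(y))$, a particle is removed from site $1$ at rate $\omega_L\,\eta(1)\,\alpha_L(1+\sigma\theta_L)$ and added to it at rate $\omega_L\,\alpha_L\theta_L(\alpha_1+\sigma\eta(1))$, and likewise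 at site $N$ with $\omega_R,\alpha_R,\theta_R$. Let $\mu_{\theta_L,\theta_R}$ be its stationary probability measure and $\bar\theta_x:=\mathbb E_{\mu_{\theta_L,\theta_R}}[\eta(x)/\alpha_x]$. For $\theta\in\varTheta$ let $\nu_{x,\theta}$ be Binomial$(\alpha_x,\theta)$ if $\sigma=-1$, Poisson$(\alpha_x\theta)$ if $\sigma=0$, and Negative-Binomial$(\alpha_x,\frac{\theta}{1+\theta})$ if $\sigma=1$, i.e. $\nu_{x,\theta}(k)=\binom{\alpha_x+k-1}{k}\bigl(\tfrac{\theta}{1+\theta}\bigr)^k(1+\theta)^{-\alpha_x}$; let $\mu_{\bar{\boldsymbol\theta}}=\bigotimes_{x\in V}\nu_{x,\bar\theta_x}$ (the local equilibrium measure). The dual process $\{\xi_t\}$ lives on $\widehat{\mathcal X}=\mathcal X\times\mathbb N_0^{\{L,R\}}$: it has the same bulk jump rates, a particle jumps from $1$ to $L$ at rate $\omega_L\alpha_L\xi(1)$ and from $N$ to $R$ at rate $\omega_R\alpha_R\xi(N)$, and $L,R$ are absorbing. Write $\widehat{\mathbb P}_\xi,\widehat{\mathbb E}_\xi$ for its law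 and expectation from $\xi$, and $\widehat{\mathbb P}^{\rm IRW}_\xi$ for the law in the case $\sigma=0$ with the same $\omega$'s and $\alpha$'s. Let $|\xi|$ be the total number of particles of $\xi$, and let $\{\xi_\infty(L)=|\xi|\}$ be the event that all of them are eventually absorbed at $L$. Order $\widehat{\mathcal X}$ coordinatewise, and for $\zeta\le\xi$ put $\binom{\xi}{\zeta}=\prod_{x\in V}\binom{\xi(x)}{\zeta(x)}$. Define $$\psi(\xi)=\sum_{\zeta\le\xi}\binom{\xi}{\zeta}(-1)^{|\xi|-|\zeta|}\,\widehat{\mathbb P}^{\rm IRW}_{\xi-\zeta}\bigl((\xi-\zeta)_\infty(L)=|\xi-\zeta|\bigr)\,\widehat{\mathbb P}_\zeta\bigl(\zeta_\infty(L)=|\zeta|\bigr),$$ $$\psi_t(\xi)=\sum_{\zeta\le\xi}\binom{\xi}{\zeta}(-1)^{|\xi|-|\zeta|}\,\widehat{\mathbb P}^{\rm IRW}_{\xi-\zeta}\bigl((\xi-\zeta)_\infty(L)=|\xi-\zeta|\bigr)\,\widehat{\mathbb E}_\zeta\Bigl[\widehat{\mathbb P}^{\rm IRW}_{\zeta_t}\bigl(\zeta_\infty(L)=|\zeta|\bigr)\Bigr].$$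 **Theorem.** Let $\boldsymbol\lambda=\{\lambda_x\}_{x\in V}\in\mathbb R^N$ be such that, for all $x\in V$, $1+\sigma\lambda_x(1+\bar\theta_x)\neq0$, $1+\sigma\lambda_x(1-(\theta_L-\theta_R))\ne0$, $$\Lambda_x:=1+\frac{\lambda_x}{1+\sigma\lambda_x(1+\bar\theta_x)}\ge0,\qquad \kappa_x:=\frac{\lambda_x(\theta_L-\theta_R)}{1+\sigma\lambda_x(1-(\theta_L-\theta_R))}\in\varTheta,$$ and, if $\sigma=1$, also $(1+\lambda_x)(1+\lambda_x(1+\bar\theta_x))>0$. Let $\mu_{\boldsymbol\kappa}=\bigotimes_{x\in V}\nu_{x,\kappa_x}$, viewed as a probability measure on $\widehat{\mathcal X}$ concentrated on $\{\xi:\xi(L)=\xi(R)=0\}$, and $$J_{\theta_L,\theta_R,\lambda_x}:=\begin{cases}e^{\alpha_x\lambda_x(\bar\theta_x+(\theta_L-\theta_R))}&\sigma=0,\\[4pt]\left(\dfrac{1+\sigma\lambda_x(1+\bar\theta_x)}{1+\sigma\lambda_x(1-(\theta_L-\theta_R))}\right)^{\sigma\alpha_x}&\sigma\in\{-1,1\}.\end{cases}$$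 Then $$\mathbb E_{\mu_{\theta_L,\theta_R}}\Bigl[\prod_{x\in V}\Lambda_x^{\eta(x)}\Bigr]=\Bigl(\prod_{x\in V}J_{\theta_L,\theta_R,\lambda_x}\Bigr)\,\mathbb E_{\mu_{\boldsymbol\kappa}}[\psi],$$ and, for all $t\ge0$, $$\mathbb E_{\mu_{\bar{\boldsymbol\theta}}}\Bigl[\prod_{x\in V}\Lambda_x^{\eta_t(x)}\Bigr]=\Bigl(\prod_{x\in V}J_{\theta_L,\theta_R,\lambda_x}\Bigr)\,\mathbb E_{\mu_{\boldsymbol\kappa}}[\psi_t],$$ where all the expectations converge absolutely (and $0^0=1$). -/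

import Mathlib

open MeasureTheory Filter

noncomputable section

/-! ### Continuous-time Markov chains on a countable state space -/

namespace MarkovChain

variable {S : Type*}

open Classical in
/-- The rate of the jumps from `x` to `y` of the chain with generator `A`: for `x ≠ y` it is the
value at `x` of `A` applied to the indicator function of `{y}`. -/
def jumpRate (A : (S → ℝ) → S → ℝ) (x y : S) : ENNReal :=
  if x = y then 0 else ENNReal.ofReal (A (Set.indicator {y} 1) x)

/-- The total rate at which the chain with generator `A` leaves the state `x`. -/
def exitRate (A : (S → ℝ) → S → ℝ) (x : S) : ℝ :=
  -A (Set.indicator {x} 1) x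

open Classical in
/-- `jumpTransition A k t x y` is the probability that the chain with generator `A` started from `x`
makes exactly `k` jumps in the time interval `[0, t]` and sits at `y` at time `t`: the chain waits
at `x` for an exponential time `s` of parameter `exitRate A x`, then jumps, with rate
`jumpRate A x z`, to a state `z`, from where `k - 1` jumps lead to `y` in the remaining time. -/
def jumpTransition (A : (S → ℝ) → S → ℝ) : ℕ → ℝ → S → S → ENNReal
  | 0, t, x, y => if x = y then ENNReal.ofReal (Real.exp (-(exitRate A x * t))) else 0
  | k + 1, t, x, y =>
      ∫⁻ s in Set.Icc 0 t, ENNReal.ofReal (Real.exp (-(exitRate A x * s))) *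
        ∑' z, jumpRate A x z * jumpTransition A k (t - s) z y

/-- The transition probabilities `p_t(x, y)` of the chain with generator `A`
(Feller's construction, by summing over the number of jumps). -/
def transition (A : (S → ℝ) → S → ℝ) (t : ℝ) (x y : S) : ENNReal :=
  ∑' k, jumpTransition A k t x y

/-- The law at time `t` of the chain with generator `A` and initial law `μ`. -/
def lawAt [MeasurableSpace S] (A : (S → ℝ) → S → ℝ) (μ : Measure S) (t : ℝ) : Measure S :=
  Measure.sum fun y => (∫⁻ x, transition A t x y ∂μ) • Measure.dirac y

/-- `μ` is a stationary measure of the chain with generator `A`. -/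
def IsStationary [MeasurableSpace S] (A : (S → ℝ) → S → ℝ) (μ : Measure S) : Prop :=
  ∀ t : ℝ, 0 ≤ t → lawAt A μ t = μ

/-- The limiting transition probability `p_∞(x, y) = lim_{t → ∞} p_t(x, y)`. -/
def limitTransition (A : (S → ℝ) → S → ℝ) (x y : S) : ℝ :=
  limUnder atTop fun t : ℝ => (transition A t x y).toReal

end MarkovChain

namespace BoundaryDriven

/-- The underlying geometry: conductances `ω` and site parameters `α` on the bulk
`V = {1, …, N}`, `N = n + 1` (as `Fin (n + 1)`, the site `1` being `0` and the site `N` being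
`Fin.last n`), and the conductances and site parameters of the two reservoirs. -/
structure Geometry (n : ℕ) where
  ω : Fin (n + 1) → Fin (n + 1) → ℝ
  ω_nonneg : ∀ x y, 0 ≤ ω x y
  ω_symm : ∀ x y, ω x y = ω y x
  ω_self : ∀ x, ω x x = 0
  connected : (SimpleGraph.fromRel fun x y => ω x y ≠ 0).Connected
  α : Fin (n + 1) → ℕ
  α_pos : ∀ x, 0 < α x
  ωL : ℝ
  ωR : ℝ
  ωL_nonneg : 0 ≤ ωL
  ωR_nonneg : 0 ≤ ωR
  αL : ℝ
  αR : ℝ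
  αL_pos : 0 < αL
  αR_pos : 0 < αR

variable {n : ℕ}

/-- The configuration space: at most `α x` particles at `x` for the exclusion process (`σ = -1`),
no restriction for independent walkers (`σ = 0`) and the inclusion process (`σ = 1`). -/
abbrev Config (σ : SignType) (G : Geometry n) : Type :=
  {η : Fin (n + 1) → ℕ // σ = -1 → ∀ x, η x ≤ G.α x}

/-- The dual configuration space; `ξ = (bulk, ξ(L), ξ(R))`. -/
abbrev DualConfig (σ : SignType) (G : Geometry n) : Type :=
  Config σ G × ℕ × ℕ

/-- The set `Θ` of the admissible scale parameters. -/
def scaleSet (σ : SignType) : Set ℝ :=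
  if σ = -1 then Set.Icc 0 1 else Set.Ici 0

section Dynamics

variable {σ : SignType} {G : Geometry n}

open Classical in
/-- `f` as a configuration, and the old `η` if `f` is not one (the generators below give
the rate `0` to such transitions, as well as to the removal of a particle from an empty site). -/
def Config.replace (η : Config σ G) (f : Fin (n + 1) → ℕ) : Config σ G :=
  if h : σ = -1 → ∀ x, f x ≤ G.α x then ⟨f, h⟩ else η

/-- `η - δ_x + δ_y` -/
def Config.move (η : Config σ G) (x y : Fin (n + 1)) : Config σ G :=
  η.replace (η.1 - Pi.single x 1 + Pi.single y 1)

/-- `η - δ_x` -/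
def Config.remove (η : Config σ G) (x : Fin (n + 1)) : Config σ G :=
  η.replace (η.1 - Pi.single x 1)

/-- `η + δ_x` -/
def Config.add (η : Config σ G) (x : Fin (n + 1)) : Config σ G :=
  η.replace (η.1 + Pi.single x 1)

end Dynamics

/-- The generator of the particle system in contact with the two reservoirs. -/
def generator (σ : SignType) (G : Geometry n) (θL θR : ℝ) (f : Config σ G → ℝ)
    (η : Config σ G) : ℝ :=
  (∑ x, ∑ y with x < y, G.ω x y *
      ((η.1 x : ℝ) * (G.α y + (σ : ℝ) * η.1 y) * (f (η.move x y) - f η)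
        + (η.1 y : ℝ) * (G.α x + (σ : ℝ) * η.1 x) * (f (η.move y x) - f η)))
  + G.ωL * ((η.1 0 : ℝ) * (G.αL + (σ : ℝ) * G.αL * θL) * (f (η.remove 0) - f η)
      + G.αL * θL * (G.α 0 + (σ : ℝ) * η.1 0) * (f (η.add 0) - f η))
  + G.ωR * ((η.1 (Fin.last n) : ℝ) * (G.αR + (σ : ℝ) * G.αR * θR)
        * (f (η.remove (Fin.last n)) - f η)
      + G.αR * θR * (G.α (Fin.last n) + (σ : ℝ) * η.1 (Fin.last n))
        * (f (η.add (Fin.last n)) - f η))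

/-- The generator of the dual particle system, whose reservoirs are purely absorbing. -/
def dualGenerator (σ : SignType) (G : Geometry n) (f : DualConfig σ G → ℝ)
    (ξ : DualConfig σ G) : ℝ :=
  (∑ x, ∑ y with x < y, G.ω x y *
      ((ξ.1.1 x : ℝ) * (G.α y + (σ : ℝ) * ξ.1.1 y) * (f (ξ.1.move x y, ξ.2) - f ξ)
        + (ξ.1.1 y : ℝ) * (G.α x + (σ : ℝ) * ξ.1.1 x) * (f (ξ.1.move y x, ξ.2) - f ξ)))
  + G.ωL * G.αL * (ξ.1.1 0 : ℝ) * (f (ξ.1.remove 0, ξ.2.1 + 1, ξ.2.2) - f ξ)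
  + G.ωR * G.αR * (ξ.1.1 (Fin.last n) : ℝ)
      * (f (ξ.1.remove (Fin.last n), ξ.2.1, ξ.2.2 + 1) - f ξ)

/-- The single-site weight `ν_{x,θ}(k)`, with `a = α_x`: Binomial `(a, θ)` for `σ = -1`,
Poisson `(a θ)` for `σ = 0`, Negative-Binomial `(a, θ / (1 + θ))` for `σ = 1`. -/
def marginal (σ : SignType) (a : ℕ) (θ : ℝ) (k : ℕ) : ℝ :=
  if σ = -1 then (a.choose k : ℝ) * θ ^ k * (1 - θ) ^ (a - k)
  else if σ = 0 then Real.exp (-(a * θ)) * (a * θ) ^ k / (k.factorial : ℝ)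
  else ((a + k - 1).choose k : ℝ) * (θ / (1 + θ)) ^ k * (1 / (1 + θ)) ^ a

/-- The product measure `⊗_x ν_{x,θ_x}` on the configuration space. -/
def productMeasure (σ : SignType) (G : Geometry n) (θ : Fin (n + 1) → ℝ) :
    Measure (Config σ G) :=
  Measure.sum fun η => ENNReal.ofReal (∏ x, marginal σ (G.α x) (θ x) (η.1 x)) • Measure.dirac η

/-- The same product measure, as a measure on the dual configurations without particles
at `L` and `R`. -/
def dualProductMeasure (σ : SignType) (G : Geometry n) (κ : Fin (n + 1) → ℝ) :
    Measure (DualConfig σ G) :=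
  (productMeasure σ G κ).map fun η => (η, 0, 0)

/-- The profile `E_μ[η(x) / α_x]`. -/
def profile {σ : SignType} {G : Geometry n} (μ : Measure (Config σ G)) (x : Fin (n + 1)) : ℝ :=
  ∫ η, (η.1 x : ℝ) / G.α x ∂μ

section Psi

variable {σ : SignType} {G : Geometry n}

/-- The total number of particles `|ξ|`. -/
def DualConfig.size (ξ : DualConfig σ G) : ℕ :=
  (∑ x, ξ.1.1 x) + ξ.2.1 + ξ.2.2

/-- A dual configuration, as a configuration of dual independent random walkers. -/
def DualConfig.toIRW (ξ : DualConfig σ G) : DualConfig 0 G :=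
  (⟨ξ.1.1, fun h => absurd h (by decide)⟩, ξ.2)

/-- The difference `ξ - ζ`, for `ζ ≤ ξ`. -/
def DualConfig.diff (ξ ζ : DualConfig σ G) : DualConfig σ G :=
  (⟨ξ.1.1 - ζ.1.1, fun h x => (Nat.sub_le _ _).trans (ξ.1.2 h x)⟩, ξ.2.1 - ζ.2.1, ξ.2.2 - ζ.2.2)

/-- `∏_x binom(ξ(x), ζ(x))` -/
def DualConfig.binom (ξ ζ : DualConfig σ G) : ℕ :=
  ∏ x, (ξ.1.1 x).choose (ζ.1.1 x)

/-- The probability that the dual process started from `ξ` has eventually all of its particles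
absorbed at `L`. -/
def absorbedLeft (ξ : DualConfig σ G) : ℝ :=
  MarkovChain.limitTransition (dualGenerator σ G) ξ (⟨0, fun _ _ => Nat.zero_le _⟩, ξ.size, 0)

theorem finite_Iic (ξ : DualConfig σ G) : (Set.Iic ξ).Finite := by
  have hinj : Function.Injective
      (fun ζ : DualConfig σ G => ((ζ.1.1, ζ.2) : (Fin (n + 1) → ℕ) × ℕ × ℕ)) := by
    rintro ⟨⟨a, ha⟩, b⟩ ⟨⟨c, hc⟩, d⟩ h
    simp only [Prod.mk.injEq] at h
    obtain ⟨rfl, rfl⟩ := h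
    rfl
  refine Set.Finite.of_finite_image (f := fun ζ : DualConfig σ G =>
    ((ζ.1.1, ζ.2) : (Fin (n + 1) → ℕ) × ℕ × ℕ)) ?_ hinj.injOn
  refine ((Set.finite_Iic ξ.1.1).prod
    ((Set.finite_Iic ξ.2.1).prod (Set.finite_Iic ξ.2.2))).subset ?_
  rintro _ ⟨ζ, hζ, rfl⟩
  exact ⟨hζ.1, hζ.2.1, hζ.2.2⟩

/-- The finite set of the dual configurations `ζ ≤ ξ`. -/
def DualConfig.below (ξ : DualConfig σ G) : Finset (DualConfig σ G) :=
  (finite_Iic ξ).toFinset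

/-- The function `ψ`. -/
def psi (ξ : DualConfig σ G) : ℝ :=
  ∑ ζ ∈ ξ.below, (ξ.binom ζ : ℝ) * (-1) ^ (ξ.size - ζ.size)
    * absorbedLeft (ξ.diff ζ).toIRW * absorbedLeft ζ

/-- The function `ψ_t`: the particles of `ζ` interact up to time `t` and are
independent afterwards. -/
def psiAt (t : ℝ) (ξ : DualConfig σ G) : ℝ :=
  ∑ ζ ∈ ξ.below, (ξ.binom ζ : ℝ) * (-1) ^ (ξ.size - ζ.size)
    * absorbedLeft (ξ.diff ζ).toIRW
    * ∫ ζ', absorbedLeft ζ'.toIRW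
        ∂(MarkovChain.lawAt (dualGenerator σ G) (Measure.dirac ζ) t)

end Psi

/-- `Λ_x`, as a function of `l = λ_x` and `θ = \bar θ_x`. -/
def bigLambda (σ : SignType) (θ l : ℝ) : ℝ :=
  1 + l / (1 + (σ : ℝ) * l * (1 + θ))

/-- `κ_x`, as a function of `l = λ_x`. -/
def kappa (σ : SignType) (θL θR l : ℝ) : ℝ :=
  l * (θL - θR) / (1 + (σ : ℝ) * l * (1 - (θL - θR)))

/-- `J_{θ_L,θ_R,λ_x}`, as a function of `a = α_x`, `θ = \bar θ_x` and `l = λ_x`. -/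
def factorJ (σ : SignType) (θL θR : ℝ) (a : ℕ) (θ l : ℝ) : ℝ :=
  if σ = 0 then Real.exp (a * l * (θ + (θL - θR)))
  else ((1 + (σ : ℝ) * l * (1 + θ)) / (1 + (σ : ℝ) * l * (1 - (θL - θR)))) ^ ((σ : ℤ) * (a : ℤ))

end BoundaryDriven

end

noncomputable section

namespace MarkovChain

open scoped Topology ENNReal

variable {S ι : Type*} [Fintype ι]

/-- `A` is the generator of a chain which jumps from `x` to `T i x` at rate `r i x`. -/
structure HasRates (A : (S → ℝ) → S → ℝ) (r : ι → S → ℝ) (T : ι → S → S) : Prop where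
  apply_eq : ∀ f x, A f x = ∑ i, r i x * (f (T i x) - f x)
  rate_nonneg : ∀ i x, 0 ≤ r i x

open Classical in
/-- The rates of the proper jumps. -/
def properRate (r : ι → S → ℝ) (T : ι → S → S) (i : ι) (x : S) : ℝ :=
  if T i x = x then 0 else r i x

namespace HasRates

variable {A : (S → ℝ) → S → ℝ} {r : ι → S → ℝ} {T : ι → S → S}

theorem properRate_nonneg (h : HasRates A r T) (i : ι) (x : S) : 0 ≤ properRate r T i x := by
  unfold properRate
  split_ifs
  exacts [le_rfl, h.rate_nonneg i x]

theorem exitRate_eq (h : HasRates A r T) (x : S) :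
    exitRate A x = ∑ i, properRate r T i x := by
  classical
  rw [exitRate, h.apply_eq, ← Finset.sum_neg_distrib]
  refine Finset.sum_congr rfl fun i _ => ?_
  by_cases hx : T i x = x <;> simp [properRate, hx, Set.indicator]

theorem exitRate_nonneg (h : HasRates A r T) (x : S) : 0 ≤ exitRate A x := by
  rw [h.exitRate_eq]
  exact Finset.sum_nonneg fun i _ => h.properRate_nonneg i x

theorem apply_eq_properRate (h : HasRates A r T) (f : S → ℝ) (x : S) :
    A f x = ∑ i, properRate r T i x * f (T i x) - exitRate A x * f x := by
  rw [h.apply_eq, h.exitRate_eq, Finset.sum_mul, ← Finset.sum_sub_distrib]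
  refine Finset.sum_congr rfl fun i _ => ?_
  by_cases hx : T i x = x <;> simp [properRate, hx, mul_sub]

theorem jumpRate_eq (h : HasRates A r T) (x z : S) [DecidableEq S] :
    jumpRate A x z = ∑ i, if T i x = z then ENNReal.ofReal (properRate r T i x) else 0 := by
  by_cases hxz : x = z
  · subst hxz
    simp +contextual [jumpRate, properRate]
  · rw [jumpRate, if_neg hxz, h.apply_eq, ENNReal.ofReal_sum_of_nonneg]
    · refine Finset.sum_congr rfl fun i _ => ?_
      by_cases hz : T i x = z
      · have : T i x ≠ x := fun h => hxz (h.symm.trans hz)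
        simp [hz, properRate, Set.indicator, hxz, Ne.symm hxz]
      · simp [hz, hxz, Set.indicator]
    · intro i _
      refine mul_nonneg (h.rate_nonneg i x) ?_
      simp only [Set.indicator, Set.mem_singleton_iff, hxz, if_false, Pi.one_apply, sub_zero]
      split_ifs <;> norm_num

theorem tsum_jumpRate_mul (h : HasRates A r T) (x : S) (g : S → ℝ≥0∞) :
    ∑' z, jumpRate A x z * g z = ∑ i, ENNReal.ofReal (properRate r T i x) * g (T i x) := by
  classical
  simp_rw [h.jumpRate_eq, Finset.sum_mul]
  rw [Summable.tsum_finsetSum fun _ _ => ENNReal.summable]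
  refine Finset.sum_congr rfl fun i _ => ?_
  rw [tsum_eq_single (T i x)]
  · simp
  · intro z hz
    simp [Ne.symm hz]

end HasRates

/-- The transition semigroup of the chain with generator `A`, on nonnegative functions. -/
def act (A : (S → ℝ) → S → ℝ) (t : ℝ) (g : S → ℝ≥0∞) (x : S) : ℝ≥0∞ :=
  ∑' y, transition A t x y * g y

/-- The contribution to the semigroup of the trajectories with exactly `k` jumps. -/
def jumpAct (A : (S → ℝ) → S → ℝ) (k : ℕ) (t : ℝ) (g : S → ℝ≥0∞) (x : S) : ℝ≥0∞ :=
  ∑' y, jumpTransition A k t x y * g y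

theorem act_eq_tsum (A : (S → ℝ) → S → ℝ) (t : ℝ) (g : S → ℝ≥0∞) (x : S) :
    act A t g x = ∑' k, jumpAct A k t g x := by
  simp only [act, transition, jumpAct, ← ENNReal.tsum_mul_right]
  exact ENNReal.tsum_comm

theorem act_mono (A : (S → ℝ) → S → ℝ) (t : ℝ) {f g : S → ℝ≥0∞} (h : f ≤ g) (x : S) :
    act A t f x ≤ act A t g x :=
  ENNReal.tsum_le_tsum fun y => mul_le_mul_right (h y) _

theorem jumpAct_zero (A : (S → ℝ) → S → ℝ) (t : ℝ) (g : S → ℝ≥0∞) (x : S) :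
    jumpAct A 0 t g x = ENNReal.ofReal (Real.exp (-(exitRate A x * t))) * g x := by
  rw [jumpAct, tsum_eq_single x]
  · simp [jumpTransition]
  · intro y hy
    simp [jumpTransition, Ne.symm hy]

/-- The integral operator of the backward equation. -/
def backward (A : (S → ℝ) → S → ℝ) (u : ℝ → S → ℝ≥0∞) (t : ℝ) (x : S) : ℝ≥0∞ :=
  ∫⁻ s in Set.Icc 0 t, ENNReal.ofReal (Real.exp (-(exitRate A x * s))) *
    ∑' z, jumpRate A x z * u (t - s) z

theorem backward_mono (A : (S → ℝ) → S → ℝ) {u v : ℝ → S → ℝ≥0∞} {t : ℝ}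
    (h : ∀ s ∈ Set.Icc 0 t, ∀ z, u s z ≤ v s z) (x : S) : backward A u t x ≤ backward A v t x := by
  refine setLIntegral_mono' measurableSet_Icc fun s hs => ?_
  gcongr with z
  exact h _ ⟨sub_nonneg.2 hs.2, sub_le_self _ hs.1⟩ z

theorem HasRates.backward_eq {A : (S → ℝ) → S → ℝ} {r : ι → S → ℝ} {T : ι → S → S}
    (h : HasRates A r T) (u : ℝ → S → ℝ≥0∞) (t : ℝ) (x : S) :
    backward A u t x = ∫⁻ s in Set.Icc 0 t, ENNReal.ofReal (Real.exp (-(exitRate A x * s))) *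
      ∑ i, ENNReal.ofReal (properRate r T i x) * u (t - s) (T i x) := by
  simp only [backward, h.tsum_jumpRate_mul]

theorem HasRates.ofReal_eq_add_backward {A : (S → ℝ) → S → ℝ} {r : ι → S → ℝ} {T : ι → S → S}
    (h : HasRates A r T) {u : ℝ → S → ℝ} (hu : ∀ t x, 0 ≤ t → 0 ≤ u t x)
    (hd : ∀ t x, HasDerivAt (fun t => u t x) (A (u t) x) t) (t : ℝ) (x : S) (ht : 0 ≤ t) :
    ENNReal.ofReal (u t x) = ENNReal.ofReal (Real.exp (-(exitRate A x * t)))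
        * ENNReal.ofReal (u 0 x)
      + backward A (fun t x => ENNReal.ofReal (u t x)) t x := by
  set q := exitRate A x with hq
  have hc : ∀ y, Continuous fun t => u t y := fun y =>
    continuous_iff_continuousAt.2 fun t => (hd t y).continuousAt
  set F : ℝ → ℝ := fun s => Real.exp (-(q * s)) * ∑ i, properRate r T i x * u (t - s) (T i x)
  have hFc : Continuous F := by
    refine Continuous.mul (by fun_prop) (continuous_finsetSum _ fun i _ => ?_)
    exact ((hc _).comp (continuous_const.sub continuous_id)).const_mul _
  have hderiv : ∀ s, HasDerivAt (fun s => -(Real.exp (-(q * s)) * u (t - s) x)) (F s) s := by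
    intro s
    have h1 : HasDerivAt (fun s => Real.exp (-(q * s))) (Real.exp (-(q * s)) * (-q)) s := by
      have : HasDerivAt (fun s => -(q * s)) (-q) s :=
        ((hasDerivAt_id s).const_mul q).neg.congr_deriv (by simp)
      exact this.exp
    have h2 : HasDerivAt (fun s => u (t - s) x) (-(A (u (t - s)) x)) s :=
      HasDerivAt.comp_const_sub t s (hd (t - s) x)
    refine (h1.mul h2).neg.congr_deriv ?_
    rw [h.apply_eq_properRate]
    simp only [F]
    ring
  have hint : ∫ s in (0 : ℝ)..t, F s = u t x - Real.exp (-(q * t)) * u 0 x := by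
    rw [intervalIntegral.integral_eq_sub_of_hasDerivAt (fun s _ => hderiv s)
      (hFc.intervalIntegrable _ _)]
    simp
    ring
  have hF0 : ∀ s ∈ Set.Icc 0 t, 0 ≤ F s := fun s hs => mul_nonneg (Real.exp_pos _).le <|
    Finset.sum_nonneg fun i _ => mul_nonneg (h.properRate_nonneg i x)
      (hu _ _ (sub_nonneg.2 hs.2))
  have hback : backward A (fun t x => ENNReal.ofReal (u t x)) t x
      = ENNReal.ofReal (∫ s in (0 : ℝ)..t, F s) := by
    rw [h.backward_eq, intervalIntegral.integral_of_le ht, ← integral_Icc_eq_integral_Ioc,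
      ofReal_integral_eq_lintegral_ofReal hFc.integrableOn_Icc
        ((ae_restrict_iff' measurableSet_Icc).2 (Eventually.of_forall hF0))]
    refine setLIntegral_congr_fun measurableSet_Icc fun s hs => ?_
    simp only [F]
    rw [ENNReal.ofReal_mul (Real.exp_pos _).le, ENNReal.ofReal_sum_of_nonneg]
    · congr 1
      refine Finset.sum_congr rfl fun i _ => ?_
      rw [ENNReal.ofReal_mul (h.properRate_nonneg i x)]
    · exact fun i _ => mul_nonneg (h.properRate_nonneg i x) (hu _ _ (sub_nonneg.2 hs.2))
  rw [hback, hint, ← ENNReal.ofReal_mul (Real.exp_pos _).le, ← ENNReal.ofReal_add]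
  · congr 1
    ring
  · exact mul_nonneg (Real.exp_pos _).le (hu _ _ le_rfl)
  · rw [← hint]
    exact intervalIntegral.integral_nonneg ht hF0

theorem HasRates.eq_zero_of_eq_backward {A : (S → ℝ) → S → ℝ} {r : ι → S → ℝ} {T : ι → S → S}
    (h : HasRates A r T) {V W : S → ℝ} {c : ℝ} (hc : 0 ≤ c) (hW : ∀ x, 0 < W x)
    (hAW : ∀ x, A W x ≤ c * W x) (hVW : Tendsto (fun x => V x / W x) cofinite (𝓝 0))
    {v : ℝ → S → ℝ≥0∞} (hv : ∀ t x, 0 ≤ t → v t x = backward A v t x)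
    (hvV : ∀ t x, 0 ≤ t → v t x ≤ ENNReal.ofReal (Real.exp (c * t) * V x))
    (t : ℝ) (ht : 0 ≤ t) (x : S) : v t x = 0 := by
  set lam := c + 1 with hlam
  set N : S → ℝ≥0∞ := fun x => ⨆ t : Set.Ici (0 : ℝ),
    v t x * ENNReal.ofReal (Real.exp (-(lam * t)))
  have hNV : ∀ x, N x ≤ ENNReal.ofReal (V x) := by
    refine fun x => iSup_le fun ⟨t, ht⟩ => ?_
    have ht' : (0 : ℝ) ≤ t := ht
    rcases le_total (V x) 0 with hV | hV
    · have := hvV t x ht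
      rw [ENNReal.ofReal_of_nonpos (mul_nonpos_of_nonneg_of_nonpos (Real.exp_pos _).le hV)] at this
      simp [nonpos_iff_eq_zero.1 this]
    · calc _ ≤ ENNReal.ofReal (Real.exp (c * t) * V x) * ENNReal.ofReal (Real.exp (-(lam * t))) :=
            mul_le_mul_left (hvV t x ht) _
        _ = ENNReal.ofReal (Real.exp (-t) * V x) := by
            rw [← ENNReal.ofReal_mul (by positivity)]
            congr 1
            rw [mul_right_comm, ← Real.exp_add]
            congr 2
            rw [hlam]
            ring
        _ ≤ _ := by
            refine ENNReal.ofReal_le_ofReal (mul_le_of_le_one_left hV ?_)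
            exact Real.exp_le_one_iff.2 (by linarith)
  have hNtop : ∀ x, N x ≠ ⊤ := fun x => ne_top_of_le_ne_top ENNReal.ofReal_ne_top (hNV x)
  set ρ : S → ℝ := fun x => (N x).toReal / W x
  have hvρ : ∀ t x, 0 ≤ t → v t x ≤ ENNReal.ofReal (ρ x * W x * Real.exp (lam * t)) := by
    intro t x ht
    have h1 : v t x * ENNReal.ofReal (Real.exp (-(lam * t))) ≤ N x :=
      le_iSup (fun t : Set.Ici (0 : ℝ) => v t x * ENNReal.ofReal (Real.exp (-(lam * t)))) ⟨t, ht⟩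
    rw [ENNReal.ofReal_mul' (Real.exp_pos _).le, div_mul_cancel₀ _ (hW x).ne',
      ENNReal.ofReal_toReal (hNtop x)]
    calc v t x = v t x * ENNReal.ofReal (Real.exp (-(lam * t)))
          * ENNReal.ofReal (Real.exp (lam * t)) := by
          rw [mul_assoc, ← ENNReal.ofReal_mul (Real.exp_pos _).le, ← Real.exp_add]
          simp
      _ ≤ _ := mul_le_mul_left h1 _
  suffices hρ : ∀ x, ρ x ≤ 0 by
    have h1 := hvρ t x ht
    rw [ENNReal.ofReal_of_nonpos] at h1
    · exact nonpos_iff_eq_zero.1 h1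
    · exact mul_nonpos_of_nonpos_of_nonneg
        (mul_nonpos_of_nonpos_of_nonneg (hρ x) (hW x).le) (Real.exp_pos _).le
  by_contra! hcon
  obtain ⟨x₀, hx₀⟩ := hcon
  have hρV : ∀ x, ρ x₀ ≤ ρ x → ρ x₀ ≤ V x / W x := by
    intro x hx
    refine hx.trans (div_le_div_of_nonneg_right ?_ (hW x).le)
    refine (ENNReal.toReal_mono ENNReal.ofReal_ne_top (hNV x)).trans ?_
    rcases le_total (V x) 0 with hV | hV
    · exfalso
      have h1 := hNV x
      rw [ENNReal.ofReal_of_nonpos hV, nonpos_iff_eq_zero] at h1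
      have : ρ x = 0 := by simp [ρ, h1]
      linarith
    · rw [ENNReal.toReal_ofReal hV]
  have hfin : {x | ρ x₀ ≤ ρ x}.Finite := by
    have h1 := hVW.eventually (gt_mem_nhds hx₀)
    rw [eventually_cofinite] at h1
    exact h1.subset fun x hx => not_lt.2 (hρV x hx)
  obtain ⟨y, hy, hmax⟩ := Set.exists_max_image _ ρ hfin ⟨x₀, le_refl (ρ x₀)⟩
  have hmax' : ∀ x, ρ x ≤ ρ y := by
    intro x
    by_cases hx : ρ x₀ ≤ ρ x
    · exact hmax x hx
    · exact (not_le.1 hx).le.trans hy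
  have hy0 : 0 < ρ y := hx₀.trans_le hy
  set q := exitRate A y with hq
  have hq0 : 0 ≤ q := h.exitRate_nonneg y
  have hsum : ∑ i, properRate r T i y * W (T i y) ≤ (q + c) * W y := by
    have := hAW y
    rw [h.apply_eq_properRate] at this
    linarith
  have hbound : ∀ t, 0 ≤ t → v t y * ENNReal.ofReal (Real.exp (-(lam * t)))
      ≤ ENNReal.ofReal (ρ y * ((q + c) * W y) / (q + lam)) := by
    intro t ht
    have hstep : v t y ≤ ENNReal.ofReal (∫ s in (0 : ℝ)..t, Real.exp (-(q * s)) *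
        (ρ y * ((q + c) * W y) * Real.exp (lam * (t - s)))) := by
      rw [hv t y ht, h.backward_eq, intervalIntegral.integral_of_le ht,
        ← integral_Icc_eq_integral_Ioc, ofReal_integral_eq_lintegral_ofReal]
      · refine setLIntegral_mono' measurableSet_Icc fun s hs => ?_
        rw [ENNReal.ofReal_mul (Real.exp_pos _).le]
        gcongr
        calc _ ≤ ∑ i, ENNReal.ofReal (properRate r T i y)
                * ENNReal.ofReal (ρ y * W (T i y) * Real.exp (lam * (t - s))) := by
              gcongr with i
              refine (hvρ _ _ (sub_nonneg.2 hs.2)).trans (ENNReal.ofReal_le_ofReal ?_)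
              have := (hW (T i y)).le
              gcongr
              exact hmax' _
          _ = ENNReal.ofReal (∑ i, properRate r T i y
                * (ρ y * W (T i y) * Real.exp (lam * (t - s)))) := by
              rw [ENNReal.ofReal_sum_of_nonneg]
              · refine Finset.sum_congr rfl fun i _ => ?_
                rw [ENNReal.ofReal_mul (h.properRate_nonneg i y)]
              · intro i _
                have := (hW (T i y)).le
                have := h.properRate_nonneg i y
                positivity
          _ ≤ _ := by
              refine ENNReal.ofReal_le_ofReal ?_
              calc _ = ρ y * (∑ i, properRate r T i y * W (T i y))
                    * Real.exp (lam * (t - s)) := by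
                    rw [Finset.mul_sum, Finset.sum_mul]
                    exact Finset.sum_congr rfl fun i _ => by ring
                _ ≤ _ := by gcongr
      · exact Continuous.integrableOn_Icc (by fun_prop)
      · refine Eventually.of_forall fun s => ?_
        have := (hW y).le
        simp only [Pi.zero_apply]
        positivity
    have hval : ∫ s in (0 : ℝ)..t, Real.exp (-(q * s)) *
        (ρ y * ((q + c) * W y) * Real.exp (lam * (t - s)))
        = ρ y * ((q + c) * W y) / (q + lam)
          * (Real.exp (lam * t) - Real.exp (-(q * t))) := by
      have hd : ∀ s, HasDerivAt (fun s => -(ρ y * ((q + c) * W y) / (q + lam)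
          * Real.exp (lam * t - (q + lam) * s))) (Real.exp (-(q * s)) *
          (ρ y * ((q + c) * W y) * Real.exp (lam * (t - s)))) s := by
        intro s
        have h1 : HasDerivAt (fun s => lam * t - (q + lam) * s) (-(q + lam)) s := by
          simpa using ((hasDerivAt_id s).const_mul (q + lam)).const_sub (lam * t)
        refine (h1.exp.const_mul (ρ y * ((q + c) * W y) / (q + lam))).neg.congr_deriv ?_
        have h2 : Real.exp (lam * t - (q + lam) * s)
            = Real.exp (-(q * s)) * Real.exp (lam * (t - s)) := by
          rw [← Real.exp_add]
          congr 1
          ring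
        have h3 : q + lam ≠ 0 := by positivity
        rw [h2]
        field_simp
      rw [intervalIntegral.integral_eq_sub_of_hasDerivAt (fun s _ => hd s)
        (Continuous.intervalIntegrable (by fun_prop) _ _)]
      have h4 : lam * t - (q + lam) * t = -(q * t) := by ring
      rw [h4, mul_zero, sub_zero]
      ring
    have hWy := (hW y).le
    calc _ ≤ ENNReal.ofReal (ρ y * ((q + c) * W y) / (q + lam) * Real.exp (lam * t))
          * ENNReal.ofReal (Real.exp (-(lam * t))) := by
          refine mul_le_mul_left (hstep.trans (ENNReal.ofReal_le_ofReal ?_)) _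
          rw [hval]
          gcongr
          exact sub_le_self _ (Real.exp_pos _).le
      _ = _ := by
          rw [← ENNReal.ofReal_mul (by positivity), mul_assoc, ← Real.exp_add]
          simp
  have hNy : N y ≤ ENNReal.ofReal (ρ y * ((q + c) * W y) / (q + lam)) :=
    iSup_le fun t => hbound t t.2
  have hWy := hW y
  have h1 : ρ y * W y ≤ ρ y * ((q + c) * W y) / (q + lam) := by
    rw [div_mul_cancel₀ _ hWy.ne']
    exact ENNReal.toReal_le_of_le_ofReal (by positivity) hNy
  rw [le_div_iff₀ (by positivity)] at h1
  nlinarith [mul_pos hy0 hWy]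

variable [Countable S]

theorem measurable_jumpTransition (A : (S → ℝ) → S → ℝ) (k : ℕ) (x y : S) :
    Measurable fun t => jumpTransition A k t x y := by
  induction k generalizing x with
  | zero =>
    simp only [jumpTransition]
    split_ifs <;> fun_prop
  | succ k ih =>
    have heq : (fun t => jumpTransition A (k + 1) t x y) = fun t => ∫⁻ s,
        {p : ℝ × ℝ | 0 ≤ p.2 ∧ p.2 ≤ p.1}.indicator (fun p =>
          ENNReal.ofReal (Real.exp (-(exitRate A x * p.2))) *
            ∑' z, jumpRate A x z * jumpTransition A k (p.1 - p.2) z y) (t, s) := by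
      funext t
      rw [jumpTransition, ← lintegral_indicator measurableSet_Icc]
      rfl
    rw [heq]
    refine Measurable.lintegral_prod_right' (f := _) ?_
    refine Measurable.indicator ?_ ?_
    · refine Measurable.mul (by fun_prop) ?_
      refine Measurable.tsum fun z => Measurable.const_mul ?_ _
      exact (ih z).comp (measurable_fst.sub measurable_snd)
    · exact (measurableSet_le measurable_const measurable_snd).inter
        (measurableSet_le measurable_snd measurable_fst)

theorem measurable_jumpAct (A : (S → ℝ) → S → ℝ) (k : ℕ) (g : S → ℝ≥0∞) (x : S) :
    Measurable fun t => jumpAct A k t g x :=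
  Measurable.tsum fun y => (measurable_jumpTransition A k x y).mul_const _

theorem measurable_act (A : (S → ℝ) → S → ℝ) (g : S → ℝ≥0∞) (x : S) :
    Measurable fun t => act A t g x := by
  simp_rw [act_eq_tsum]
  exact Measurable.tsum fun k => measurable_jumpAct A k g x

theorem measurable_backward_integrand (A : (S → ℝ) → S → ℝ) {u : ℝ → S → ℝ≥0∞}
    (hu : ∀ x, Measurable fun t => u t x) (t : ℝ) (x : S) :
    Measurable fun s => ENNReal.ofReal (Real.exp (-(exitRate A x * s))) *
      ∑' z, jumpRate A x z * u (t - s) z := by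
  refine Measurable.mul (by fun_prop) ?_
  exact Measurable.tsum fun z =>
    ((hu z).comp (measurable_const.sub measurable_id)).const_mul _

theorem backward_add (A : (S → ℝ) → S → ℝ) {u v : ℝ → S → ℝ≥0∞}
    (hu : ∀ x, Measurable fun t => u t x) (t : ℝ) (x : S) :
    backward A (fun s z => u s z + v s z) t x = backward A u t x + backward A v t x := by
  rw [backward, backward, backward, ← lintegral_add_left (measurable_backward_integrand A hu t x)]
  simp_rw [mul_add, ENNReal.tsum_add, mul_add]

theorem backward_tsum (A : (S → ℝ) → S → ℝ) {u : ℕ → ℝ → S → ℝ≥0∞}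
    (hu : ∀ k x, Measurable fun t => u k t x) (t : ℝ) (x : S) :
    backward A (fun s z => ∑' k, u k s z) t x = ∑' k, backward A (u k) t x := by
  simp only [backward]
  rw [← lintegral_tsum fun k => (measurable_backward_integrand A (hu k) t x).aemeasurable]
  refine lintegral_congr fun s => ?_
  rw [ENNReal.tsum_mul_left, ENNReal.tsum_comm]
  simp_rw [ENNReal.tsum_mul_left]

theorem jumpAct_succ (A : (S → ℝ) → S → ℝ) (k : ℕ) (t : ℝ) (g : S → ℝ≥0∞) (x : S) :
    jumpAct A (k + 1) t g x = backward A (fun s z => jumpAct A k s g z) t x := by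
  simp only [jumpAct, jumpTransition, backward]
  have hm : ∀ y, Measurable fun s => ENNReal.ofReal (Real.exp (-(exitRate A x * s))) *
      ∑' z, jumpRate A x z * jumpTransition A k (t - s) z y := fun y =>
    measurable_backward_integrand A (u := fun s z => jumpTransition A k s z y)
      (fun z => measurable_jumpTransition A k z y) t x
  simp_rw [← lintegral_mul_const _ (hm _)]
  rw [← lintegral_tsum fun y => ((hm y).mul_const _).aemeasurable]
  refine lintegral_congr fun s => ?_
  simp_rw [← ENNReal.tsum_mul_left, ← ENNReal.tsum_mul_right]
  rw [ENNReal.tsum_comm]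
  refine tsum_congr fun z => tsum_congr fun y => ?_
  ring

theorem act_eq_add_backward (A : (S → ℝ) → S → ℝ) (t : ℝ) (g : S → ℝ≥0∞) (x : S) :
    act A t g x = ENNReal.ofReal (Real.exp (-(exitRate A x * t))) * g x
      + backward A (fun s z => act A s g z) t x := by
  simp_rw [act_eq_tsum]
  rw [tsum_eq_zero_add' ENNReal.summable, jumpAct_zero,
    backward_tsum A fun k x => measurable_jumpAct A k g x]
  simp_rw [jumpAct_succ]

theorem act_le_of_eq_add_backward (A : (S → ℝ) → S → ℝ) {u : ℝ → S → ℝ≥0∞} {g : S → ℝ≥0∞}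
    (hu : ∀ t x, 0 ≤ t → u t x = ENNReal.ofReal (Real.exp (-(exitRate A x * t))) * g x
      + backward A u t x) (t : ℝ) (ht : 0 ≤ t) (x : S) : act A t g x ≤ u t x := by
  rw [act_eq_tsum, ENNReal.tsum_eq_iSup_nat]
  refine iSup_le fun m => ?_
  induction m generalizing t x with
  | zero => simp
  | succ m ih =>
    have key : backward A (fun s z => ∑ k ∈ Finset.range m, jumpAct A k s g z) t x
        = ∑ k ∈ Finset.range m, jumpAct A (k + 1) t g x := by
      simp_rw [jumpAct_succ]
      clear ih
      induction m with
      | zero => simp [backward]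
      | succ m ih =>
        simp_rw [Finset.sum_range_succ]
        rw [backward_add A, ih]
        exact fun x => Finset.measurable_sum _ fun k _ => measurable_jumpAct A k g x
    rw [Finset.sum_range_succ', ← key, jumpAct_zero, hu t x ht, add_comm]
    gcongr
    exact backward_mono A (fun s hs z => ih s hs.1 z) x

/-- A solution of the backward equation which grows less than a Lyapunov function is given by the
transition probabilities. -/
theorem HasRates.act_eq_ofReal {A : (S → ℝ) → S → ℝ} {r : ι → S → ℝ} {T : ι → S → S}
    (h : HasRates A r T) {V W : S → ℝ} {c : ℝ} (hc : 0 ≤ c) (hW : ∀ x, 0 < W x)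
    (hAW : ∀ x, A W x ≤ c * W x) (hVW : Tendsto (fun x => V x / W x) cofinite (𝓝 0))
    {u : ℝ → S → ℝ} (hu : ∀ t x, 0 ≤ t → 0 ≤ u t x)
    (hd : ∀ t x, HasDerivAt (fun t => u t x) (A (u t) x) t)
    (huV : ∀ t x, 0 ≤ t → u t x ≤ Real.exp (c * t) * V x) (t : ℝ) (ht : 0 ≤ t) (x : S) :
    act A t (fun y => ENNReal.ofReal (u 0 y)) x = ENNReal.ofReal (u t x) := by
  set g : S → ℝ≥0∞ := fun y => ENNReal.ofReal (u 0 y)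
  have hu' := h.ofReal_eq_add_backward hu hd
  have hle : ∀ t, 0 ≤ t → ∀ x, act A t g x ≤ ENNReal.ofReal (u t x) := fun t ht x =>
    act_le_of_eq_add_backward A (u := fun t x => ENNReal.ofReal (u t x)) hu' t ht x
  set v : ℝ → S → ℝ≥0∞ := fun t x => ENNReal.ofReal (u t x) - act A t g x
  have hadd : ∀ t, 0 ≤ t → ∀ x, act A t g x + v t x = ENNReal.ofReal (u t x) := fun t ht x =>
    add_tsub_cancel_of_le (hle t ht x)
  have htop : ∀ t, 0 ≤ t → ∀ x, act A t g x ≠ ⊤ := fun t ht x =>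
    ne_top_of_le_ne_top ENNReal.ofReal_ne_top (hle t ht x)
  have hv : ∀ t x, 0 ≤ t → v t x = backward A v t x := by
    intro t x ht
    have h1 : backward A (fun t x => ENNReal.ofReal (u t x)) t x
        = backward A (fun s z => act A s g z) t x + backward A v t x := by
      rw [← backward_add A fun x => measurable_act A g x]
      refine le_antisymm (backward_mono A (fun s hs z => ?_) x)
        (backward_mono A (fun s hs z => ?_) x)
      exacts [(hadd s hs.1 z).ge, (hadd s hs.1 z).le]
    have h2 := hadd t ht x
    rw [hu' t x ht, h1, ← add_assoc] at h2
    change _ = _ * g x + _ + _ at h2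
    rw [← act_eq_add_backward] at h2
    exact (ENNReal.add_right_inj (htop t ht x)).1 h2
  have hv0 := h.eq_zero_of_eq_backward hc hW hAW hVW hv
    (fun t x ht => tsub_le_self.trans (ENNReal.ofReal_le_ofReal (huV t x ht))) t ht x
  rw [← hadd t ht x, hv0, add_zero]

end MarkovChain

namespace MarkovChain

open scoped Topology ENNReal

/-! ### Chains which live on finite classes -/

/-- The semigroup of a chain with generator `A`, as an exponential series. -/
def expAct {S : Type*} (A : (S → ℝ) → S → ℝ) (t : ℝ) (g : S → ℝ) (x : S) : ℝ :=
  ∑' n : ℕ, ((n.factorial : ℝ)⁻¹ * t ^ n) * (A^[n] g) x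

/-- The jumps conserve a quantity with finite sublevel sets. -/
structure Conserves {S ι : Type*} (r : ι → S → ℝ) (T : ι → S → S) (size : S → ℕ) : Prop where
  finite : ∀ k, {x | size x ≤ k}.Finite
  size_eq : ∀ i x, r i x ≠ 0 → size (T i x) = size x

section Block

variable {S ι : Type*} [Fintype ι] (r : ι → S → ℝ) (T : ι → S → S) (size : S → ℕ)

open Classical in
/-- The generator on the functions on a finite class. -/
def blockGen (k : ℕ) : ({x // size x ≤ k} → ℝ) →L[ℝ] ({x // size x ≤ k} → ℝ) :=
  ContinuousLinearMap.pi fun x => ∑ i, r i x.1 •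
    ((if h : size (T i x.1) ≤ k then ContinuousLinearMap.proj (R := ℝ)
        (φ := fun _ : {x // size x ≤ k} => ℝ) ⟨T i x.1, h⟩ else 0)
      - ContinuousLinearMap.proj x)

variable {r T size} {A : (S → ℝ) → S → ℝ}

theorem HasRates.blockGen_restrict (h : HasRates A r T) (hs : Conserves r T size) (k : ℕ)
    (g : S → ℝ) : blockGen r T size k (fun x => g x) = fun x => A g x.1 := by
  funext x
  simp only [blockGen, ContinuousLinearMap.coe_pi', sum_apply,
    smul_apply, sub_apply, ContinuousLinearMap.proj_apply,
    smul_eq_mul, h.apply_eq]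
  refine Finset.sum_congr rfl fun i _ => ?_
  by_cases hr : r i x.1 = 0
  · simp [hr]
  · rw [dif_pos ((hs.size_eq i x.1 hr).le.trans x.2)]
    rfl

theorem HasRates.blockGen_pow_restrict (h : HasRates A r T) (hs : Conserves r T size) (k m : ℕ)
    (g : S → ℝ) : (blockGen r T size k ^ m) (fun x => g x) = fun x => (A^[m] g) x.1 := by
  induction m generalizing g with
  | zero => rfl
  | succ m ih =>
    rw [pow_succ, mul_apply_eq_comp, h.blockGen_restrict hs, Function.iterate_succ_apply]
    exact ih (A g)

variable (k : ℕ) [Fintype {x // size x ≤ k}]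

theorem HasRates.hasSum_block (h : HasRates A r T) (hs : Conserves r T size) (t : ℝ)
    (g : S → ℝ) (x : {x // size x ≤ k}) :
    HasSum (fun m : ℕ => ((m.factorial : ℝ)⁻¹ * t ^ m) * (A^[m] g) x)
      (NormedSpace.exp (t • blockGen r T size k) (fun y => g y) x) := by
  have h1 := NormedSpace.exp_series_hasSum_exp' (𝕂 := ℝ) (t • blockGen r T size k)
  have h2 := ((ContinuousLinearMap.proj (R := ℝ) (φ := fun _ : {x // size x ≤ k} => ℝ) x).comp
    (ContinuousLinearMap.apply ℝ ({x // size x ≤ k} → ℝ) (fun y => g y.1))).hasSum h1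
  refine h2.congr_fun fun m => ?_
  simp only [smul_pow, ContinuousLinearMap.comp_apply, map_smul, ContinuousLinearMap.apply_apply,
    ContinuousLinearMap.proj_apply, h.blockGen_pow_restrict hs, smul_eq_mul,
    mul_assoc]

theorem HasRates.expAct_eq_block (h : HasRates A r T) (hs : Conserves r T size) (t : ℝ)
    (g : S → ℝ) (x : {x // size x ≤ k}) :
    expAct A t g x = NormedSpace.exp (t • blockGen r T size k) (fun y => g y) x :=
  (h.hasSum_block k hs t g x).tsum_eq

theorem HasRates.exp_block_nonneg (h : HasRates A r T) {t : ℝ} (ht : 0 ≤ t)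
    {g : {x // size x ≤ k} → ℝ} (hg : 0 ≤ g) :
    0 ≤ NormedSpace.exp (t • blockGen r T size k) g := by
  let : NormedAlgebra ℚ (({x // size x ≤ k} → ℝ) →L[ℝ] ({x // size x ≤ k} → ℝ)) :=
    NormedAlgebra.restrictScalars ℚ ℝ _
  set B := blockGen r T size k
  set c : ℝ := ∑ x : {x // size x ≤ k}, ∑ i, r i x.1
  set N := B + algebraMap ℝ _ c with hN
  have hNg : ∀ g : {x // size x ≤ k} → ℝ, 0 ≤ g → 0 ≤ N g := by
    intro g hg x
    have h1 : ∑ i, r i x.1 ≤ c := Finset.single_le_sum (f := fun x : {x // size x ≤ k} =>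
      ∑ i, r i x.1) (fun y _ => Finset.sum_nonneg fun i _ => h.rate_nonneg i y.1)
      (Finset.mem_univ x)
    have h2 : -(∑ i, r i x.1) * g x ≤ B g x := by
      simp only [B, blockGen, ContinuousLinearMap.coe_pi', sum_apply,
        smul_apply, sub_apply,
        ContinuousLinearMap.proj_apply, smul_eq_mul]
      rw [← Finset.sum_neg_distrib, Finset.sum_mul]
      refine Finset.sum_le_sum fun i _ => ?_
      have hr := h.rate_nonneg i x.1
      split_ifs with hk
      · have := mul_nonneg hr (hg ⟨T i x.1, hk⟩)
        simp only [ContinuousLinearMap.proj_apply] at this ⊢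
        linarith
      · simp
    have h3 := mul_le_mul_of_nonneg_right h1 (hg x)
    simp only [hN, add_apply, Pi.add_apply, Algebra.algebraMap_eq_smul_one,
      smul_apply, one_apply_eq_self, Pi.smul_apply, smul_eq_mul,
      Pi.zero_apply] at h2 h3 ⊢
    linarith
  have hpow : ∀ (m : ℕ) (g : {x // size x ≤ k} → ℝ), 0 ≤ g → 0 ≤ (N ^ m) g := by
    intro m
    induction m with
    | zero => exact fun g hg => hg
    | succ m ih =>
      intro g hg
      rw [pow_succ, mul_apply_eq_comp]
      exact ih _ (hNg g hg)
  have hexpN : 0 ≤ NormedSpace.exp (t • N) g := by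
    intro x
    have h1 := NormedSpace.exp_series_hasSum_exp' (𝕂 := ℝ) (t • N)
    have h2 := ((ContinuousLinearMap.proj (R := ℝ) (φ := fun _ : {x // size x ≤ k} => ℝ) x).comp
      (ContinuousLinearMap.apply ℝ ({x // size x ≤ k} → ℝ) g)).hasSum h1
    refine h2.nonneg fun m => ?_
    have := hpow m g hg x
    simp only [smul_pow, ContinuousLinearMap.comp_apply, map_smul,
      ContinuousLinearMap.apply_apply, ContinuousLinearMap.proj_apply, smul_eq_mul]
    simp only [Pi.zero_apply] at this
    positivity
  have hsplit : t • B = algebraMap ℝ _ (-(t * c)) + t • N := by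
    rw [hN, smul_add, Algebra.smul_def t (algebraMap ℝ _ c), ← map_mul, map_neg]
    abel
  rw [hsplit, NormedSpace.exp_add_of_commute (Algebra.commutes _ _),
    ← NormedSpace.algebraMap_exp_comm, Algebra.algebraMap_eq_smul_one, ← Real.exp_eq_exp_ℝ]
  intro x
  have := hexpN x
  simp only [mul_apply_eq_comp, smul_apply,
    one_apply_eq_self, Pi.smul_apply, smul_eq_mul]
  exact mul_nonneg (Real.exp_pos _).le this

end Block

theorem Conserves.size_tendsto {S ι : Type*} {r : ι → S → ℝ} {T : ι → S → S} {size : S → ℕ}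
    (hs : Conserves r T size) :
    Tendsto (fun x => (1 + size x : ℝ)⁻¹) cofinite (𝓝 0) := by
  have h1 : Tendsto size cofinite atTop := by
    rw [tendsto_atTop]
    intro k
    rw [eventually_cofinite]
    exact (hs.finite k).subset fun x hx => (not_le.1 hx).le
  have h2 : Tendsto (fun k : ℕ => (1 + k : ℝ)⁻¹) atTop (𝓝 0) := by
    refine tendsto_inv_atTop_zero.comp ?_
    exact tendsto_atTop_add_const_left _ _ tendsto_natCast_atTop_atTop
  exact h2.comp h1

namespace HasRates

variable {S ι : Type*} [Fintype ι] {r : ι → S → ℝ} {T : ι → S → S} {size : S → ℕ}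
  {A : (S → ℝ) → S → ℝ}

theorem hasSum_expAct (h : HasRates A r T) (hs : Conserves r T size) (t : ℝ) (g : S → ℝ)
    (x : S) : HasSum (fun m : ℕ => ((m.factorial : ℝ)⁻¹ * t ^ m) * (A^[m] g) x)
      (expAct A t g x) := by
  let := (hs.finite (size x)).fintype
  let : Fintype {y // size y ≤ size x} := this
  exact (h.hasSum_block (size x) hs t g ⟨x, le_rfl⟩).summable.hasSum

theorem hasDerivAt_expAct (h : HasRates A r T) (hs : Conserves r T size) (t : ℝ) (g : S → ℝ)
    (x : S) : HasDerivAt (fun t => expAct A t g x) (A (expAct A t g) x) t := by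
  let : Fintype {y // size y ≤ size x} := (hs.finite (size x)).fintype
  have h1 := hasDerivAt_exp_smul_const' (𝕂 := ℝ) (blockGen r T size (size x)) t
  have h2 := ((ContinuousLinearMap.proj (R := ℝ) (φ := fun _ : {y // size y ≤ size x} => ℝ)
    ⟨x, le_rfl⟩).comp (ContinuousLinearMap.apply ℝ ({y // size y ≤ size x} → ℝ)
      (fun y => g y.1))).hasFDerivAt.comp_hasDerivAt t h1
  have h3 : (fun t => expAct A t g x) = fun t =>
      NormedSpace.exp (t • blockGen r T size (size x)) (fun y => g y) ⟨x, le_rfl⟩ :=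
    funext fun t => h.expAct_eq_block (size x) hs t g ⟨x, le_rfl⟩
  rw [h3]
  refine h2.congr_deriv ?_
  have h4 : NormedSpace.exp (t • blockGen r T size (size x)) (fun y => g y)
      = fun y => expAct A t g y.1 :=
    funext fun y => (h.expAct_eq_block (size x) hs t g y).symm
  simp only [ContinuousLinearMap.comp_apply, ContinuousLinearMap.apply_apply,
    ContinuousLinearMap.proj_apply, mul_apply_eq_comp, h4, h.blockGen_restrict hs]

theorem expAct_nonneg (h : HasRates A r T) (hs : Conserves r T size) {t : ℝ} (ht : 0 ≤ t)
    {g : S → ℝ} (hg : ∀ x, 0 ≤ g x) (x : S) : 0 ≤ expAct A t g x := by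
  let : Fintype {y // size y ≤ size x} := (hs.finite (size x)).fintype
  rw [h.expAct_eq_block (size x) hs t g ⟨x, le_rfl⟩]
  exact h.exp_block_nonneg (size x) ht (fun y => hg y.1) _

theorem iterate_congr (h : HasRates A r T) (hs : Conserves r T size) {f g : S → ℝ} {k : ℕ}
    (hfg : ∀ y, size y = k → f y = g y) (m : ℕ) {x : S} (hx : size x = k) :
    (A^[m] f) x = (A^[m] g) x := by
  induction m generalizing f g with
  | zero => exact hfg x hx
  | succ m ih =>
    refine ih fun y hy => ?_
    rw [h.apply_eq, h.apply_eq]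
    refine Finset.sum_congr rfl fun i _ => ?_
    by_cases hr : r i y = 0
    · simp [hr]
    · rw [hfg y hy, hfg (T i y) ((hs.size_eq i y hr).trans hy)]

theorem expAct_congr (h : HasRates A r T) (hs : Conserves r T size) (t : ℝ) {f g : S → ℝ} {x : S}
    (hfg : ∀ y, size y = size x → f y = g y) : expAct A t f x = expAct A t g x := by
  simp only [expAct, h.iterate_congr hs hfg _ rfl]

/-- Intertwining of the generators gives intertwining of the semigroups. -/
theorem expAct_map (h : HasRates A r T) (hs : Conserves r T size) {S' : Type*}
    {A' : (S' → ℝ) → S' → ℝ} (L : (S → ℝ) →L[ℝ] (S' → ℝ)) (hL : ∀ f, L (A f) = A' (L f))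
    (t : ℝ) (g : S → ℝ) : expAct A' t (L g) = L (expAct A t g) := by
  have h1 : HasSum (fun m : ℕ => ((m.factorial : ℝ)⁻¹ * t ^ m) • (A^[m] g)) (expAct A t g) :=
    Pi.hasSum.2 fun x => h.hasSum_expAct hs t g x
  have h2 := L.hasSum h1
  funext x
  have h3 := Pi.hasSum.1 h2 x
  rw [← h3.tsum_eq, expAct]
  refine tsum_congr fun m => ?_
  have h4 : ∀ f, L (A^[m] f) = A'^[m] (L f) := by
    induction m with
    | zero => exact fun f => rfl
    | succ m ih =>
      intro f
      rw [Function.iterate_succ_apply, Function.iterate_succ_apply, ih, hL]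
  simp [h4]

/-- The generator as a continuous linear map. -/
def toCLM (r : ι → S → ℝ) (T : ι → S → S) : (S → ℝ) →L[ℝ] (S → ℝ) :=
  ContinuousLinearMap.pi fun x => ∑ i, r i x •
    (ContinuousLinearMap.proj (R := ℝ) (φ := fun _ : S => ℝ) (T i x)
      - ContinuousLinearMap.proj x)

theorem toCLM_apply (h : HasRates A r T) (f : S → ℝ) : toCLM r T f = A f := by
  funext x
  simp [toCLM, h.apply_eq]

theorem expAct_apply_comm (h : HasRates A r T) (hs : Conserves r T size) (t : ℝ) (g : S → ℝ) :
    expAct A t (A g) = A (expAct A t g) := by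
  have := h.expAct_map hs (A' := A) (toCLM r T) (fun f => by simp [h.toCLM_apply]) t g
  simpa [h.toCLM_apply] using this

theorem apply_add (h : HasRates A r T) (f g : S → ℝ) : A (f + g) = A f + A g := by
  simp [← h.toCLM_apply]

theorem apply_smul (h : HasRates A r T) (c : ℝ) (f : S → ℝ) : A (c • f) = c • A f := by
  simp [← h.toCLM_apply]

theorem iterate_linear (h : HasRates A r T) (m : ℕ) (f : S → ℝ) :
    A^[m] f = (toCLM r T ^ m) f := by
  induction m generalizing f with
  | zero => rfl
  | succ m ih =>
    rw [Function.iterate_succ_apply, ih, pow_succ, mul_apply_eq_comp, h.toCLM_apply]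

theorem expAct_add (h : HasRates A r T) (hs : Conserves r T size) (t : ℝ) (f g : S → ℝ) (x : S) :
    expAct A t (f + g) x = expAct A t f x + expAct A t g x := by
  refine HasSum.tsum_eq ?_
  refine ((h.hasSum_expAct hs t f x).add (h.hasSum_expAct hs t g x)).congr_fun fun m => ?_
  simp [h.iterate_linear, mul_add]

theorem expAct_smul (h : HasRates A r T) (hs : Conserves r T size) (t c : ℝ) (g : S → ℝ) (x : S) :
    expAct A t (c • g) x = c * expAct A t g x := by
  refine HasSum.tsum_eq ?_
  refine ((h.hasSum_expAct hs t g x).mul_left c).congr_fun fun m => ?_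
  simp [h.iterate_linear]
  ring

theorem expAct_sub (h : HasRates A r T) (hs : Conserves r T size) (t : ℝ) (f g : S → ℝ) (x : S) :
    expAct A t (f - g) x = expAct A t f x - expAct A t g x := by
  have h1 : f - g = f + (-1 : ℝ) • g := by simp [sub_eq_add_neg]
  rw [h1, h.expAct_add hs, h.expAct_smul hs]
  ring

theorem expAct_sum (h : HasRates A r T) (hs : Conserves r T size) (t : ℝ) {κ : Type*}
    (s : Finset κ) (f : κ → S → ℝ) (x : S) :
    expAct A t (∑ j ∈ s, f j) x = ∑ j ∈ s, expAct A t (f j) x := by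
  classical
  induction s using Finset.induction_on with
  | empty =>
    have := h.expAct_smul hs t 0 0 x
    simpa using this
  | insert j s hj ih => rw [Finset.sum_insert hj, Finset.sum_insert hj, h.expAct_add hs, ih]

theorem expAct_mono (h : HasRates A r T) (hs : Conserves r T size) {t : ℝ} (ht : 0 ≤ t)
    {f g : S → ℝ} {x : S} (hfg : ∀ y, size y = size x → f y ≤ g y) :
    expAct A t f x ≤ expAct A t g x := by
  classical
  set d : S → ℝ := fun y => if size y = size x then g y - f y else 0
  have h1 : expAct A t d x = expAct A t (g - f) x :=
    h.expAct_congr hs t fun y hy => by simp [d, hy]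
  have h2 := h.expAct_nonneg hs ht (g := d) (fun y => by
    simp only [d]
    split_ifs with hy
    exacts [sub_nonneg.2 (hfg y hy), le_rfl]) x
  rw [h1, h.expAct_sub hs] at h2
  linarith

theorem abs_expAct_sub_le (h : HasRates A r T) (hs : Conserves r T size) {t : ℝ} (ht : 0 ≤ t)
    {f g b : S → ℝ} {x : S} (hb : ∀ y, size y = size x → |f y - g y| ≤ b y) :
    |expAct A t f x - expAct A t g x| ≤ expAct A t b x := by
  rw [abs_le, neg_le_sub_iff_le_add, sub_le_iff_le_add, ← h.expAct_add hs, ← h.expAct_add hs]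
  constructor
  · refine h.expAct_mono hs ht fun y hy => ?_
    have := (abs_le.1 (hb y hy)).1
    simp only [Pi.add_apply]
    linarith
  · refine h.expAct_mono hs ht fun y hy => ?_
    have := (abs_le.1 (hb y hy)).2
    simp only [Pi.add_apply]
    linarith

theorem expAct_zero_time (A : (S → ℝ) → S → ℝ) (g : S → ℝ) (x : S) : expAct A 0 g x = g x := by
  rw [expAct, tsum_eq_single 0]
  · simp
  · intro m hm
    simp [hm]

theorem expAct_of_harmonic (h : HasRates A r T) (t : ℝ) {g : S → ℝ} (hg : A g = 0) :
    expAct A t g = g := by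
  funext x
  rw [expAct, tsum_eq_single 0]
  · simp
  · intro m hm
    obtain ⟨m, rfl⟩ := Nat.exists_eq_succ_of_ne_zero hm
    rw [Function.iterate_succ_apply, hg, h.iterate_linear]
    simp

theorem apply_size (h : HasRates A r T) (hs : Conserves r T size) (φ : ℕ → ℝ) :
    A (fun x => φ (size x)) = 0 := by
  funext x
  rw [h.apply_eq]
  refine Finset.sum_eq_zero fun i _ => ?_
  by_cases hr : r i x = 0
  · simp [hr]
  · simp [hs.size_eq i x hr]

theorem expAct_size (h : HasRates A r T) (hs : Conserves r T size) (t : ℝ) (φ : ℕ → ℝ) (x : S) :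
    expAct A t (fun x => φ (size x)) x = φ (size x) :=
  congrFun (h.expAct_of_harmonic t (h.apply_size hs φ)) x

theorem expAct_size_mul (h : HasRates A r T) (hs : Conserves r T size) (t : ℝ) (φ : ℕ → ℝ)
    (g : S → ℝ) (x : S) :
    expAct A t (fun x => φ (size x) * g x) x = φ (size x) * expAct A t g x := by
  rw [← h.expAct_smul hs]
  exact h.expAct_congr hs t fun y hy => by simp [hy]

theorem act_eq_expAct [Countable S] (h : HasRates A r T) (hs : Conserves r T size) {t : ℝ}
    (ht : 0 ≤ t) {g : S → ℝ} (hg : ∀ x, 0 ≤ g x) (x : S) :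
    act A t (fun y => ENNReal.ofReal (g y)) x = ENNReal.ofReal (expAct A t g x) := by
  classical
  set Φ : ℕ → ℝ := fun k => ∑ y ∈ (hs.finite k).toFinset, g y
  have hΦ0 : ∀ k, 0 ≤ Φ k := fun k => Finset.sum_nonneg fun y _ => hg y
  have hgΦ : ∀ y, g y ≤ Φ (size y) := fun y =>
    Finset.single_le_sum (f := g) (fun y _ => hg y) (by simp)
  have := h.act_eq_ofReal (V := fun x => Φ (size x)) (c := 0)
    (W := fun x => (1 + size x : ℝ) * (1 + Φ (size x))) le_rfl
    (fun x => by have := hΦ0 (size x); positivity)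
    (fun x => by
      rw [h.apply_size hs fun k => (1 + k : ℝ) * (1 + Φ k)]
      simp)
    (by
      refine squeeze_zero (fun x => ?_) (fun x => ?_) hs.size_tendsto
      · have := hΦ0 (size x)
        positivity
      · have := hΦ0 (size x)
        rw [mul_comm, ← div_div, div_eq_mul_inv]
        refine mul_le_of_le_one_left (by positivity) ?_
        rw [div_le_one (by positivity)]
        linarith)
    (u := fun t x => expAct A t g x) (fun t x ht => h.expAct_nonneg hs ht hg x)
    (fun t x => h.hasDerivAt_expAct hs t g x)
    (fun t x ht => by
      rw [zero_mul, Real.exp_zero, one_mul, ← h.expAct_size hs t Φ x]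
      exact h.expAct_mono hs ht fun y _ => hgΦ y) t ht x
  simpa [expAct_zero_time] using this

theorem transition_eq_expAct [Countable S] (h : HasRates A r T) (hs : Conserves r T size) {t : ℝ}
    (ht : 0 ≤ t) (x y : S) :
    transition A t x y = ENNReal.ofReal (expAct A t (Set.indicator {y} 1) x) := by
  classical
  rw [← h.act_eq_expAct hs ht (g := Set.indicator {y} 1)
    (fun z => Set.indicator_nonneg (fun _ _ => zero_le_one) z), act, tsum_eq_single y]
  · simp
  · intro z hz
    simp [hz]

/-- A semigroup started from a subharmonic bounded function converges to a harmonic function. -/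
theorem tendsto_expAct (h : HasRates A r T) (hs : Conserves r T size) {g : S → ℝ}
    (hg1 : ∀ x, g x ≤ 1) (hAg : ∀ x, 0 ≤ A g x) :
    ∃ F : S → ℝ, A F = 0 ∧ (∀ x, Tendsto (fun t => expAct A t g x) atTop (𝓝 (F x))) := by
  have hmono : ∀ x, MonotoneOn (fun t => expAct A t g x) (Set.Ici 0) := by
    intro x
    refine monotoneOn_of_deriv_nonneg (convex_Ici 0) ?_ ?_ ?_
    · exact fun t _ => (h.hasDerivAt_expAct hs t g x).continuousAt.continuousWithinAt
    · exact fun t _ => (h.hasDerivAt_expAct hs t g x).differentiableAt.differentiableWithinAt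
    · intro t ht
      rw [interior_Ici] at ht
      rw [(h.hasDerivAt_expAct hs t g x).deriv, ← h.expAct_apply_comm hs]
      exact h.expAct_nonneg hs (le_of_lt ht) hAg x
  have hbd : ∀ x t, 0 ≤ t → expAct A t g x ≤ 1 := by
    intro x t ht
    rw [← h.expAct_size hs t (fun _ => 1) x]
    exact h.expAct_mono hs ht fun y _ => hg1 y
  have hlim : ∀ x, ∃ l, Tendsto (fun t => expAct A t g x) atTop (𝓝 l) := by
    intro x
    have h1 : Monotone fun t : ℝ => expAct A (max t 0) g x := fun s t hst =>
      hmono x (le_max_right s 0) (le_max_right t 0) (max_le_max_right 0 hst)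
    have h2 : BddAbove (Set.range fun t : ℝ => expAct A (max t 0) g x) :=
      ⟨1, by rintro _ ⟨t, rfl⟩; exact hbd x _ (le_max_right _ _)⟩
    refine ⟨_, (tendsto_atTop_ciSup h1 h2).congr' ?_⟩
    filter_upwards [eventually_ge_atTop 0] with t ht
    rw [max_eq_left ht]
  choose F hF using hlim
  refine ⟨F, ?_, hF⟩
  funext x
  have h1 : Tendsto (fun t => A (expAct A t g) x) atTop (𝓝 (A F x)) := by
    simp_rw [h.apply_eq]
    exact tendsto_finsetSum _ fun i _ => ((hF _).sub (hF x)).const_mul _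
  have h2 : ∀ t : ℝ, ∃ s ∈ Set.Ioo t (t + 1), A (expAct A s g) x
      = expAct A (t + 1) g x - expAct A t g x := by
    intro t
    obtain ⟨s, hs', hsl⟩ := exists_hasDerivAt_eq_slope (fun t => expAct A t g x)
      (fun t => A (expAct A t g) x) (by linarith : t < t + 1)
      (fun s _ => (h.hasDerivAt_expAct hs s g x).continuousAt.continuousWithinAt)
      (fun s _ => h.hasDerivAt_expAct hs s g x)
    exact ⟨s, hs', by simpa using hsl⟩
  choose s hs1 hs2 using h2
  have h3 : Tendsto s atTop atTop := tendsto_atTop_mono (fun t => (hs1 t).1.le) tendsto_id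
  have h4 := h1.comp h3
  have h5 : Tendsto (fun t => expAct A (t + 1) g x - expAct A t g x) atTop (𝓝 (F x - F x)) :=
    ((hF x).comp (tendsto_atTop_add_const_right _ 1 tendsto_id)).sub (hF x)
  rw [sub_self] at h5
  refine tendsto_nhds_unique h4 (h5.congr fun t => (hs2 t).symm)

end HasRates

end MarkovChain

namespace BoundaryDriven

open MarkovChain

variable {n : ℕ}

theorem sign_cases (σ : SignType) : σ = -1 ∨ σ = 0 ∨ σ = 1 := by
  revert σ
  decide

section Moves

variable {σ : SignType} {G : Geometry n}

theorem Config.free_nonneg (η : Config σ G) (x : Fin (n + 1)) :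
    0 ≤ (G.α x : ℝ) + (σ : ℝ) * η.1 x := by
  rcases sign_cases σ with h | h | h
  · have : (η.1 x : ℝ) ≤ G.α x := by exact_mod_cast η.2 h x
    subst h
    rw [SignType.coe_neg_one]
    linarith
  · subst h
    simp
  · subst h
    simp
    positivity

theorem Config.lt_of_free_ne_zero (η : Config σ G) (x : Fin (n + 1))
    (hx : (G.α x : ℝ) + (σ : ℝ) * η.1 x ≠ 0) (h : σ = -1) : η.1 x < G.α x := by
  refine lt_of_le_of_ne (η.2 h x) fun he => hx ?_
  subst h
  simp [he]

theorem Config.move_apply (η : Config σ G) {x y : Fin (n + 1)} (hxy : x ≠ y)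
    (hy : σ = -1 → η.1 y < G.α y) :
    (η.move x y).1 = η.1 - Pi.single x 1 + Pi.single y 1 := by
  rw [Config.move, Config.replace, dif_pos]
  intro h z
  have h1 := η.2 h z
  by_cases hz : z = y
  · subst hz
    have := hy h
    simp [Ne.symm hxy]
    omega
  · simp [hz]
    omega

theorem Config.remove_apply (η : Config σ G) (x : Fin (n + 1)) :
    (η.remove x).1 = η.1 - Pi.single x 1 := by
  rw [Config.remove, Config.replace, dif_pos]
  intro h z
  have h1 := η.2 h z
  simp
  omega

theorem Config.add_apply (η : Config σ G) {y : Fin (n + 1)}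
    (hy : σ = -1 → η.1 y < G.α y) :
    (η.add y).1 = η.1 + Pi.single y 1 := by
  rw [Config.add, Config.replace, dif_pos]
  intro h z
  have h1 := η.2 h z
  by_cases hz : z = y
  · subst hz
    have := hy h
    simp
    omega
  · simp [hz]
    omega

theorem sub_single_add_single {f : Fin (n + 1) → ℕ} {x : Fin (n + 1)} (hx : f x ≠ 0) :
    f - Pi.single x 1 + Pi.single x 1 = f := by
  funext z
  by_cases hz : z = x
  · subst hz
    simp
    omega
  · simp [hz]

end Moves

theorem sum_lt_symm {ι M : Type*} [Fintype ι] [LinearOrder ι] [AddCommMonoid M] (g : ι → ι → M)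
    (hg : ∀ x, g x x = 0) :
    ∑ x, ∑ y with x < y, (g x y + g y x) = ∑ p : ι × ι, g p.1 p.2 := by
  have h1 : ∀ x y : ι, g x y = (if x < y then g x y else 0) + (if y < x then g x y else 0) := by
    intro x y
    rcases lt_trichotomy x y with h | h | h
    · simp [h, h.not_gt]
    · simp [h, hg]
    · simp [h, h.not_gt]
  rw [Fintype.sum_prod_type]
  simp_rw [Finset.sum_add_distrib, Finset.sum_filter]
  conv_rhs => enter [2, x, 2, y]; rw [h1 x y]
  simp_rw [Finset.sum_add_distrib]
  congr 1
  exact Finset.sum_comm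

section Rates

variable (σ : SignType) (G : Geometry n) (θL θR : ℝ)

/-- The rates of the dual process. -/
def dualRate : (Fin (n + 1) × Fin (n + 1)) ⊕ Bool → DualConfig σ G → ℝ
  | .inl (x, y), ξ => G.ω x y * ((ξ.1.1 x : ℝ) * (G.α y + (σ : ℝ) * ξ.1.1 y))
  | .inr true, ξ => G.ωL * G.αL * (ξ.1.1 0 : ℝ)
  | .inr false, ξ => G.ωR * G.αR * (ξ.1.1 (Fin.last n) : ℝ)

/-- The jumps of the dual process. -/
def dualTarget : (Fin (n + 1) × Fin (n + 1)) ⊕ Bool → DualConfig σ G → DualConfig σ G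
  | .inl (x, y), ξ => (ξ.1.move x y, ξ.2)
  | .inr true, ξ => (ξ.1.remove 0, ξ.2.1 + 1, ξ.2.2)
  | .inr false, ξ => (ξ.1.remove (Fin.last n), ξ.2.1, ξ.2.2 + 1)

theorem hasRates_dual : HasRates (dualGenerator σ G) (dualRate σ G) (dualTarget σ G) where
  apply_eq f ξ := by
    rw [Fintype.sum_sum_type, Fintype.sum_bool, dualGenerator,
      ← sum_lt_symm (fun x y => dualRate σ G (.inl (x, y)) ξ
        * (f (dualTarget σ G (.inl (x, y)) ξ) - f ξ)) fun x => by simp [dualRate, G.ω_self],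
      ← add_assoc]
    simp only [dualRate, dualTarget]
    congr 2
    refine Finset.sum_congr rfl fun x _ => Finset.sum_congr rfl fun y _ => ?_
    rw [G.ω_symm y x]
    ring
  rate_nonneg i ξ := by
    rcases i with ⟨x, y⟩ | _ | _
    · exact mul_nonneg (G.ω_nonneg x y) (mul_nonneg (Nat.cast_nonneg _) (ξ.1.free_nonneg y))
    · exact mul_nonneg (mul_nonneg G.ωR_nonneg G.αR_pos.le) (Nat.cast_nonneg _)
    · exact mul_nonneg (mul_nonneg G.ωL_nonneg G.αL_pos.le) (Nat.cast_nonneg _)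

/-- The rates of the particle system. -/
def rate : (Fin (n + 1) × Fin (n + 1)) ⊕ (Bool × Bool) → Config σ G → ℝ
  | .inl (x, y), η => G.ω x y * ((η.1 x : ℝ) * (G.α y + (σ : ℝ) * η.1 y))
  | .inr (true, true), η => G.ωL * ((η.1 0 : ℝ) * (G.αL + (σ : ℝ) * G.αL * θL))
  | .inr (true, false), η => G.ωL * (G.αL * θL * (G.α 0 + (σ : ℝ) * η.1 0))
  | .inr (false, true), η => G.ωR * ((η.1 (Fin.last n) : ℝ) * (G.αR + (σ : ℝ) * G.αR * θR))
  | .inr (false, false), η =>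
      G.ωR * (G.αR * θR * (G.α (Fin.last n) + (σ : ℝ) * η.1 (Fin.last n)))

/-- The jumps of the particle system. -/
def target : (Fin (n + 1) × Fin (n + 1)) ⊕ (Bool × Bool) → Config σ G → Config σ G
  | .inl (x, y), η => η.move x y
  | .inr (true, true), η => η.remove 0
  | .inr (true, false), η => η.add 0
  | .inr (false, true), η => η.remove (Fin.last n)
  | .inr (false, false), η => η.add (Fin.last n)

theorem scaleSet_nonneg {σ : SignType} {θ : ℝ} (h : θ ∈ scaleSet σ) : 0 ≤ θ := by
  unfold scaleSet at h
  split_ifs at h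
  exacts [h.1, h]

theorem scaleSet_one_add_nonneg {σ : SignType} {θ : ℝ} (h : θ ∈ scaleSet σ) :
    0 ≤ 1 + (σ : ℝ) * θ := by
  have h0 := scaleSet_nonneg h
  rcases sign_cases σ with rfl | rfl | rfl
  · have : θ ≤ 1 := by
      simp only [scaleSet, if_true] at h
      exact h.2
    simp
    linarith
  · simp
  · simp
    linarith

theorem hasRates_generator (hL : θL ∈ scaleSet σ) (hR : θR ∈ scaleSet σ) :
    HasRates (generator σ G θL θR) (rate σ G θL θR) (target σ G) where
  apply_eq f η := by
    rw [Fintype.sum_sum_type, Fintype.sum_prod_type (γ := ℝ) (α₁ := Bool), Fintype.sum_bool,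
      Fintype.sum_bool, Fintype.sum_bool, generator,
      ← sum_lt_symm (fun x y => rate σ G θL θR (.inl (x, y)) η
        * (f (target σ G (.inl (x, y)) η) - f η)) fun x => by simp [rate, G.ω_self],
      ← add_assoc]
    simp only [rate, target]
    congr 1
    · congr 1
      · refine Finset.sum_congr rfl fun x _ => Finset.sum_congr rfl fun y _ => ?_
        rw [G.ω_symm y x]
        ring
      · ring
    · ring
  rate_nonneg i η := by
    have hL' := scaleSet_one_add_nonneg hL
    have hR' := scaleSet_one_add_nonneg hR
    rcases i with ⟨x, y⟩ | ⟨_ | _, _ | _⟩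
    · exact mul_nonneg (G.ω_nonneg x y) (mul_nonneg (Nat.cast_nonneg _) (η.free_nonneg y))
    · exact mul_nonneg G.ωR_nonneg (mul_nonneg (mul_nonneg G.αR_pos.le (scaleSet_nonneg hR))
        (η.free_nonneg _))
    · refine mul_nonneg G.ωR_nonneg (mul_nonneg (Nat.cast_nonneg _) ?_)
      have := mul_nonneg G.αR_pos.le hR'
      linarith
    · exact mul_nonneg G.ωL_nonneg (mul_nonneg (mul_nonneg G.αL_pos.le (scaleSet_nonneg hL))
        (η.free_nonneg _))
    · refine mul_nonneg G.ωL_nonneg (mul_nonneg (Nat.cast_nonneg _) ?_)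
      have := mul_nonneg G.αL_pos.le hL'
      linarith

end Rates

section Size

variable {σ : SignType} {G : Geometry n}

theorem DualConfig.finite_size_le (k : ℕ) : {ξ : DualConfig σ G | ξ.size ≤ k}.Finite := by
  have hinj : Function.Injective
      (fun ζ : DualConfig σ G => ((ζ.1.1, ζ.2) : (Fin (n + 1) → ℕ) × ℕ × ℕ)) := by
    rintro ⟨⟨a, ha⟩, b⟩ ⟨⟨c, hc⟩, d⟩ h
    simp only [Prod.mk.injEq] at h
    obtain ⟨rfl, rfl⟩ := h
    rfl
  refine Set.Finite.of_finite_image (f := fun ζ : DualConfig σ G =>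
    ((ζ.1.1, ζ.2) : (Fin (n + 1) → ℕ) × ℕ × ℕ)) ?_ hinj.injOn
  refine ((Set.finite_Iic (fun _ => k)).prod
    ((Set.finite_Iic k).prod (Set.finite_Iic k))).subset ?_
  rintro _ ⟨ζ, hζ, rfl⟩
  have hζ' : (∑ x, ζ.1.1 x) + ζ.2.1 + ζ.2.2 ≤ k := hζ
  refine ⟨fun x => ?_, ?_, ?_⟩
  · have := Finset.single_le_sum (f := ζ.1.1) (fun _ _ => Nat.zero_le _) (Finset.mem_univ x)
    simp only
    omega
  · simp only [Set.mem_Iic]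
    omega
  · simp only [Set.mem_Iic]
    omega

theorem sum_sub_single {f : Fin (n + 1) → ℕ} {x : Fin (n + 1)} (hx : f x ≠ 0) :
    ∑ z, (f - Pi.single x 1 : Fin (n + 1) → ℕ) z + 1 = ∑ z, f z := by
  conv_rhs => rw [← sub_single_add_single hx]
  simp [Finset.sum_add_distrib]

theorem conserves_dual :
    Conserves (dualRate σ G) (dualTarget σ G) DualConfig.size where
  finite := DualConfig.finite_size_le
  size_eq i ξ h := by
    rcases i with ⟨x, y⟩ | _ | _
    · simp only [dualRate, ne_eq, mul_eq_zero, not_or, Nat.cast_eq_zero] at h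
      obtain ⟨h1, h2, h3⟩ := h
      have hxy : x ≠ y := by
        rintro rfl
        exact h1 (G.ω_self x)
      have h4 := ξ.1.move_apply hxy (ξ.1.lt_of_free_ne_zero y h3)
      have h5 := sum_sub_single h2
      simp only [dualTarget, DualConfig.size, h4, Pi.add_apply, Finset.sum_add_distrib]
      simp
      simp only [Pi.sub_apply] at h5
      omega
    · simp only [dualRate, ne_eq, mul_eq_zero, not_or, Nat.cast_eq_zero] at h
      have h5 := sum_sub_single h.2
      simp only [dualTarget, DualConfig.size, ξ.1.remove_apply]
      omega
    · simp only [dualRate, ne_eq, mul_eq_zero, not_or, Nat.cast_eq_zero] at h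
      have h5 := sum_sub_single h.2
      simp only [dualTarget, DualConfig.size, ξ.1.remove_apply]
      omega

end Size

section Duality

/-- The rising product `a (a + σ) ⋯ (a + σ (k - 1))`. -/
def poch (σ : SignType) (a k : ℕ) : ℝ :=
  ∏ i ∈ Finset.range k, ((a : ℝ) + (σ : ℝ) * i)

theorem poch_succ (σ : SignType) (a k : ℕ) :
    poch σ a (k + 1) = poch σ a k * ((a : ℝ) + (σ : ℝ) * k) := Finset.prod_range_succ _ _

@[simp]
theorem poch_zero (σ : SignType) (a : ℕ) : poch σ a 0 = 1 := Finset.prod_range_zero _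

theorem poch_pos {σ : SignType} {a k : ℕ} (ha : 0 < a) (hk : σ = -1 → k ≤ a) :
    0 < poch σ a k := by
  refine Finset.prod_pos fun i hi => ?_
  have hi' := Finset.mem_range.1 hi
  have ha' : (0 : ℝ) < a := by exact_mod_cast ha
  rcases sign_cases σ with rfl | rfl | rfl
  · have h1 : i < a := hi'.trans_le (hk rfl)
    have : (i : ℝ) < a := by exact_mod_cast h1
    simp
    linarith
  · simpa using ha
  · simp
    positivity

/-- The single-site duality function. -/
def dualFun (σ : SignType) (a k m : ℕ) : ℝ := (m.descFactorial k : ℝ) / poch σ a k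

theorem cast_descFactorial_succ (m k : ℕ) :
    (m.descFactorial (k + 1) : ℝ) = ((m : ℝ) - k) * m.descFactorial k := by
  rw [Nat.descFactorial_succ, Nat.cast_mul]
  rcases le_or_gt k m with h | h
  · rw [Nat.cast_sub h]
  · simp [Nat.descFactorial_of_lt h]

theorem cast_mul_descFactorial_pred (m k : ℕ) :
    (m : ℝ) * ((m - 1).descFactorial k : ℝ) = ((m : ℝ) - k) * m.descFactorial k := by
  rw [← cast_descFactorial_succ]
  cases m with
  | zero => simp
  | succ m =>
    rw [Nat.succ_descFactorial_succ]
    push_cast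
    simp

theorem cast_succ_descFactorial (m k : ℕ) :
    ((m + 1).descFactorial k : ℝ) = m.descFactorial k + k * m.descFactorial (k - 1) := by
  cases k with
  | zero => simp
  | succ k =>
    rw [Nat.succ_descFactorial_succ, cast_descFactorial_succ, Nat.add_sub_cancel]
    push_cast
    ring

theorem cast_descFactorial_pred (m k : ℕ) :
    ((m : ℝ) - k + 1) * (k * m.descFactorial (k - 1)) = k * m.descFactorial k := by
  cases k with
  | zero => simp
  | succ k =>
    rw [cast_descFactorial_succ, Nat.add_sub_cancel]
    push_cast
    ring

theorem cast_mul_poch_pred (σ : SignType) (a k : ℕ) (f : ℕ → ℝ) (hk : poch σ a k ≠ 0) :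
    (k : ℝ) * (f (k - 1) / poch σ a (k - 1))
      = k * ((a : ℝ) + (σ : ℝ) * ((k : ℝ) - 1)) * f (k - 1) / poch σ a k := by
  cases k with
  | zero => simp
  | succ k =>
    rw [poch_succ] at hk
    have h1 := left_ne_zero_of_mul hk
    have h2 := right_ne_zero_of_mul hk
    rw [poch_succ]
    push_cast
    rw [add_tsub_cancel_right, mul_div_assoc', div_eq_div_iff h1 hk]
    ring

theorem mul_dualFun_succ {σ : SignType} {a l m : ℕ} (ha : 0 < a) (hl : poch σ a l ≠ 0)
    (hm : σ = -1 → m ≤ a) :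
    ((a : ℝ) + (σ : ℝ) * l) * dualFun σ a (l + 1) m
      = ((m : ℝ) - l) * m.descFactorial l / poch σ a l := by
  rw [dualFun, ← cast_descFactorial_succ, poch_succ]
  by_cases h : (a : ℝ) + (σ : ℝ) * l = 0
  · have ha' : (0 : ℝ) < a := by exact_mod_cast ha
    rcases sign_cases σ with rfl | rfl | rfl
    · have : (l : ℝ) = a := by
        rw [SignType.coe_neg_one] at h
        linarith
      have : l = a := by exact_mod_cast this
      rw [Nat.descFactorial_of_lt (by have := hm rfl; omega)]
      simp
    · simp at h
      omega
    · rw [SignType.coe_one] at h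
      have : (0 : ℝ) ≤ l := Nat.cast_nonneg l
      linarith
  · field_simp

theorem bond_duality {σ : SignType} {a b k l p m : ℕ} (ha : 0 < a) (hb : 0 < b)
    (hk : σ = -1 → k ≤ a) (hl : σ = -1 → l ≤ b) (hp : σ = -1 → p ≤ a) (hm : σ = -1 → m ≤ b) :
    (p : ℝ) * ((b : ℝ) + (σ : ℝ) * m) * (dualFun σ a k (p - 1) * dualFun σ b l (m + 1)
        - dualFun σ a k p * dualFun σ b l m)
      + (m : ℝ) * ((a : ℝ) + (σ : ℝ) * p) * (dualFun σ a k (p + 1) * dualFun σ b l (m - 1)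
        - dualFun σ a k p * dualFun σ b l m)
    = (k : ℝ) * ((b : ℝ) + (σ : ℝ) * l) * (dualFun σ a (k - 1) p * dualFun σ b (l + 1) m
        - dualFun σ a k p * dualFun σ b l m)
      + (l : ℝ) * ((a : ℝ) + (σ : ℝ) * k) * (dualFun σ a (k + 1) p * dualFun σ b (l - 1) m
        - dualFun σ a k p * dualFun σ b l m) := by
  have hP := (poch_pos ha hk).ne'
  have hQ := (poch_pos hb hl).ne'
  have e1 := cast_mul_descFactorial_pred p k
  have e2 := cast_mul_descFactorial_pred m l
  have e3 := cast_succ_descFactorial p k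
  have e4 := cast_succ_descFactorial m l
  have e5 := cast_descFactorial_pred p k
  have e6 := cast_descFactorial_pred m l
  have e7 := mul_dualFun_succ ha hP hp
  have e8 := mul_dualFun_succ hb hQ hm
  have e9 := cast_mul_poch_pred σ a k (fun i => (p.descFactorial i : ℝ)) hP
  have e10 := cast_mul_poch_pred σ b l (fun i => (m.descFactorial i : ℝ)) hQ
  have f1 : (k : ℝ) * ((b : ℝ) + (σ : ℝ) * l) * (dualFun σ a (k - 1) p * dualFun σ b (l + 1) m)
      = (k * ((a : ℝ) + (σ : ℝ) * ((k : ℝ) - 1)) * p.descFactorial (k - 1) / poch σ a k)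
        * (((m : ℝ) - l) * m.descFactorial l / poch σ b l) := by
    rw [← e8, ← e9]
    simp only [dualFun]
    ring
  have f2 : (l : ℝ) * ((a : ℝ) + (σ : ℝ) * k) * (dualFun σ a (k + 1) p * dualFun σ b (l - 1) m)
      = (l * ((b : ℝ) + (σ : ℝ) * ((l : ℝ) - 1)) * m.descFactorial (l - 1) / poch σ b l)
        * (((p : ℝ) - k) * p.descFactorial k / poch σ a k) := by
    rw [← e7, ← e10]
    simp only [dualFun]
    ring
  have f3 : (p : ℝ) * ((b : ℝ) + (σ : ℝ) * m) * (dualFun σ a k (p - 1) * dualFun σ b l (m + 1))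
      = ((b : ℝ) + (σ : ℝ) * m) * (((p : ℝ) - k) * p.descFactorial k / poch σ a k)
        * ((m.descFactorial l + l * m.descFactorial (l - 1)) / poch σ b l) := by
    rw [← e1, ← e4]
    simp only [dualFun]
    ring
  have f4 : (m : ℝ) * ((a : ℝ) + (σ : ℝ) * p) * (dualFun σ a k (p + 1) * dualFun σ b l (m - 1))
      = ((a : ℝ) + (σ : ℝ) * p) * (((m : ℝ) - l) * m.descFactorial l / poch σ b l)
        * ((p.descFactorial k + k * p.descFactorial (k - 1)) / poch σ a k) := by
    rw [← e2, ← e3]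
    simp only [dualFun]
    ring
  simp only [mul_sub, f1, f2, f3, f4]
  simp only [dualFun]
  field_simp
  linear_combination (σ : ℝ) * ((p : ℝ) - k) * p.descFactorial k * e6
    + (σ : ℝ) * ((m : ℝ) - l) * m.descFactorial l * e5

theorem boundary_duality {σ : SignType} {a k p : ℕ} (θ : ℝ) (ha : 0 < a)
    (hk : σ = -1 → k ≤ a) :
    (p : ℝ) * (1 + (σ : ℝ) * θ) * (dualFun σ a k (p - 1) - dualFun σ a k p)
      + θ * ((a : ℝ) + (σ : ℝ) * p) * (dualFun σ a k (p + 1) - dualFun σ a k p)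
    = (k : ℝ) * (θ * dualFun σ a (k - 1) p - dualFun σ a k p) := by
  have hP := (poch_pos ha hk).ne'
  have e1 := cast_mul_descFactorial_pred p k
  have e3 := cast_succ_descFactorial p k
  have e5 := cast_descFactorial_pred p k
  have e9 := cast_mul_poch_pred σ a k (fun i => (p.descFactorial i : ℝ)) hP
  have f1 : (k : ℝ) * (θ * dualFun σ a (k - 1) p)
      = θ * (k * ((a : ℝ) + (σ : ℝ) * ((k : ℝ) - 1)) * p.descFactorial (k - 1) / poch σ a k) := by
    rw [← e9]
    simp only [dualFun]
    ring
  have f2 : (p : ℝ) * (1 + (σ : ℝ) * θ) * dualFun σ a k (p - 1)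
      = (1 + (σ : ℝ) * θ) * (((p : ℝ) - k) * p.descFactorial k / poch σ a k) := by
    rw [← e1]
    simp only [dualFun]
    ring
  simp only [mul_sub, f1, f2]
  simp only [dualFun, e3]
  field_simp
  linear_combination (σ : ℝ) * θ * e5

variable {σ : SignType} {G : Geometry n}

theorem prod_eq_two {x y : Fin (n + 1)} (hxy : x ≠ y) (f : Fin (n + 1) → ℝ) :
    ∏ z, f z = f x * f y * ∏ z ∈ (Finset.univ.erase x).erase y, f z := by
  rw [mul_assoc, Finset.mul_prod_erase _ _ (Finset.mem_erase.2 ⟨hxy.symm, Finset.mem_univ y⟩),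
    Finset.mul_prod_erase _ _ (Finset.mem_univ x)]

theorem rate_mul_prod_move (η : Config σ G) {x y : Fin (n + 1)} (hxy : x ≠ y)
    (F : Fin (n + 1) → ℕ → ℝ) :
    (η.1 x : ℝ) * ((G.α y : ℝ) + (σ : ℝ) * η.1 y) * ∏ z, F z ((η.move x y).1 z)
      = (η.1 x : ℝ) * ((G.α y : ℝ) + (σ : ℝ) * η.1 y) * (F x (η.1 x - 1) * F y (η.1 y + 1)
        * ∏ z ∈ (Finset.univ.erase x).erase y, F z (η.1 z)) := by
  by_cases h : (G.α y : ℝ) + (σ : ℝ) * η.1 y = 0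
  · simp [h]
  · rw [η.move_apply hxy (η.lt_of_free_ne_zero y h), prod_eq_two hxy]
    congr 2
    · simp [hxy, Ne.symm hxy]
    · refine Finset.prod_congr rfl fun z hz => ?_
      simp only [Finset.mem_erase, Finset.mem_univ, and_true] at hz
      simp [hz.1, hz.2]

theorem prod_remove (η : Config σ G) (x : Fin (n + 1)) (F : Fin (n + 1) → ℕ → ℝ) :
    ∏ z, F z ((η.remove x).1 z) = F x (η.1 x - 1) * ∏ z ∈ Finset.univ.erase x, F z (η.1 z) := by
  rw [η.remove_apply, ← Finset.mul_prod_erase _ _ (Finset.mem_univ x)]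
  congr 1
  · simp
  · refine Finset.prod_congr rfl fun z hz => ?_
    simp [(Finset.mem_erase.1 hz).1]

theorem rate_mul_prod_add (η : Config σ G) (x : Fin (n + 1)) (F : Fin (n + 1) → ℕ → ℝ) :
    ((G.α x : ℝ) + (σ : ℝ) * η.1 x) * ∏ z, F z ((η.add x).1 z)
      = ((G.α x : ℝ) + (σ : ℝ) * η.1 x)
        * (F x (η.1 x + 1) * ∏ z ∈ Finset.univ.erase x, F z (η.1 z)) := by
  by_cases h : (G.α x : ℝ) + (σ : ℝ) * η.1 x = 0
  · simp [h]
  · rw [η.add_apply (η.lt_of_free_ne_zero x h), ← Finset.mul_prod_erase _ _ (Finset.mem_univ x)]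
    congr 2
    · simp
    · refine Finset.prod_congr rfl fun z hz => ?_
      simp [(Finset.mem_erase.1 hz).1]

/-- The duality function. -/
def duality (θL θR : ℝ) (ξ : DualConfig σ G) (η : Config σ G) : ℝ :=
  (∏ x, dualFun σ (G.α x) (ξ.1.1 x) (η.1 x)) * (θL ^ ξ.2.1 * θR ^ ξ.2.2)

theorem generator_duality (θL θR : ℝ) (ξ : DualConfig σ G) (η : Config σ G) :
    generator σ G θL θR (duality θL θR ξ) η
      = dualGenerator σ G (fun ξ => duality θL θR ξ η) ξ := by
  have hη : ∀ x, σ = -1 → η.1 x ≤ G.α x := fun x h => η.2 h x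
  have hξ : ∀ x, σ = -1 → ξ.1.1 x ≤ G.α x := fun x h => ξ.1.2 h x
  set c : ℝ := θL ^ ξ.2.1 * θR ^ ξ.2.2 with hc
  rw [generator, dualGenerator]
  congr 1
  · congr 1
    · refine Finset.sum_congr rfl fun x _ => Finset.sum_congr rfl fun y hy => ?_
      have hxy : x ≠ y := (Finset.mem_filter.1 hy).2.ne
      congr 1
      simp only [duality, ← hc]
      have hp := prod_eq_two hxy fun z => dualFun σ (G.α z) (ξ.1.1 z) (η.1 z)
      have hp' := hp
      rw [mul_comm (dualFun σ (G.α x) (ξ.1.1 x) (η.1 x)), Finset.erase_right_comm] at hp'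
      have h1 := rate_mul_prod_move η hxy fun z => dualFun σ (G.α z) (ξ.1.1 z)
      have h2 := rate_mul_prod_move η hxy.symm fun z => dualFun σ (G.α z) (ξ.1.1 z)
      have h3 := rate_mul_prod_move ξ.1 hxy fun z k => dualFun σ (G.α z) k (η.1 z)
      have h4 := rate_mul_prod_move ξ.1 hxy.symm fun z k => dualFun σ (G.α z) k (η.1 z)
      rw [Finset.erase_right_comm] at h2 h4
      have h5 := bond_duality (G.α_pos x) (G.α_pos y) (hξ x) (hξ y) (hη x) (hη y)
      set R := ∏ z ∈ (Finset.univ.erase x).erase y, dualFun σ (G.α z) (ξ.1.1 z) (η.1 z)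
      rw [hp]
      linear_combination c * (h1 + h2 - h3 - h4) + c * R * h5
    · simp only [duality, pow_succ, ← hc]
      have hp := (Finset.mul_prod_erase Finset.univ
        (fun z => dualFun σ (G.α z) (ξ.1.1 z) (η.1 z)) (Finset.mem_univ 0)).symm
      have h1 := prod_remove η 0 fun z => dualFun σ (G.α z) (ξ.1.1 z)
      have h2 := rate_mul_prod_add η 0 fun z => dualFun σ (G.α z) (ξ.1.1 z)
      have h3 := prod_remove ξ.1 0 fun z k => dualFun σ (G.α z) k (η.1 z)
      have h5 := boundary_duality (p := η.1 0) θL (G.α_pos 0) (hξ 0)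
      set R := ∏ z ∈ Finset.univ.erase 0, dualFun σ (G.α z) (ξ.1.1 z) (η.1 z)
      rw [hp, h1, h3]
      linear_combination G.ωL * G.αL * c * θL * h2 + G.ωL * G.αL * c * R * h5
  · simp only [duality, pow_succ, ← hc]
    have hp := (Finset.mul_prod_erase Finset.univ
      (fun z => dualFun σ (G.α z) (ξ.1.1 z) (η.1 z)) (Finset.mem_univ (Fin.last n))).symm
    have h1 := prod_remove η (Fin.last n) fun z => dualFun σ (G.α z) (ξ.1.1 z)
    have h2 := rate_mul_prod_add η (Fin.last n) fun z => dualFun σ (G.α z) (ξ.1.1 z)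
    have h3 := prod_remove ξ.1 (Fin.last n) fun z k => dualFun σ (G.α z) k (η.1 z)
    have h5 := boundary_duality (p := η.1 (Fin.last n)) θR (G.α_pos (Fin.last n)) (hξ (Fin.last n))
    set R := ∏ z ∈ Finset.univ.erase (Fin.last n), dualFun σ (G.α z) (ξ.1.1 z) (η.1 z)
    rw [hp, h1, h3]
    linear_combination G.ωR * G.αR * c * θR * h2 + G.ωR * G.αR * c * R * h5

end Duality

end BoundaryDriven

namespace BoundaryDriven

open MarkovChain
open scoped Topology

variable {n : ℕ} {σ : SignType} {G : Geometry n} {θL θR : ℝ}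

section Growth

/-- The total number of particles of a configuration. -/
def Config.total (η : Config σ G) : ℕ := ∑ x, η.1 x

theorem Config.le_total (η : Config σ G) (x : Fin (n + 1)) : η.1 x ≤ η.total :=
  Finset.single_le_sum (f := η.1) (fun _ _ => Nat.zero_le _) (Finset.mem_univ x)

theorem Config.finite_total_le (k : ℕ) : {η : Config σ G | η.total ≤ k}.Finite := by
  refine Set.Finite.of_finite_image (f := Subtype.val) ?_ Subtype.val_injective.injOn
  refine (Set.finite_Iic (fun _ => k)).subset ?_
  rintro _ ⟨η, hη, rfl⟩
  exact fun x => (η.le_total x).trans hη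

theorem Config.total_tendsto :
    Tendsto (fun η : Config σ G => (1 + η.total : ℝ)⁻¹) cofinite (𝓝 0) := by
  have h1 : Tendsto (Config.total : Config σ G → ℕ) cofinite atTop := by
    rw [tendsto_atTop]
    intro k
    rw [eventually_cofinite]
    exact (Config.finite_total_le k).subset fun x hx => (not_le.1 hx).le
  have h2 : Tendsto (fun k : ℕ => (1 + k : ℝ)⁻¹) atTop (𝓝 0) := by
    refine tendsto_inv_atTop_zero.comp ?_
    exact tendsto_atTop_add_const_left _ _ tendsto_natCast_atTop_atTop
  exact h2.comp h1

theorem Config.total_move (η : Config σ G) {x y : Fin (n + 1)} (hxy : x ≠ y) (hx : η.1 x ≠ 0)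
    (hy : σ = -1 → η.1 y < G.α y) : (η.move x y).total = η.total := by
  have h5 := sum_sub_single hx
  rw [Config.total, η.move_apply hxy hy]
  simp only [Pi.add_apply, Finset.sum_add_distrib, Finset.sum_pi_single', Finset.mem_univ, if_true]
  exact h5

theorem Config.total_remove_le (η : Config σ G) (x : Fin (n + 1)) :
    (η.remove x).total ≤ η.total := by
  rw [Config.total, η.remove_apply]
  exact Finset.sum_le_sum fun z _ => Nat.sub_le _ _

theorem Config.total_add (η : Config σ G) {y : Fin (n + 1)}
    (hy : σ = -1 → η.1 y < G.α y) : (η.add y).total = η.total + 1 := by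
  rw [Config.total, η.add_apply hy]
  simp [Finset.sum_add_distrib, Config.total]

theorem mul_add_one_pow_sub_le {a : ℝ} (ha : 1 ≤ a) (j : ℕ) :
    a * ((a + 1) ^ j - a ^ j) ≤ 3 ^ j * a ^ j := by
  induction j with
  | zero => simp
  | succ j ih =>
    have h1 : (1 : ℝ) ≤ 3 ^ j := one_le_pow₀ (by norm_num)
    have h2 : 0 < a ^ j := by positivity
    have h3 := mul_le_mul_of_nonneg_left ih (by linarith : (0 : ℝ) ≤ a + 1)
    have h4 : 3 ^ j * a ^ j ≤ 3 ^ j * a ^ j * a := le_mul_of_one_le_right (by positivity) ha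
    have h5 : a ^ j * a ≤ 3 ^ j * (a ^ j * a) := le_mul_of_one_le_left (by positivity) h1
    rw [pow_succ, pow_succ, pow_succ]
    nlinarith

theorem Config.rate_add_mul_le (η : Config σ G) {b : ℝ} (hb : 0 ≤ b) (x : Fin (n + 1)) (j : ℕ) :
    b * ((G.α x : ℝ) + (σ : ℝ) * η.1 x)
        * ((1 + (η.add x).total : ℝ) ^ j - (1 + η.total : ℝ) ^ j)
      ≤ b * G.α x * 3 ^ j * (1 + η.total : ℝ) ^ j := by
  by_cases h : (G.α x : ℝ) + (σ : ℝ) * η.1 x = 0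
  · rw [h]
    simp
    positivity
  · rw [η.total_add (η.lt_of_free_ne_zero x h)]
    push_cast
    have h1 : (1 : ℝ) ≤ 1 + η.total := by simp
    have h2 := mul_add_one_pow_sub_le h1 j
    have h3 : (G.α x : ℝ) + (σ : ℝ) * η.1 x ≤ G.α x * (1 + η.total) := by
      have h4 : (1 : ℝ) ≤ G.α x := by exact_mod_cast G.α_pos x
      have h5 : (η.1 x : ℝ) ≤ η.total := by exact_mod_cast η.le_total x
      have h6 : (0 : ℝ) ≤ η.1 x := Nat.cast_nonneg _
      have h7 : (σ : ℝ) * η.1 x ≤ η.1 x := by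
        rcases sign_cases σ with rfl | rfl | rfl
        · rw [SignType.coe_neg_one]
          linarith
        · simp
        · simp
      nlinarith
    have h8 : 0 ≤ (1 + (η.total : ℝ) + 1) ^ j - (1 + (η.total : ℝ)) ^ j :=
      sub_nonneg.2 (pow_le_pow_left₀ (by positivity) (by linarith) j)
    rw [← add_assoc]
    calc _ ≤ b * (G.α x * (1 + η.total))
          * ((1 + (η.total : ℝ) + 1) ^ j - (1 + (η.total : ℝ)) ^ j) := by gcongr
      _ = b * G.α x
          * ((1 + (η.total : ℝ)) * ((1 + (η.total : ℝ) + 1) ^ j - (1 + (η.total : ℝ)) ^ j)) := by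
          ring
      _ ≤ b * G.α x * (3 ^ j * (1 + (η.total : ℝ)) ^ j) := by gcongr
      _ = _ := by ring

theorem generator_total_pow_le (hL : θL ∈ scaleSet σ) (hR : θR ∈ scaleSet σ) (j : ℕ)
    (η : Config σ G) :
    generator σ G θL θR (fun η => (1 + η.total : ℝ) ^ j) η
      ≤ (3 ^ j * (G.ωL * G.αL * θL * G.α 0 + G.ωR * G.αR * θR * G.α (Fin.last n)))
        * (1 + η.total : ℝ) ^ j := by
  have hL0 := scaleSet_nonneg hL
  have hR0 := scaleSet_nonneg hR
  have hαL := G.αL_pos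
  have hαR := G.αR_pos
  have hωL := G.ωL_nonneg
  have hωR := G.ωR_nonneg
  have h := hasRates_generator σ G θL θR hL hR
  have hmove : ∀ x y, rate σ G θL θR (.inl (x, y)) η
      * ((1 + (η.move x y).total : ℝ) ^ j - (1 + η.total : ℝ) ^ j) = 0 := by
    intro x y
    by_cases hr : rate σ G θL θR (.inl (x, y)) η = 0
    · simp [hr]
    · simp only [rate, mul_eq_zero, not_or, Nat.cast_eq_zero] at hr
      obtain ⟨h1, h2, h3⟩ := hr
      have hxy : x ≠ y := by
        rintro rfl
        exact h1 (G.ω_self x)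
      rw [η.total_move hxy h2 (η.lt_of_free_ne_zero y h3)]
      simp
  have hrem : ∀ x, (1 + (η.remove x).total : ℝ) ^ j - (1 + η.total : ℝ) ^ j ≤ 0 := by
    intro x
    rw [sub_nonpos]
    have : ((η.remove x).total : ℝ) ≤ η.total := by exact_mod_cast η.total_remove_le x
    gcongr
  have hremL := mul_nonpos_of_nonneg_of_nonpos (h.rate_nonneg (.inr (true, true)) η) (hrem 0)
  have hremR := mul_nonpos_of_nonneg_of_nonpos (h.rate_nonneg (.inr (false, true)) η)
    (hrem (Fin.last n))
  have haddL := η.rate_add_mul_le (b := G.ωL * G.αL * θL) (by positivity) 0 j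
  have haddR := η.rate_add_mul_le (b := G.ωR * G.αR * θR) (by positivity) (Fin.last n) j
  rw [h.apply_eq, Fintype.sum_sum_type, Fintype.sum_prod_type (γ := ℝ) (α₁ := Bool),
    Fintype.sum_bool, Fintype.sum_bool, Fintype.sum_bool, Finset.sum_eq_zero fun p _ => hmove p.1 p.2]
  simp only [rate, target] at hremL hremR ⊢
  linarith

end Growth

section ActDuality

theorem dualFun_nonneg {a k m : ℕ} (ha : 0 < a) (hk : σ = -1 → k ≤ a) : 0 ≤ dualFun σ a k m :=
  div_nonneg (Nat.cast_nonneg _) (poch_pos ha hk).le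

theorem duality_nonneg (hL : 0 ≤ θL) (hR : 0 ≤ θR) (ξ : DualConfig σ G) (η : Config σ G) :
    0 ≤ duality θL θR ξ η :=
  mul_nonneg (Finset.prod_nonneg fun x _ => dualFun_nonneg (G.α_pos x) fun h => ξ.1.2 h x)
    (mul_nonneg (pow_nonneg hL _) (pow_nonneg hR _))

theorem exists_duality_le (hL : 0 ≤ θL) (hR : 0 ≤ θR) :
    ∃ φ : ℕ → ℝ, (∀ k, 0 ≤ φ k) ∧ ∀ (ξ : DualConfig σ G) (η : Config σ G),
      duality θL θR ξ η ≤ φ ξ.size * (1 + η.total : ℝ) ^ ξ.size := by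
  set C : DualConfig σ G → ℝ := fun ξ =>
    (∏ x, (poch σ (G.α x) (ξ.1.1 x))⁻¹) * (θL ^ ξ.2.1 * θR ^ ξ.2.2) with hC
  have hpoch : ∀ (ξ : DualConfig σ G) x, 0 < poch σ (G.α x) (ξ.1.1 x) := fun ξ x =>
    poch_pos (G.α_pos x) fun h => ξ.1.2 h x
  have hC0 : ∀ ξ, 0 ≤ C ξ := fun ξ => mul_nonneg
    (Finset.prod_nonneg fun x _ => inv_nonneg.2 (hpoch ξ x).le)
    (mul_nonneg (pow_nonneg hL _) (pow_nonneg hR _))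
  refine ⟨fun k => ∑ ξ ∈ (DualConfig.finite_size_le (σ := σ) (G := G) k).toFinset, C ξ,
    fun k => Finset.sum_nonneg fun ξ _ => hC0 ξ, fun ξ η => ?_⟩
  have h1 : C ξ ≤ ∑ ξ' ∈ (DualConfig.finite_size_le (σ := σ) (G := G) ξ.size).toFinset, C ξ' :=
    Finset.single_le_sum (fun ξ _ => hC0 ξ) (by simp)
  refine le_trans ?_ (mul_le_mul_of_nonneg_right h1 (by positivity))
  have h2 : duality θL θR ξ η = C ξ * ∏ x, ((η.1 x).descFactorial (ξ.1.1 x) : ℝ) := by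
    simp only [duality, dualFun, hC, div_eq_mul_inv, Finset.prod_mul_distrib]
    ring
  rw [h2]
  refine mul_le_mul_of_nonneg_left ?_ (hC0 ξ)
  calc ∏ x, ((η.1 x).descFactorial (ξ.1.1 x) : ℝ)
      ≤ ∏ x, (1 + η.total : ℝ) ^ ξ.1.1 x := by
        refine Finset.prod_le_prod (fun x _ => Nat.cast_nonneg _) fun x _ => ?_
        calc ((η.1 x).descFactorial (ξ.1.1 x) : ℝ) ≤ (η.1 x : ℝ) ^ ξ.1.1 x := by
              exact_mod_cast Nat.descFactorial_le_pow _ _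
          _ ≤ _ := by
              have : (η.1 x : ℝ) ≤ η.total := by exact_mod_cast η.le_total x
              gcongr
              linarith
    _ = (1 + η.total : ℝ) ^ ∑ x, ξ.1.1 x := Finset.prod_pow_eq_pow_sum _ _ _
    _ ≤ _ := by
        refine pow_le_pow_right₀ (by simp) ?_
        rw [DualConfig.size]
        omega

/-- The dual semigroup. -/
abbrev dualAct (t : ℝ) (g : DualConfig σ G → ℝ) : DualConfig σ G → ℝ :=
  expAct (dualGenerator σ G) t g

theorem act_duality (hL : θL ∈ scaleSet σ) (hR : θR ∈ scaleSet σ) {t : ℝ} (ht : 0 ≤ t)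
    (ξ : DualConfig σ G) (η : Config σ G) :
    act (generator σ G θL θR) t (fun η => ENNReal.ofReal (duality θL θR ξ η)) η
      = ENNReal.ofReal (dualAct t (fun ξ => duality θL θR ξ η) ξ) := by
  have hL0 := scaleSet_nonneg hL
  have hR0 := scaleSet_nonneg hR
  have h := hasRates_generator σ G θL θR hL hR
  have h' := hasRates_dual σ G
  have hs := conserves_dual (σ := σ) (G := G)
  obtain ⟨φ, hφ0, hφ⟩ := exists_duality_le (σ := σ) (G := G) hL0 hR0
  set c : ℝ := 3 ^ (ξ.size + 1)
    * (G.ωL * G.αL * θL * G.α 0 + G.ωR * G.αR * θR * G.α (Fin.last n)) with hc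
  have hc0 : 0 ≤ c := by
    have hαL := G.αL_pos
    have hαR := G.αR_pos
    have hωL := G.ωL_nonneg
    have hωR := G.ωR_nonneg
    positivity
  have key := h.act_eq_ofReal (V := fun η => φ ξ.size * (1 + η.total : ℝ) ^ ξ.size)
    (W := fun η => (1 + η.total : ℝ) ^ (ξ.size + 1)) hc0 (fun η => by positivity)
    (fun η => generator_total_pow_le hL hR (ξ.size + 1) η)
    (by
      have h1 := (Config.total_tendsto (σ := σ) (G := G)).const_mul (φ ξ.size)
      rw [mul_zero] at h1
      refine h1.congr fun η => ?_
      have : (0 : ℝ) < 1 + η.total := by positivity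
      rw [pow_succ]
      field_simp)
    (u := fun t η => dualAct t (fun ξ => duality θL θR ξ η) ξ)
    (fun t η ht => h'.expAct_nonneg hs ht (fun ξ => duality_nonneg hL0 hR0 ξ η) ξ)
    (fun t η => by
      refine (h'.hasDerivAt_expAct hs t _ ξ).congr_deriv ?_
      rw [← h'.expAct_apply_comm hs, h.apply_eq]
      have h2 : dualGenerator σ G (fun ξ => duality θL θR ξ η)
          = ∑ i, (rate σ G θL θR i η) • ((fun ξ => duality θL θR ξ (target σ G i η))
            - fun ξ => duality θL θR ξ η) := by
        funext ξ'
        rw [← generator_duality, h.apply_eq]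
        simp
      rw [h2, h'.expAct_sum hs]
      refine Finset.sum_congr rfl fun i _ => ?_
      rw [h'.expAct_smul hs, h'.expAct_sub hs])
    (fun t η ht => by
      calc _ ≤ dualAct t (fun ξ => φ ξ.size * (1 + η.total : ℝ) ^ ξ.size) ξ :=
            h'.expAct_mono hs ht fun ξ' _ => hφ ξ' η
        _ = φ ξ.size * (1 + η.total : ℝ) ^ ξ.size :=
            h'.expAct_size hs t (fun k => φ k * (1 + η.total : ℝ) ^ k) ξ
        _ ≤ _ := by
            refine le_mul_of_one_le_left (mul_nonneg (hφ0 _) (by positivity)) ?_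
            exact Real.one_le_exp (by positivity))
    t ht η
  simpa only [HasRates.expAct_zero_time] using key

end ActDuality

section Law

theorem lintegral_lawAt {S : Type*} [Countable S] [MeasurableSpace S] [MeasurableSingletonClass S]
    (A : (S → ℝ) → S → ℝ) (μ : Measure S) (t : ℝ) (f : S → ENNReal) :
    ∫⁻ x, f x ∂(lawAt A μ t) = ∫⁻ x, act A t f x ∂μ := by
  rw [lawAt, lintegral_sum_measure]
  simp_rw [lintegral_smul_measure, lintegral_dirac, smul_eq_mul, act]
  rw [lintegral_tsum fun y => (measurable_of_countable _).aemeasurable]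
  refine tsum_congr fun y => ?_
  rw [lintegral_mul_const _ (measurable_of_countable _)]

end Law

end BoundaryDriven

namespace BoundaryDriven

open MarkovChain
open scoped Topology

variable {n : ℕ} {σ : SignType} {G : Geometry n}

section Polynomials

open MvPolynomial

/-- The sites of the dual process: the bulk, `L = inr true` and `R = inr false`. -/
abbrev Site (n : ℕ) : Type := Fin (n + 1) ⊕ Bool

/-- The occupation numbers of a dual configuration. -/
def DualConfig.occ (ξ : DualConfig σ G) : Site n → ℕ :=
  Sum.elim ξ.1.1 fun b => if b then ξ.2.1 else ξ.2.2

/-- The monomial `∏_s X_s ^ f(s)`. -/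
def mono {κ : Type*} [Fintype κ] (f : κ → ℕ) : MvPolynomial κ ℝ := ∏ s, X s ^ f s

theorem mono_eq_monomial {κ : Type*} [Fintype κ] (f : κ → ℕ) :
    mono f = monomial (Finsupp.equivFunOnFinite.symm f) 1 := by
  rw [monomial_eq, map_one, one_mul, Finsupp.prod_fintype _ _ fun s => pow_zero _]
  rfl

/-- The value at the configuration with occupation numbers `f`, and `0` if there is none. -/
def valueAt (g : DualConfig σ G → ℝ) (f : Site n → ℕ) : ℝ :=
  open Classical in
  if h : σ = -1 → ∀ x, f (.inl x) ≤ G.α x then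
    g (⟨fun x => f (.inl x), h⟩, f (.inr true), f (.inr false)) else 0

/-- The linear functional on polynomials which maps the monomial of a configuration to the value
of `g` there. -/
def functional (g : DualConfig σ G → ℝ) : MvPolynomial (Site n) ℝ →ₗ[ℝ] ℝ :=
  (basisMonomials (Site n) ℝ).constr ℝ fun e => valueAt g e

theorem functional_mono (g : DualConfig σ G → ℝ) (f : Site n → ℕ) :
    functional g (mono f) = valueAt g f := by
  have h := (basisMonomials (Site n) ℝ).constr_basis ℝ (fun e => valueAt g e)
    (Finsupp.equivFunOnFinite.symm f)
  rw [coe_basisMonomials] at h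
  rw [mono_eq_monomial, functional, h]
  rfl

theorem valueAt_occ (g : DualConfig σ G → ℝ) (ξ : DualConfig σ G) : valueAt g ξ.occ = g ξ := by
  rw [valueAt, dif_pos (show σ = -1 → ∀ x, ξ.occ (.inl x) ≤ G.α x from ξ.1.2)]
  rfl

theorem functional_mono_occ (g : DualConfig σ G → ℝ) (ξ : DualConfig σ G) :
    functional g (mono ξ.occ) = g ξ := by
  rw [functional_mono, valueAt_occ]

theorem exists_occ_eq {f : Site n → ℕ} (h : σ = -1 → ∀ x, f (.inl x) ≤ G.α x) :
    ∃ ξ : DualConfig σ G, ξ.occ = f := by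
  refine ⟨(⟨fun x => f (.inl x), h⟩, f (.inr true), f (.inr false)), ?_⟩
  funext s
  rcases s with x | _ | _ <;> rfl

/-- Polynomials in the occupation variables. -/
abbrev Poly (n : ℕ) : Type := MvPolynomial (Site n) ℝ

/-- Partial differentiation followed by the multiplication with a polynomial. -/
def mulPartial (p : Poly n) (s : Site n) : Poly n →ₗ[ℝ] Poly n :=
  LinearMap.mulLeft ℝ p ∘ₗ (pderiv s).toLinearMap

theorem mulPartial_apply (p : Poly n) (s : Site n) (P : Poly n) :
    mulPartial p s P = p * pderiv s P := rfl

variable (G) in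
/-- The contribution of a bond to `diffOp`. -/
def bondOp (σ : SignType) (x y : Fin (n + 1)) : Poly n →ₗ[ℝ] Poly n :=
  (G.α y : ℝ) • mulPartial (X (.inl y) - X (.inl x)) (.inl x)
    + ((G.α x : ℝ) • mulPartial (X (.inl x) - X (.inl y)) (.inl y)
    + (σ : ℝ) • (mulPartial ((X (.inl x) - X (.inl y)) ^ 2) (.inl x) ∘ₗ mulPartial 1 (.inl y)))

theorem bondOp_apply (x y : Fin (n + 1)) (P : Poly n) :
    bondOp G σ x y P = (G.α y : ℝ) • ((X (.inl y) - X (.inl x)) * pderiv (.inl x) P)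
      + ((G.α x : ℝ) • ((X (.inl x) - X (.inl y)) * pderiv (.inl y) P)
      + (σ : ℝ) • ((X (.inl x) - X (.inl y)) ^ 2 * pderiv (.inl x) (pderiv (.inl y) P))) := by
  simp only [bondOp, LinearMap.add_apply, LinearMap.smul_apply, LinearMap.comp_apply,
    mulPartial_apply, one_mul]

variable (σ G) in
/-- The differential operator which represents the generator of the dual process. -/
def diffOp : Poly n →ₗ[ℝ] Poly n :=
  (∑ x, ∑ y with x < y, G.ω x y • bondOp G σ x y)
  + (G.ωL * G.αL) • mulPartial (X (.inr true) - X (.inl 0)) (.inl 0)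
  + (G.ωR * G.αR) • mulPartial (X (.inr false) - X (.inl (Fin.last n))) (.inl (Fin.last n))

theorem diffOp_apply (P : Poly n) :
    diffOp σ G P = (∑ x, ∑ y with x < y, G.ω x y • bondOp G σ x y P)
    + (G.ωL * G.αL) • ((X (.inr true) - X (.inl 0)) * pderiv (.inl 0) P)
    + (G.ωR * G.αR) • ((X (.inr false) - X (.inl (Fin.last n))) * pderiv (.inl (Fin.last n)) P) := by
  simp only [diffOp, LinearMap.add_apply, LinearMap.smul_apply, LinearMap.sum_apply,
    mulPartial_apply]

/-- The translation of the variables. -/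
def translate {κ : Type*} (a : ℝ) : MvPolynomial κ ℝ →ₐ[ℝ] MvPolynomial κ ℝ :=
  aeval fun s => X s + C a

theorem pderiv_translate {κ : Type*} (a : ℝ) (s : κ) (P : MvPolynomial κ ℝ) :
    pderiv s (translate a P) = translate a (pderiv s P) := by
  classical
  induction P using MvPolynomial.induction_on with
  | C c => simp [translate]
  | add p q hp hq => simp [hp, hq]
  | mul_X p t hp =>
    simp only [map_mul, Derivation.leibniz, hp, smul_eq_mul, map_add]
    congr 2
    by_cases h : t = s
    · subst h
      simp [translate]
    · simp [translate, pderiv_X_of_ne h]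

theorem diffOp_translate (a : ℝ) (P : Poly n) :
    diffOp σ G (translate a P) = translate a (diffOp σ G P) := by
  have hX : ∀ s t : Site n, translate a (X s - X t : Poly n) = X s - X t := by
    intro s t
    simp [translate]
  have hB : ∀ x y, bondOp G σ x y (translate a P) = translate a (bondOp G σ x y P) := by
    intro x y
    simp only [bondOp_apply, pderiv_translate, map_add, map_smul, map_mul, map_pow, hX]
  simp only [diffOp_apply, hB, pderiv_translate, map_add, map_sum, map_smul, map_mul, hX]

theorem X_mul_pderiv_mono {κ : Type*} [Fintype κ] (f : κ → ℕ) (s : κ) :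
    X s * pderiv s (mono f) = (f s : ℝ) • mono f := by
  rw [mono_eq_monomial, X_mul_pderiv_monomial, ← Nat.cast_smul_eq_nsmul ℝ]
  rfl

theorem X_mul_pderiv_mono_of_ne {κ : Type*} [Fintype κ] [DecidableEq κ] (f : κ → ℕ) (s t : κ) :
    X t * pderiv s (mono f) = (f s : ℝ) • mono (f - Pi.single s 1 + Pi.single t 1) := by
  have h : Finsupp.single t 1 + (Finsupp.equivFunOnFinite.symm f - Finsupp.single s 1)
      = Finsupp.equivFunOnFinite.symm (f - Pi.single s 1 + Pi.single t 1) := by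
    ext u
    simp [Finsupp.single_apply, Pi.single_apply, add_comm, eq_comm]
  rw [mono_eq_monomial, mono_eq_monomial, pderiv_monomial, X, monomial_mul, smul_monomial, h]
  simp

theorem X_mul_pderiv_mul_pderiv_mono {κ : Type*} [Fintype κ] (f : κ → ℕ) {s t : κ}
    (hst : s ≠ t) :
    X t * pderiv s (pderiv t (mono f)) = (f t : ℝ) • pderiv s (mono f) := by
  have h := congrArg (pderiv s) (X_mul_pderiv_mono f t)
  rw [pderiv_mul, pderiv_X_of_ne hst.symm, zero_mul, zero_add, Derivation.map_smul] at h
  exact h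

theorem pderiv_comm {κ : Type*} [Fintype κ] (f : κ → ℕ) {s t : κ} :
    pderiv s (pderiv t (mono f)) = pderiv t (pderiv s (mono f)) := by
  classical
  by_cases hst : s = t
  · rw [hst]
  · simp only [mono_eq_monomial, pderiv_monomial]
    rw [tsub_right_comm]
    simp [hst, Ne.symm hst, mul_comm]

theorem bondOp_mono (f : Site n → ℕ) {x y : Fin (n + 1)} (hxy : x ≠ y) :
    bondOp G σ x y (mono f)
      = ((f (.inl x) : ℝ) * (G.α y + (σ : ℝ) * f (.inl y)))
          • (mono (f - Pi.single (.inl x) 1 + Pi.single (.inl y) 1) - mono f)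
        + ((f (.inl y) : ℝ) * (G.α x + (σ : ℝ) * f (.inl x)))
          • (mono (f - Pi.single (.inl y) 1 + Pi.single (.inl x) 1) - mono f) := by
  have hst : (Sum.inl x : Site n) ≠ .inl y := fun h => hxy (Sum.inl_injective h)
  have e1 := X_mul_pderiv_mono f (.inl x)
  have e2 := X_mul_pderiv_mono f (.inl y)
  have e3 := X_mul_pderiv_mono_of_ne f (.inl x) (.inl y)
  have e4 := X_mul_pderiv_mono_of_ne f (.inl y) (.inl x)
  have e5 := X_mul_pderiv_mul_pderiv_mono f hst
  have e6 := X_mul_pderiv_mul_pderiv_mono f hst.symm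
  rw [pderiv_comm] at e6
  rw [bondOp_apply]
  simp only [smul_eq_C_mul, C_mul, C_add] at *
  set M := mono f
  set D1 := pderiv (.inl x) M
  set D2 := pderiv (.inl y) M
  set D3 := pderiv (.inl x) (pderiv (.inl y) M)
  set U := mono (f - Pi.single (.inl x) 1 + Pi.single (.inl y) 1)
  set V := mono (f - Pi.single (.inl y) 1 + Pi.single (.inl x) 1)
  set a := C (G.α y : ℝ)
  set b := C (G.α x : ℝ)
  set s := C (σ : ℝ)
  set k := C (f (.inl x) : ℝ)
  set l := C (f (.inl y) : ℝ)
  linear_combination a * (e3 - e1) + b * (e4 - e2)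
    + s * ((X (.inl y) - 2 * X (.inl x)) * e5 + X (.inl x) * e6 + l * e3 + k * e4 - 2 * l * e1)

end Polynomials

end BoundaryDriven

namespace BoundaryDriven

open MarkovChain
open scoped Topology

variable {n : ℕ} {σ : SignType} {G : Geometry n}

section Consistency

open MvPolynomial

theorem occ_move (ξ : DualConfig σ G) {x y : Fin (n + 1)} (hxy : x ≠ y)
    (hy : σ = -1 → ξ.1.1 y < G.α y) :
    DualConfig.occ (ξ.1.move x y, ξ.2)
      = ξ.occ - Pi.single (.inl x) 1 + Pi.single (.inl y) 1 := by
  funext s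
  rcases s with z | b
  · simp [DualConfig.occ, ξ.1.move_apply hxy hy, Pi.single_apply]
  · simp [DualConfig.occ]

theorem occ_absorb_left (ξ : DualConfig σ G) :
    DualConfig.occ (ξ.1.remove 0, ξ.2.1 + 1, ξ.2.2)
      = ξ.occ - Pi.single (.inl 0) 1 + Pi.single (.inr true) 1 := by
  funext s
  rcases s with z | _ | _
  · simp [DualConfig.occ, ξ.1.remove_apply, Pi.single_apply]
  · simp [DualConfig.occ]
  · simp [DualConfig.occ]

theorem occ_absorb_right (ξ : DualConfig σ G) :
    DualConfig.occ (ξ.1.remove (Fin.last n), ξ.2.1, ξ.2.2 + 1)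
      = ξ.occ - Pi.single (.inl (Fin.last n)) 1 + Pi.single (.inr false) 1 := by
  funext s
  rcases s with z | _ | _
  · simp [DualConfig.occ, ξ.1.remove_apply, Pi.single_apply]
  · simp [DualConfig.occ]
  · simp [DualConfig.occ]

theorem sum_dualRate_smul {M : Type*} [AddCommGroup M] [Module ℝ M] (m : DualConfig σ G → M)
    (ξ : DualConfig σ G) :
    ∑ i, dualRate σ G i ξ • (m (dualTarget σ G i ξ) - m ξ)
      = (∑ x, ∑ y with x < y, G.ω x y •
        (((ξ.1.1 x : ℝ) * (G.α y + (σ : ℝ) * ξ.1.1 y)) • (m (ξ.1.move x y, ξ.2) - m ξ)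
          + ((ξ.1.1 y : ℝ) * (G.α x + (σ : ℝ) * ξ.1.1 x)) • (m (ξ.1.move y x, ξ.2) - m ξ)))
      + (G.ωL * G.αL) • ((ξ.1.1 0 : ℝ) • (m (ξ.1.remove 0, ξ.2.1 + 1, ξ.2.2) - m ξ))
      + (G.ωR * G.αR) • ((ξ.1.1 (Fin.last n) : ℝ)
          • (m (ξ.1.remove (Fin.last n), ξ.2.1, ξ.2.2 + 1) - m ξ)) := by
  rw [Fintype.sum_sum_type, Fintype.sum_bool,
    ← sum_lt_symm (fun x y => dualRate σ G (.inl (x, y)) ξ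
      • (m (dualTarget σ G (.inl (x, y)) ξ) - m ξ))
      (fun x => by simp [dualRate, G.ω_self]), ← add_assoc]
  simp only [dualRate, dualTarget, mul_smul, smul_add]
  congr 2
  refine Finset.sum_congr rfl fun x _ => Finset.sum_congr rfl fun y _ => ?_
  rw [G.ω_symm y x]

theorem rate_smul_mono_move (ξ : DualConfig σ G) {x y : Fin (n + 1)} (hxy : x ≠ y) :
    ((ξ.1.1 x : ℝ) * (G.α y + (σ : ℝ) * ξ.1.1 y))
      • (mono (DualConfig.occ (ξ.1.move x y, ξ.2)) - mono ξ.occ : Poly n)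
      = ((ξ.1.1 x : ℝ) * (G.α y + (σ : ℝ) * ξ.1.1 y))
      • (mono (ξ.occ - Pi.single (.inl x) 1 + Pi.single (.inl y) 1) - mono ξ.occ) := by
  by_cases h : (G.α y : ℝ) + (σ : ℝ) * ξ.1.1 y = 0
  · rw [h, mul_zero, zero_smul, zero_smul]
  · rw [occ_move ξ hxy (ξ.1.lt_of_free_ne_zero y h)]

theorem bondOp_mono_occ (ξ : DualConfig σ G) {x y : Fin (n + 1)} (hxy : x ≠ y) :
    bondOp G σ x y (mono ξ.occ)
      = ((ξ.1.1 x : ℝ) * (G.α y + (σ : ℝ) * ξ.1.1 y))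
          • (mono (DualConfig.occ (ξ.1.move x y, ξ.2)) - mono ξ.occ)
        + ((ξ.1.1 y : ℝ) * (G.α x + (σ : ℝ) * ξ.1.1 x))
          • (mono (DualConfig.occ (ξ.1.move y x, ξ.2)) - mono ξ.occ) := by
  rw [rate_smul_mono_move ξ hxy, rate_smul_mono_move ξ hxy.symm]
  exact bondOp_mono ξ.occ hxy

theorem sub_mul_pderiv_mono (f : Site n → ℕ) (s t : Site n) :
    (X t - X s : Poly n) * pderiv s (mono f)
      = (f s : ℝ) • (mono (f - Pi.single s 1 + Pi.single t 1) - mono f) := by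
  rw [sub_mul, X_mul_pderiv_mono, X_mul_pderiv_mono_of_ne, ← smul_sub]

theorem diffOp_mono_occ (ξ : DualConfig σ G) :
    diffOp σ G (mono ξ.occ) = ∑ i, dualRate σ G i ξ •
      (mono (dualTarget σ G i ξ).occ - mono ξ.occ : Poly n) := by
  rw [sum_dualRate_smul (fun ξ : DualConfig σ G => (mono ξ.occ : Poly n)), diffOp_apply,
    sub_mul_pderiv_mono, sub_mul_pderiv_mono, occ_absorb_left, occ_absorb_right]
  refine congrArg₂ _ (congrArg₂ _ ?_ rfl) rfl
  refine Finset.sum_congr rfl fun x _ => Finset.sum_congr rfl fun y hy => ?_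
  rw [bondOp_mono_occ ξ (Finset.mem_filter.1 hy).2.ne]

theorem dualGenerator_comp_mono (l : Poly n →ₗ[ℝ] ℝ) (ξ : DualConfig σ G) :
    dualGenerator σ G (fun ξ => l (mono ξ.occ)) ξ = l (diffOp σ G (mono ξ.occ)) := by
  rw [(hasRates_dual σ G).apply_eq, diffOp_mono_occ, map_sum]
  simp only [map_smul, map_sub, smul_eq_mul]

theorem dualGenerator_eq_functional (f : DualConfig σ G → ℝ) (ξ : DualConfig σ G) :
    dualGenerator σ G f ξ = functional f (diffOp σ G (mono ξ.occ)) := by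
  rw [← dualGenerator_comp_mono]
  simp only [functional_mono_occ]

theorem prod_add_pow {κ R : Type*} [Fintype κ] [DecidableEq κ] [CommSemiring R] (u v : κ → R)
    (e : κ → ℕ) :
    ∏ s, (u s + v s) ^ e s = ∑ f ∈ Fintype.piFinset fun s => Finset.range (e s + 1),
      ∏ s, (u s ^ f s * v s ^ (e s - f s) * (e s).choose (f s)) := by
  simp_rw [add_pow, Finset.prod_univ_sum]

theorem prod_X_add_C_pow {κ : Type*} [Fintype κ] [DecidableEq κ] (a : κ → ℝ) (e : κ → ℕ) :
    ∏ s, (X s + C (a s) : MvPolynomial κ ℝ) ^ e s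
      = ∑ f ∈ Fintype.piFinset fun s => Finset.range (e s + 1),
        (∏ s, (a s ^ (e s - f s) * (e s).choose (f s))) • mono f := by
  rw [prod_add_pow]
  refine Finset.sum_congr rfl fun f _ => ?_
  rw [smul_eq_C_mul, mono, map_prod, ← Finset.prod_mul_distrib]
  refine Finset.prod_congr rfl fun s _ => ?_
  simp
  ring

theorem translate_mono {κ : Type*} [Fintype κ] (a : ℝ) (e : κ → ℕ) :
    translate a (mono e) = ∏ s, (X s + C a : MvPolynomial κ ℝ) ^ e s := by
  simp [translate, mono]

/-- The dual process is consistent: translations of the variables commute with the generator. -/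
theorem dualGenerator_translate (a : ℝ) (f : DualConfig σ G → ℝ) (ξ : DualConfig σ G) :
    dualGenerator σ G (fun ξ => functional f (translate a (mono ξ.occ))) ξ
      = functional (dualGenerator σ G f) (translate a (mono ξ.occ)) := by
  classical
  refine (dualGenerator_comp_mono (functional f ∘ₗ (translate a).toLinearMap) ξ).trans ?_
  simp only [LinearMap.comp_apply, AlgHom.toLinearMap_apply]
  rw [← diffOp_translate, translate_mono, prod_X_add_C_pow (fun _ => a)]
  simp only [map_sum, map_smul]
  refine Finset.sum_congr rfl fun e he => ?_
  obtain ⟨ζ, hζ⟩ := exists_occ_eq (σ := σ) (G := G) (f := e) fun h x => by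
    have := Finset.mem_range.1 (Fintype.mem_piFinset.1 he (.inl x))
    have h2 := ξ.1.2 h x
    simp only [DualConfig.occ, Sum.elim_inl] at this
    omega
  rw [← hζ, functional_mono_occ, dualGenerator_eq_functional]

theorem functional_eq_sum (f : DualConfig σ G → ℝ) (P : Poly n) :
    functional f P = ∑ e ∈ P.support, coeff e P * valueAt f e := by
  conv_lhs => rw [P.as_sum, map_sum]
  refine Finset.sum_congr rfl fun e _ => ?_
  have h : monomial e (coeff e P) = coeff e P • mono (fun s => e s) := by
    rw [mono_eq_monomial, smul_monomial, smul_eq_mul, mul_one]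
    congr 2
    ext s
    rfl
  rw [h, map_smul, functional_mono, smul_eq_mul]

/-- The value of the functional, as a continuous function of the configuration function. -/
def functionalCLM (P : DualConfig σ G → Poly n) :
    (DualConfig σ G → ℝ) →L[ℝ] (DualConfig σ G → ℝ) where
  toFun f ξ := functional f (P ξ)
  map_add' f g := by
    funext ξ
    simp only [functional_eq_sum, Pi.add_apply, ← Finset.sum_add_distrib, valueAt]
    refine Finset.sum_congr rfl fun e _ => ?_
    split_ifs <;> ring
  map_smul' c f := by
    funext ξ
    simp only [functional_eq_sum, Pi.smul_apply, smul_eq_mul, Finset.mul_sum, valueAt,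
      RingHom.id_apply]
    refine Finset.sum_congr rfl fun e _ => ?_
    split_ifs <;> ring
  cont := by
    simp only [functional_eq_sum, valueAt]
    refine continuous_pi fun ξ => continuous_finsetSum _ fun e _ => continuous_const.mul ?_
    split_ifs
    · exact continuous_apply _
    · exact continuous_const

theorem functionalCLM_apply (P : DualConfig σ G → Poly n) (f : DualConfig σ G → ℝ)
    (ξ : DualConfig σ G) : functionalCLM P f ξ = functional f (P ξ) := rfl

theorem dualAct_translate (t a : ℝ) (f : DualConfig σ G → ℝ) (ξ : DualConfig σ G) :
    dualAct t (fun ξ => functional f (translate a (mono ξ.occ))) ξ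
      = functional (dualAct t f) (translate a (mono ξ.occ)) := by
  have h := (hasRates_dual σ G).expAct_map conserves_dual (A' := dualGenerator σ G)
    (functionalCLM fun ξ : DualConfig σ G => translate a (mono ξ.occ))
    (fun f => funext fun ξ => (dualGenerator_translate a f ξ).symm) t f
  exact congrFun h ξ

end Consistency

section MaximumPrinciple

theorem exists_exit (G : Geometry n) (hω : 0 < G.ωL ∨ 0 < G.ωR) :
    ∃ z b, ∀ ξ : DualConfig σ G, ξ.1.1 z ≠ 0 →
      dualRate σ G (.inr b) ξ ≠ 0 ∧ (dualTarget σ G (.inr b) ξ).1.total + 1 = ξ.1.total := by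
  have hαL := G.αL_pos
  have hαR := G.αR_pos
  rcases hω with h | h
  · refine ⟨0, true, fun ξ hξ => ⟨?_, ?_⟩⟩
    · simp only [dualRate]
      have : (ξ.1.1 0 : ℝ) ≠ 0 := by exact_mod_cast hξ
      positivity
    · simp only [dualTarget, Config.total, ξ.1.remove_apply]
      exact sum_sub_single hξ
  · refine ⟨Fin.last n, false, fun ξ hξ => ⟨?_, ?_⟩⟩
    · simp only [dualRate]
      have : (ξ.1.1 (Fin.last n) : ℝ) ≠ 0 := by exact_mod_cast hξ
      positivity
    · simp only [dualTarget, Config.total, ξ.1.remove_apply]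
      exact sum_sub_single hξ

/-- The graph of the conductances. -/
abbrev Geometry.graph (G : Geometry n) : SimpleGraph (Fin (n + 1)) :=
  SimpleGraph.fromRel fun x y => G.ω x y ≠ 0

theorem exists_step_closer (G : Geometry n) (ξ : DualConfig σ G) (z : Fin (n + 1))
    (hξ : ξ.1.1 ≠ 0) (hz : ξ.1.1 z = 0) :
    ∃ x y, dualRate σ G (.inl (x, y)) ξ ≠ 0 ∧ x ≠ y ∧ (σ = -1 → ξ.1.1 y < G.α y) ∧ ξ.1.1 x ≠ 0
      ∧ G.graph.dist y z < G.graph.dist x z := by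
  classical
  obtain ⟨x₀, hx₀⟩ := Function.ne_iff.1 hξ
  obtain ⟨x, hx, hmin⟩ := Finset.exists_min_image (Finset.univ.filter fun x => ξ.1.1 x ≠ 0)
    (fun x => G.graph.dist x z) ⟨x₀, by simpa using hx₀⟩
  have hx' : ξ.1.1 x ≠ 0 := (Finset.mem_filter.1 hx).2
  have hxz : x ≠ z := by
    rintro rfl
    exact hx' hz
  obtain ⟨p, hp⟩ := (G.connected x z).exists_walk_length_eq_dist
  cases p with
  | nil => exact absurd rfl hxz
  | @cons _ y _ hadj q =>
    have hlt : G.graph.dist y z < G.graph.dist x z := by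
      rw [← hp, SimpleGraph.Walk.length_cons]
      exact Nat.lt_succ_of_le (SimpleGraph.dist_le q)
    have hy : ξ.1.1 y = 0 := by
      by_contra hy
      exact absurd (hmin y (by simpa using hy)) (not_le.2 hlt)
    rw [SimpleGraph.fromRel_adj] at hadj
    have hω : G.ω x y ≠ 0 := by
      rcases hadj.2 with h | h
      · exact h
      · rwa [G.ω_symm]
    have hα : (G.α y : ℝ) ≠ 0 := by exact_mod_cast (G.α_pos y).ne'
    have hxr : (ξ.1.1 x : ℝ) ≠ 0 := by exact_mod_cast hx'
    refine ⟨x, y, ?_, hadj.1, fun _ => by rw [hy]; exact G.α_pos y, hx', hlt⟩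
    simp only [dualRate, hy, Nat.cast_zero, mul_zero, add_zero]
    exact mul_ne_zero hω (mul_ne_zero hxr hα)

/-- Maximum principle: a harmonic function which is nonpositive on the configurations with empty
bulk is nonpositive. -/
theorem nonpos_of_harmonic (hω : 0 < G.ωL ∨ 0 < G.ωR) {f : DualConfig σ G → ℝ}
    (hf : dualGenerator σ G f = 0) (h0 : ∀ ξ : DualConfig σ G, ξ.1.1 = 0 → f ξ ≤ 0)
    (ξ : DualConfig σ G) : f ξ ≤ 0 := by
  classical
  have h := hasRates_dual σ G
  have hs := conserves_dual (σ := σ) (G := G)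
  obtain ⟨z, b, hexit⟩ := exists_exit (σ := σ) G hω
  set k := ξ.size with hk
  have hfin : {ζ : DualConfig σ G | ζ.size = k}.Finite :=
    (hs.finite k).subset fun ζ hζ => le_of_eq hζ
  obtain ⟨ζ₀, hζ₀, hmax⟩ := Set.exists_max_image _ f hfin ⟨ξ, hk.symm⟩
  refine (hmax ξ hk.symm).trans ?_
  have hstep : ∀ ζ : DualConfig σ G, ζ.size = k → f ζ = f ζ₀ → ∀ i, dualRate σ G i ζ ≠ 0 →
      (dualTarget σ G i ζ).size = k ∧ f (dualTarget σ G i ζ) = f ζ₀ := by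
    intro ζ hζ hfζ i hi
    have hle : ∀ j, dualRate σ G j ζ * (f (dualTarget σ G j ζ) - f ζ) ≤ 0 := by
      intro j
      by_cases hj : dualRate σ G j ζ = 0
      · simp [hj]
      · refine mul_nonpos_of_nonneg_of_nonpos (h.rate_nonneg j ζ) ?_
        have := hmax _ ((hs.size_eq j ζ hj).trans hζ)
        linarith
    have hsum : ∑ j, dualRate σ G j ζ * (f (dualTarget σ G j ζ) - f ζ) = 0 := by
      rw [← h.apply_eq, hf]
      rfl
    have := (Finset.sum_eq_zero_iff_of_nonpos fun j _ => hle j).1 hsum i (Finset.mem_univ i)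
    rcases mul_eq_zero.1 this with h1 | h1
    · exact absurd h1 hi
    · exact ⟨(hs.size_eq i ζ hi).trans hζ, by linarith⟩
  suffices H : ∀ m (ζ : DualConfig σ G), ζ.1.total = m → ζ.size = k → f ζ = f ζ₀ → f ζ₀ ≤ 0 from
    H _ ζ₀ rfl hζ₀ rfl
  intro m
  induction m using Nat.strong_induction_on with
  | _ m ihm =>
    suffices H : ∀ d (ζ : DualConfig σ G), ∑ x, ζ.1.1 x * G.graph.dist x z = d →
        ζ.1.total = m → ζ.size = k → f ζ = f ζ₀ → f ζ₀ ≤ 0 from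
      fun ζ => H _ ζ rfl
    intro d
    induction d using Nat.strong_induction_on with
    | _ d ihd =>
      intro ζ hd hm hζ hfζ
      by_cases hbulk : ζ.1.1 = 0
      · rw [← hfζ]
        exact h0 ζ hbulk
      by_cases hz : ζ.1.1 z = 0
      · obtain ⟨x, y, hr, hxy, hy, hx, hlt⟩ := exists_step_closer G ζ z hbulk hz
        obtain ⟨h1, h2⟩ := hstep ζ hζ hfζ _ hr
        refine ihd _ ?_ (dualTarget σ G (.inl (x, y)) ζ) rfl
          ((ζ.1.total_move hxy hx hy).trans hm) h1 h2
        rw [← hd]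
        simp only [dualTarget, ζ.1.move_apply hxy hy]
        have e1 := Finset.sum_congr (rfl : (Finset.univ : Finset (Fin (n + 1))) = Finset.univ)
          fun w _ => congrArg (· * G.graph.dist w z)
            (congrFun (sub_single_add_single hx) w)
        simp only [Pi.add_apply, add_mul, Finset.sum_add_distrib, Pi.single_apply, ite_mul,
          one_mul, zero_mul, Finset.sum_ite_eq', Finset.mem_univ, if_true] at e1 ⊢
        omega
      · obtain ⟨hr, ht⟩ := hexit ζ hz
        obtain ⟨h1, h2⟩ := hstep ζ hζ hfζ _ hr
        exact ihm _ (by omega) _ rfl h1 h2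

theorem eq_of_harmonic (hω : 0 < G.ωL ∨ 0 < G.ωR) {f g : DualConfig σ G → ℝ}
    (hf : dualGenerator σ G f = 0) (hg : dualGenerator σ G g = 0)
    (h0 : ∀ ξ : DualConfig σ G, ξ.1.1 = 0 → f ξ = g ξ) : f = g := by
  have h := hasRates_dual σ G
  have hneg : ∀ f g : DualConfig σ G → ℝ, dualGenerator σ G f = 0 → dualGenerator σ G g = 0 →
      (∀ ξ : DualConfig σ G, ξ.1.1 = 0 → f ξ = g ξ) → ∀ ξ, f ξ ≤ g ξ := by
    intro f g hf hg h0 ξ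
    have h1 : dualGenerator σ G (f + (-1 : ℝ) • g) = 0 := by
      rw [h.apply_add, h.apply_smul, hf, hg]
      simp
    have := nonpos_of_harmonic hω h1 (fun ξ hξ => by simp [h0 ξ hξ]) ξ
    simp at this
    linarith
  funext ξ
  exact le_antisymm (hneg f g hf hg h0 ξ) (hneg g f hg hf (fun ξ hξ => (h0 ξ hξ).symm) ξ)

theorem dualRate_eq_zero_of_bulk {ξ : DualConfig σ G} (hξ : ξ.1.1 = 0)
    (i : (Fin (n + 1) × Fin (n + 1)) ⊕ Bool) : dualRate σ G i ξ = 0 := by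
  rcases i with ⟨x, y⟩ | _ | _ <;> simp [dualRate, hξ]

theorem dualGenerator_of_bulk {ξ : DualConfig σ G} (hξ : ξ.1.1 = 0) (f : DualConfig σ G → ℝ) :
    dualGenerator σ G f ξ = 0 := by
  rw [(hasRates_dual σ G).apply_eq]
  exact Finset.sum_eq_zero fun i _ => by rw [dualRate_eq_zero_of_bulk hξ, zero_mul]

theorem dualAct_of_bulk {ξ : DualConfig σ G} (hξ : ξ.1.1 = 0) (t : ℝ) (f : DualConfig σ G → ℝ) :
    dualAct t f ξ = f ξ := by
  rw [dualAct, expAct, tsum_eq_single 0]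
  · simp
  · intro m hm
    obtain ⟨m, rfl⟩ := Nat.exists_eq_succ_of_ne_zero hm
    rw [Function.iterate_succ_apply', dualGenerator_of_bulk hξ, mul_zero]

/-- Convergence to the harmonic function with boundary values `g`, for `g` supported on the
absorbed configurations. -/
theorem tendsto_dualAct_of_absorbed {g : DualConfig σ G → ℝ} (hg0 : ∀ ξ, 0 ≤ g ξ)
    (hg1 : ∀ ξ, g ξ ≤ 1) (hg : ∀ ξ : DualConfig σ G, ξ.1.1 ≠ 0 → g ξ = 0) :
    ∃ F : DualConfig σ G → ℝ, dualGenerator σ G F = 0 ∧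
      (∀ ξ, Tendsto (fun t => dualAct t g ξ) atTop (𝓝 (F ξ))) ∧
      ∀ ξ : DualConfig σ G, ξ.1.1 = 0 → F ξ = g ξ := by
  have h := hasRates_dual σ G
  obtain ⟨F, hF, hlim⟩ := h.tendsto_expAct conserves_dual hg1 fun ξ => by
    by_cases hξ : ξ.1.1 = 0
    · rw [dualGenerator_of_bulk hξ]
    · rw [h.apply_eq]
      refine Finset.sum_nonneg fun i _ => mul_nonneg (h.rate_nonneg i ξ) ?_
      rw [hg ξ hξ, sub_zero]
      exact hg0 _
  refine ⟨F, hF, hlim, fun ξ hξ => tendsto_nhds_unique (hlim ξ) ?_⟩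
  have : (fun t => dualAct t g ξ) = fun _ => g ξ := funext fun t => dualAct_of_bulk hξ t g
  rw [this]
  exact tendsto_const_nhds

theorem exists_absorbed_indicator (hω : 0 < G.ωL ∨ 0 < G.ωR) :
    ∃ e : DualConfig σ G → ℝ, (∀ ξ, ξ.1.1 = 0 → e ξ = 1) ∧ (∀ ξ, ξ.1.1 ≠ 0 → e ξ = 0) ∧
      ∀ ξ, Tendsto (fun t => dualAct t e ξ) atTop (𝓝 1) := by
  classical
  obtain ⟨e, he⟩ : ∃ e : DualConfig σ G → ℝ, e = fun ξ => if ξ.1.1 = 0 then 1 else 0 := ⟨_, rfl⟩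
  have he1 : ∀ ξ : DualConfig σ G, ξ.1.1 = 0 → e ξ = 1 := fun ξ hξ => he ▸ if_pos hξ
  have he0 : ∀ ξ : DualConfig σ G, ξ.1.1 ≠ 0 → e ξ = 0 := fun ξ hξ => he ▸ if_neg hξ
  obtain ⟨E, hE, hElim, hE0⟩ := tendsto_dualAct_of_absorbed (g := e)
    (fun ξ => by
      by_cases hξ : ξ.1.1 = 0
      · rw [he1 ξ hξ]; norm_num
      · rw [he0 ξ hξ])
    (fun ξ => by
      by_cases hξ : ξ.1.1 = 0
      · rw [he1 ξ hξ]
      · rw [he0 ξ hξ]; norm_num) he0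
  have h1 : dualGenerator σ G (fun _ => 1) = 0 :=
    (hasRates_dual σ G).apply_size conserves_dual fun _ => 1
  have hE1 : E = fun _ => 1 :=
    eq_of_harmonic hω hE h1 fun ξ hξ => by rw [hE0 ξ hξ, he1 ξ hξ]
  refine ⟨e, he1, he0, fun ξ => ?_⟩
  have := hElim ξ
  rwa [hE1] at this

theorem tendsto_dualAct (hω : 0 < G.ωL ∨ 0 < G.ωR) {f f₀ : DualConfig σ G → ℝ}
    (hf₀ : dualGenerator σ G f₀ = 0) (h0 : ∀ ξ : DualConfig σ G, ξ.1.1 = 0 → f ξ = f₀ ξ)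
    (ξ : DualConfig σ G) : Tendsto (fun t => dualAct t f ξ) atTop (𝓝 (f₀ ξ)) := by
  have h := hasRates_dual σ G
  have hs := conserves_dual (σ := σ) (G := G)
  obtain ⟨e, he1, he0, he⟩ := exists_absorbed_indicator (σ := σ) hω
  obtain ⟨C, hC⟩ : ∃ C, ∀ ζ : DualConfig σ G, ζ.size = ξ.size → |f ζ - f₀ ζ| ≤ C := by
    obtain ⟨C, hC⟩ := ((hs.finite ξ.size).image fun ζ => |f ζ - f₀ ζ|).bddAbove
    exact ⟨C, fun ζ hζ => hC ⟨ζ, hζ.le, rfl⟩⟩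
  have hbd : ∀ ζ : DualConfig σ G, ζ.size = ξ.size →
      |f ζ - f₀ ζ| ≤ (C • ((fun _ => 1) - e) : DualConfig σ G → ℝ) ζ := by
    intro ζ hζ
    by_cases hb : ζ.1.1 = 0
    · simp [h0 ζ hb, he1 ζ hb]
    · simpa [he0 ζ hb] using hC ζ hζ
  have hact : ∀ t, 0 ≤ t → |dualAct t f ξ - f₀ ξ| ≤ C * (1 - dualAct t e ξ) := by
    intro t ht
    have h1 := h.abs_expAct_sub_le hs ht hbd
    rwa [h.expAct_smul hs, h.expAct_sub hs, h.expAct_size hs t fun _ => 1,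
      h.expAct_of_harmonic t hf₀] at h1
  have hlim : Tendsto (fun t => C * (1 - dualAct t e ξ)) atTop (𝓝 0) := by
    simpa using ((he ξ).const_sub 1).const_mul C
  rw [tendsto_iff_norm_sub_tendsto_zero]
  refine squeeze_zero' (Eventually.of_forall fun t => norm_nonneg _) ?_ hlim
  filter_upwards [eventually_ge_atTop 0] with t ht
  exact hact t ht

end MaximumPrinciple

end BoundaryDriven

namespace BoundaryDriven

open MarkovChain
open scoped Topology

variable {n : ℕ} {σ : SignType} {G : Geometry n}

section Absorption

open MvPolynomial

theorem absorbedLeft_spec (σ : SignType) (G : Geometry n) :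
    dualGenerator σ G absorbedLeft = 0 ∧
      (∀ ξ : DualConfig σ G, ξ.1.1 = 0 → absorbedLeft ξ = if ξ.2.2 = 0 then 1 else 0) ∧
      ∀ ξ : DualConfig σ G, 0 ≤ absorbedLeft ξ ∧ absorbedLeft ξ ≤ 1 := by
  classical
  have h := hasRates_dual σ G
  have hs := conserves_dual (σ := σ) (G := G)
  obtain ⟨g, hg⟩ : ∃ g : DualConfig σ G → ℝ,
      ∀ ξ, g ξ = if ξ.1.1 = 0 ∧ ξ.2.2 = 0 then 1 else 0 := ⟨_, fun _ => rfl⟩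
  have hg0 : ∀ ξ, 0 ≤ g ξ := fun ξ => by rw [hg]; split_ifs <;> norm_num
  have hg1 : ∀ ξ, g ξ ≤ 1 := fun ξ => by rw [hg]; split_ifs <;> norm_num
  obtain ⟨F, hF, hlim, hF0⟩ := tendsto_dualAct_of_absorbed hg0 hg1 fun ξ hξ => by
    rw [hg, if_neg fun h => hξ h.1]
  have hFeq : absorbedLeft (σ := σ) (G := G) = F := by
    funext ξ
    refine Tendsto.limUnder_eq ((hlim ξ).congr' ?_)
    filter_upwards [eventually_ge_atTop 0] with t ht
    rw [h.transition_eq_expAct hs ht, ENNReal.toReal_ofReal (h.expAct_nonneg hs ht (g :=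
      Set.indicator _ 1) (fun z => Set.indicator_nonneg (fun _ _ => zero_le_one) z) _)]
    refine h.expAct_congr hs t fun ζ hζ => ?_
    rw [hg, Set.indicator_apply]
    refine if_congr ?_ rfl rfl
    rw [Set.mem_singleton_iff]
    constructor
    · rintro ⟨h1, h2⟩
      refine Prod.ext (Subtype.ext h1) (Prod.ext ?_ h2)
      rw [← hζ]
      simp [DualConfig.size, h1, h2]
    · rintro rfl
      exact ⟨rfl, rfl⟩
  rw [hFeq]
  refine ⟨hF, fun ξ hξ => ?_, fun ξ => ⟨?_, ?_⟩⟩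
  · rw [hF0 ξ hξ, hg]
    simp [hξ]
  · refine ge_of_tendsto (hlim ξ) ?_
    filter_upwards [eventually_ge_atTop 0] with t ht
    exact h.expAct_nonneg hs ht hg0 ξ
  · refine le_of_tendsto (hlim ξ) ?_
    filter_upwards [eventually_ge_atTop 0] with t ht
    exact (h.expAct_mono hs ht fun y _ => hg1 y).trans_eq (h.expAct_size hs t (fun _ => 1) ξ)

theorem X_eq_mono {κ : Type*} [Fintype κ] [DecidableEq κ] (s : κ) :
    (X s : MvPolynomial κ ℝ) = mono (Pi.single s 1) := by
  rw [mono, Finset.prod_eq_single s]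
  · simp
  · intro t _ ht
    simp [ht]
  · simp

theorem exists_occ_single (σ : SignType) (G : Geometry n) (s : Site n) :
    ∃ ξ : DualConfig σ G, ξ.occ = Pi.single s 1 := by
  refine exists_occ_eq fun _ x => ?_
  have := G.α_pos x
  by_cases h : Sum.inl x = s
  · subst h
    simpa using Nat.succ_le_of_lt this
  · simp [h]

theorem functional_diffOp_X {f : DualConfig σ G → ℝ} (hf : dualGenerator σ G f = 0) (s : Site n) :
    functional f (diffOp σ G (X s)) = 0 := by
  classical
  obtain ⟨ξ, hξ⟩ := exists_occ_single σ G s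
  rw [X_eq_mono, ← hξ, ← dualGenerator_eq_functional, hf]
  rfl

theorem diffOp_X_congr (l₁ l₂ : Poly n →ₗ[ℝ] ℝ) (hl : ∀ s, l₁ (X s) = l₂ (X s)) (s : Site n) :
    l₁ (diffOp σ G (X s)) = l₂ (diffOp 0 G (X s)) := by
  classical
  have hterm : ∀ a b c : Site n,
      l₁ ((X a - X b) * pderiv c (X s)) = l₂ ((X a - X b) * pderiv c (X s)) := by
    intro a b c
    by_cases h : s = c
    · subst h
      simp [hl]
    · simp [pderiv_X_of_ne h]
  have h2 : ∀ a b : Site n, pderiv a (pderiv b (X s : Poly n)) = 0 := by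
    intro a b
    by_cases h : s = b
    · subst h
      simp
    · simp [pderiv_X_of_ne h]
  simp only [diffOp_apply, bondOp_apply, h2, mul_zero, smul_zero, add_zero, map_add, map_sum,
    map_smul, hterm]

theorem diffOp_zero_mul (P Q : Poly n) :
    diffOp 0 G (P * Q) = P * diffOp 0 G Q + Q * diffOp 0 G P := by
  have h : ∀ x y, bondOp G 0 x y (P * Q) = P * bondOp G 0 x y Q + Q * bondOp G 0 x y P := by
    intro x y
    simp only [bondOp_apply, Derivation.leibniz, smul_eq_mul, SignType.coe_zero, zero_smul,
      add_zero, smul_eq_C_mul]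
    ring
  simp only [diffOp_apply, h, smul_add, Finset.sum_add_distrib, ← mul_smul_comm, ← Finset.mul_sum,
    Derivation.leibniz, smul_eq_mul, mul_add, smul_eq_C_mul]
  ring

/-- The absorption probability of the independent walkers factorizes; the one-particle
probabilities can be computed from the interacting system. -/
theorem absorbedLeft_zero_eq (hω : 0 < G.ωL ∨ 0 < G.ωR) (ξ : DualConfig 0 G) :
    absorbedLeft ξ = aeval (fun s => functional (absorbedLeft (σ := σ) (G := G)) (X s))
      (mono ξ.occ) := by
  classical
  obtain ⟨hF, hb, -⟩ := absorbedLeft_spec σ G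
  obtain ⟨hF0, hb0, -⟩ := absorbedLeft_spec 0 G
  set q : Site n → ℝ := fun s => functional (absorbedLeft (σ := σ) (G := G)) (X s) with hq
  have hX : ∀ s, aeval q (diffOp 0 G (X s)) = 0 := fun s => by
    rw [← functional_diffOp_X hF s]
    exact (diffOp_X_congr (functional absorbedLeft) (aeval q).toLinearMap
      (fun s => by simp [hq]) s).symm
  have hP : ∀ P : Poly n, aeval q (diffOp 0 G P) = 0 := by
    intro P
    induction P using MvPolynomial.induction_on with
    | C c => simp [diffOp_apply, bondOp_apply]
    | add P Q hP hQ => rw [map_add, map_add, hP, hQ, add_zero]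
    | mul_X P s hP => rw [diffOp_zero_mul, map_add, map_mul, map_mul, hX, hP]; simp
  have hqb : ∀ b, q (.inr b) = if b then 1 else 0 := by
    intro b
    obtain ⟨ξ, hξ⟩ := exists_occ_single σ G (.inr b)
    have h1 : ξ.1.1 = 0 := by
      funext x
      have := congrFun hξ (.inl x)
      simpa [DualConfig.occ] using this
    have h2 : ξ.2.2 = if b then 0 else 1 := by
      have := congrFun hξ (.inr false)
      cases b <;> simpa [DualConfig.occ] using this
    simp only [hq]
    rw [X_eq_mono, ← hξ, functional_mono_occ, hb ξ h1, h2]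
    cases b <;> simp
  refine congrFun (eq_of_harmonic (f := absorbedLeft)
    (g := fun ξ : DualConfig 0 G => aeval q (mono ξ.occ)) hω hF0 ?_ fun ξ hξ => ?_) ξ
  · funext ξ
    exact (dualGenerator_comp_mono (aeval q).toLinearMap ξ).trans (hP _)
  · rw [hb0 ξ hξ]
    simp [mono, DualConfig.occ, hξ, hqb, zero_pow_eq]

/-- The probability that a single dual particle started from a site is absorbed at `L`. -/
def hitLeft (G : Geometry n) (s : Site n) : ℝ :=
  functional (absorbedLeft (σ := 0) (G := G)) (X s)

theorem functional_absorbedLeft_X (hω : 0 < G.ωL ∨ 0 < G.ωR) (s : Site n) :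
    functional (absorbedLeft (σ := σ) (G := G)) (X s) = hitLeft G s := by
  classical
  obtain ⟨ξ, hξ⟩ := exists_occ_single 0 G s
  have h := absorbedLeft_zero_eq (σ := σ) hω ξ
  rw [hξ, ← X_eq_mono, aeval_X] at h
  rw [← h, hitLeft, X_eq_mono, ← hξ, functional_mono_occ]

theorem hitLeft_mem (G : Geometry n) (s : Site n) :
    0 ≤ hitLeft G s ∧ hitLeft G s ≤ 1 := by
  classical
  obtain ⟨ξ, hξ⟩ := exists_occ_single 0 G s
  rw [hitLeft, X_eq_mono, ← hξ, functional_mono_occ]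
  exact (absorbedLeft_spec 0 G).2.2 ξ

theorem hitLeft_reservoir (G : Geometry n) (b : Bool) :
    hitLeft G (.inr b) = if b then 1 else 0 := by
  classical
  obtain ⟨ξ, hξ⟩ := exists_occ_single 0 G (.inr b)
  have h1 : ξ.1.1 = 0 := by
    funext x
    have := congrFun hξ (.inl x)
    simpa [DualConfig.occ] using this
  have h2 : ξ.2.2 = if b then 0 else 1 := by
    have := congrFun hξ (.inr false)
    cases b <;> simpa [DualConfig.occ] using this
  rw [hitLeft, X_eq_mono, ← hξ, functional_mono_occ, (absorbedLeft_spec 0 G).2.1 ξ h1, h2]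
  cases b <;> simp

/-- Product functions of the dual configuration. -/
def prodFun (h : Site n → ℝ) (ξ : DualConfig σ G) : ℝ := ∏ s, h s ^ ξ.occ s

theorem absorbedLeft_toIRW (hω : 0 < G.ωL ∨ 0 < G.ωR) (ξ : DualConfig σ G) :
    absorbedLeft ξ.toIRW = prodFun (hitLeft G) ξ := by
  rw [absorbedLeft_zero_eq (σ := 0) hω]
  simp only [mono, map_prod, map_pow, aeval_X]
  rfl

/-- The polynomial `∏_x (X_x - p_x) ^ η(x)`, `p_x` being the absorption probability. -/
def centred (G : Geometry n) (η : Fin (n + 1) → ℕ) : Poly n :=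
  ∏ x, (X (.inl x) - C (hitLeft G (.inl x))) ^ η x

theorem sum_below_eq (hω : 0 < G.ωL ∨ 0 < G.ωR) (f : DualConfig σ G → ℝ) (η : Config σ G) :
    ∑ ζ ∈ DualConfig.below (η, 0, 0), (DualConfig.binom (η, 0, 0) ζ : ℝ)
      * (-1) ^ (DualConfig.size (η, 0, 0) - ζ.size)
      * absorbedLeft (DualConfig.diff (η, 0, 0) ζ).toIRW * f ζ
      = functional f (centred G η.1) := by
  classical
  simp only [centred, sub_eq_add_neg, prod_add_pow, map_sum]
  refine Finset.sum_bij (fun ζ _ => ζ.1.1) ?_ ?_ ?_ ?_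
  · intro ζ hζ
    have h : ζ ≤ (η, 0, 0) := (finite_Iic (σ := σ) (G := G) (η, 0, 0)).mem_toFinset.1 hζ
    exact Fintype.mem_piFinset.2 fun x => Finset.mem_range.2 (Nat.lt_succ_of_le (h.1 x))
  · intro ζ hζ ζ' hζ' hh
    have h : ζ ≤ (η, 0, 0) := (finite_Iic (σ := σ) (G := G) (η, 0, 0)).mem_toFinset.1 hζ
    have h' : ζ' ≤ (η, 0, 0) := (finite_Iic (σ := σ) (G := G) (η, 0, 0)).mem_toFinset.1 hζ'
    refine Prod.ext (Subtype.ext hh) ?_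
    rw [le_antisymm h.2 (zero_le (a := ζ.2)), le_antisymm h'.2 (zero_le (a := ζ'.2))]
  · intro e he
    have he' : ∀ x, e x ≤ η.1 x := fun x =>
      Nat.le_of_lt_succ (Finset.mem_range.1 (Fintype.mem_piFinset.1 he x))
    exact ⟨(⟨e, fun h x => (he' x).trans (η.2 h x)⟩, 0, 0),
      (finite_Iic (σ := σ) (G := G) (η, 0, 0)).mem_toFinset.2 ⟨he', le_rfl⟩, rfl⟩
  · intro ζ hζ
    have h : ζ ≤ (η, 0, 0) := (finite_Iic (σ := σ) (G := G) (η, 0, 0)).mem_toFinset.1 hζ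
    obtain ⟨ζ, a, b⟩ := ζ
    obtain ⟨h1, h2 : a ≤ 0, h3 : b ≤ 0⟩ := h
    obtain rfl := Nat.le_zero.1 h2
    obtain rfl := Nat.le_zero.1 h3
    have h1' : ∀ x, ζ.1 x ≤ η.1 x := h1
    have hm : (mono (DualConfig.occ ((ζ, 0, 0) : DualConfig σ G)) : Poly n)
        = ∏ x, X (.inl x) ^ ζ.1 x := by
      simp [mono, DualConfig.occ]
    have hpoly : ∏ x, ((X (.inl x) : Poly n) ^ ζ.1 x * (-C (hitLeft G (.inl x))) ^ (η.1 x - ζ.1 x)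
          * ((η.1 x).choose (ζ.1 x) : Poly n))
        = (∏ x, ((-hitLeft G (.inl x)) ^ (η.1 x - ζ.1 x) * ((η.1 x).choose (ζ.1 x) : ℝ)))
          • mono (DualConfig.occ ((ζ, 0, 0) : DualConfig σ G)) := by
      rw [hm, smul_eq_C_mul, map_prod, ← Finset.prod_mul_distrib]
      refine Finset.prod_congr rfl fun x _ => ?_
      simp
      ring
    rw [hpoly, map_smul, functional_mono_occ, absorbedLeft_toIRW hω, smul_eq_mul]
    congr 1
    have hsz : DualConfig.size ((η, 0, 0) : DualConfig σ G) - DualConfig.size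
        ((ζ, 0, 0) : DualConfig σ G) = ∑ x, (η.1 x - ζ.1 x) := by
      simp only [DualConfig.size, add_zero]
      rw [Finset.sum_tsub_distrib _ fun x _ => h1' x]
    rw [hsz, ← Finset.prod_pow_eq_pow_sum, DualConfig.binom, Nat.cast_prod]
    simp only [prodFun, Fintype.prod_sum_type, DualConfig.occ, DualConfig.diff, Sum.elim_inl,
      Sum.elim_inr, Fintype.prod_bool, Nat.sub_self, if_true, Bool.false_eq_true, if_false,
      pow_zero, mul_one, Pi.sub_apply]
    rw [← Finset.prod_mul_distrib, ← Finset.prod_mul_distrib]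
    refine Finset.prod_congr rfl fun x _ => ?_
    rw [neg_pow]
    ring

theorem psi_eq (hω : 0 < G.ωL ∨ 0 < G.ωR) (η : Config σ G) :
    psi ((η, 0, 0) : DualConfig σ G) = functional (absorbedLeft (σ := σ) (G := G)) (centred G η.1) :=
  sum_below_eq hω absorbedLeft η

theorem prodFun_nonneg {h : Site n → ℝ} (hh : ∀ s, 0 ≤ h s) (ξ : DualConfig σ G) :
    0 ≤ prodFun h ξ := Finset.prod_nonneg fun s _ => pow_nonneg (hh s) _

theorem psiAt_eq (hω : 0 < G.ωL ∨ 0 < G.ωR) {t : ℝ} (ht : 0 ≤ t) (η : Config σ G) :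
    psiAt t ((η, 0, 0) : DualConfig σ G)
      = functional (dualAct (σ := σ) (G := G) t (prodFun (hitLeft G))) (centred G η.1) := by
  have h := hasRates_dual σ G
  have hs := conserves_dual (σ := σ) (G := G)
  have h0 : ∀ ξ : DualConfig σ G, 0 ≤ prodFun (hitLeft G) ξ :=
    prodFun_nonneg fun s => (hitLeft_mem G s).1
  rw [← sum_below_eq hω]
  refine Finset.sum_congr rfl fun ζ _ => ?_
  congr 1
  simp only [absorbedLeft_toIRW hω]
  rw [integral_eq_lintegral_of_nonneg_ae (Eventually.of_forall h0)
    (measurable_of_countable _).aestronglyMeasurable, lintegral_lawAt, lintegral_dirac,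
    h.act_eq_expAct hs ht h0, ENNReal.toReal_ofReal (h.expAct_nonneg hs ht h0 ζ)]

end Absorption

end BoundaryDriven

namespace BoundaryDriven

open MarkovChain
open scoped Topology

section ProductSums

variable {R : Type*} [NormedField R] [CompleteSpace R]

theorem hasSum_mul_prod {β γ : Type*} {f : β → R} {g : γ → R} {a b : R} (hf : HasSum f a)
    (hg : HasSum g b) (hfn : Summable fun x => ‖f x‖) (hgn : Summable fun y => ‖g y‖) :
    HasSum (fun p : β × γ => f p.1 * g p.2) (a * b) :=
  hf.mul hg (summable_mul_of_summable_norm hfn hgn)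

theorem summable_norm_prod_and_hasSum {m : ℕ} {β : Type*} (f : Fin m → β → R)
    (hf : ∀ x, Summable fun k => ‖f x k‖) :
    (Summable fun e : Fin m → β => ‖∏ x, f x (e x)‖) ∧
      HasSum (fun e : Fin m → β => ∏ x, f x (e x)) (∏ x, ∑' k, f x k) := by
  induction m with
  | zero =>
    constructor
    · exact (hasSum_unique _).summable
    · simp
  | succ m ih =>
    obtain ⟨h1, h2⟩ := ih (fun x => f x.succ) fun x => hf x.succ
    obtain ⟨g, hg⟩ : ∃ g : (Fin m → β) → R, ∀ e, g e = ∏ x, f (Fin.succ x) (e x) :=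
      ⟨_, fun _ => rfl⟩
    simp only [← hg] at h1 h2
    have hcomp : (fun e : Fin (m + 1) → β => ∏ x, f x (e x)) ∘ Fin.consEquiv (fun _ => β)
        = fun p : β × (Fin m → β) => f 0 p.1 * g p.2 := by
      funext p
      rw [Function.comp_apply, Fin.prod_univ_succ, hg]
      rfl
    constructor
    · rw [← (Fin.consEquiv fun _ => β).summable_iff]
      refine (Summable.mul_norm (hf 0) h1).congr fun p => ?_
      exact congrArg norm (congrFun hcomp p).symm
    · rw [← (Fin.consEquiv fun _ => β).hasSum_iff, Fin.prod_univ_succ, hcomp]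
      have h0 : HasSum (f 0) (∑' k, f 0 k) := (hf 0).of_norm.hasSum
      have h3 := hasSum_mul_prod h0 h2 (hf 0) h1
      exact h3

theorem hasSum_prod {m : ℕ} {β : Type*} {f : Fin m → β → R} {s : Fin m → R}
    (h : ∀ x, HasSum (f x) (s x)) (hf : ∀ x, Summable fun k => ‖f x k‖) :
    HasSum (fun e : Fin m → β => ∏ x, f x (e x)) (∏ x, s x) := by
  have := (summable_norm_prod_and_hasSum f hf).2
  simp_rw [fun x => (h x).tsum_eq] at this
  exact this

end ProductSums

section Weights

variable {σ : SignType}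

/-- The coefficients of the single-site partition function. -/
def weight (σ : SignType) (a k : ℕ) : ℝ := poch σ a k / k.factorial

theorem weight_neg_one (a k : ℕ) : weight (-1) a k = a.choose k := by
  have h : poch (-1) a k = a.descFactorial k := by
    induction k with
    | zero => simp
    | succ k ih =>
      rw [poch_succ, ih, cast_descFactorial_succ]
      simp
      ring
  rw [weight, h, Nat.descFactorial_eq_factorial_mul_choose, Nat.cast_mul]
  field_simp

theorem weight_zero (a k : ℕ) : weight 0 a k = (a : ℝ) ^ k / k.factorial := by
  simp [weight, poch]

theorem weight_one (a k : ℕ) : weight 1 a k = (a + k - 1).choose k := by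
  have h : poch 1 a k = a.ascFactorial k := by
    induction k with
    | zero => simp
    | succ k ih =>
      rw [poch_succ, ih, Nat.ascFactorial_succ, SignType.coe_one]
      push_cast
      ring
  rw [weight, h, Nat.ascFactorial_eq_factorial_mul_choose', Nat.cast_mul]
  field_simp

theorem weight_nonneg (σ : SignType) (a k : ℕ) : 0 ≤ weight σ a k := by
  rcases sign_cases σ with rfl | rfl | rfl
  · rw [weight_neg_one]
    positivity
  · rw [weight_zero]
    positivity
  · rw [weight_one]
    positivity

theorem weight_pos {a k : ℕ} (ha : 0 < a) (hk : σ = -1 → k ≤ a) : 0 < weight σ a k :=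
  div_pos (poch_pos ha hk) (by positivity)

theorem weight_eq_zero {a k : ℕ} (hk : ¬ (σ = -1 → k ≤ a)) : weight σ a k = 0 := by
  obtain ⟨rfl, hlt⟩ := Classical.not_imp.1 hk
  rw [weight_neg_one, Nat.choose_eq_zero_of_lt (not_le.1 hlt), Nat.cast_zero]

/-- The parameter `a + σ l`. -/
def shiftParam (σ : SignType) (a l : ℕ) : ℕ := ((a : ℤ) + (σ : ℤ) * l).toNat

theorem cast_shiftParam {a l : ℕ} (hl : σ = -1 → l ≤ a) :
    ((shiftParam σ a l : ℕ) : ℤ) = (a : ℤ) + (σ : ℤ) * l := by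
  refine Int.toNat_of_nonneg ?_
  rcases sign_cases σ with rfl | rfl | rfl
  · have := hl rfl
    simp
    omega
  · simp
  · simp
    omega

theorem weight_add_mul_choose {a l : ℕ} (hl : σ = -1 → l ≤ a) (j : ℕ) :
    weight σ a (l + j) * (l + j).choose l = weight σ a l * weight σ (shiftParam σ a l) j := by
  have h1 : poch σ a (l + j) = poch σ a l * poch σ (shiftParam σ a l) j := by
    have hc : ((shiftParam σ a l : ℕ) : ℝ) = (a : ℝ) + (σ : ℝ) * l := by
      have := congrArg (fun z : ℤ => (z : ℝ)) (cast_shiftParam hl)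
      push_cast at this
      rcases sign_cases σ with rfl | rfl | rfl <;> simpa using this
    rw [poch, Finset.prod_range_add, poch, poch, hc]
    congr 1
    refine Finset.prod_congr rfl fun i _ => ?_
    push_cast
    ring
  have h2 : ((l + j).choose l : ℝ) * l.factorial * j.factorial = (l + j).factorial := by
    rw [Nat.choose_symm_add]
    exact_mod_cast Nat.add_choose_mul_factorial_mul_factorial l j
  have h3 : ((l + j).choose l : ℝ) ≠ 0 := by
    exact_mod_cast (Nat.choose_pos (Nat.le_add_right l j)).ne'
  rw [weight, weight, weight, h1, ← h2]
  field_simp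

variable {𝕜 : Type*} [RCLike 𝕜]

/-- The single-site partition function `∑_k weight(k) u ^ k`. -/
def partFun (σ : SignType) (a : ℕ) (u : 𝕜) : 𝕜 :=
  if σ = -1 then (1 + u) ^ a else if σ = 0 then NormedSpace.exp ((a : 𝕜) * u)
  else ((1 - u) ^ a)⁻¹

theorem hasSum_weight {a : ℕ} (ha : σ = 1 → 0 < a) {u : 𝕜} (hu : σ = 1 → ‖u‖ < 1) :
    HasSum (fun k => (weight σ a k : 𝕜) * u ^ k) (partFun σ a u) := by
  rcases sign_cases σ with rfl | rfl | rfl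
  · simp only [partFun, if_true, weight_neg_one]
    rw [add_comm, add_pow]
    have h := hasSum_sum_of_ne_finset_zero (L := .unconditional ℕ) (f := fun k => ((a.choose k : ℝ) : 𝕜) * u ^ k)
      (s := Finset.range (a + 1)) fun k hk => by
        rw [Nat.choose_eq_zero_of_lt (by simpa using hk)]
        simp
    convert! h using 1
    refine Finset.sum_congr rfl fun k _ => ?_
    simp [mul_comm]
  · simp only [partFun, weight_zero]
    refine (NormedSpace.expSeries_div_hasSum_exp ((a : 𝕜) * u)).congr_fun fun k => ?_
    push_cast
    rw [mul_pow]
    ring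
  · obtain ⟨m, rfl⟩ := Nat.exists_eq_succ_of_ne_zero (ha rfl).ne'
    have h := hasSum_choose_mul_geometric_of_norm_lt_one m (hu rfl)
    rw [one_div] at h
    refine h.congr_fun fun k => ?_
    rw [weight_one]
    have : m.succ + k - 1 = k + m := by omega
    rw [this, Nat.choose_symm_add]
    simp

theorem hasSum_weight_real {a : ℕ} (ha : σ = 1 → 0 < a) {u : ℝ} (hu : σ = 1 → |u| < 1) :
    HasSum (fun k => weight σ a k * u ^ k) (partFun σ a u) := by
  simpa using hasSum_weight (𝕜 := ℝ) ha (u := u) hu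

theorem hasSum_weight_complex {a : ℕ} (ha : σ = 1 → 0 < a) {u : ℂ} (hu : σ = 1 → ‖u‖ < 1) :
    HasSum (fun k => (weight σ a k : ℂ) * u ^ k) (partFun σ a u) := by
  simpa using hasSum_weight ha hu

theorem hasSum_weight_choose {a l : ℕ} (ha : 0 < a) (hl : σ = -1 → l ≤ a) {y θ : 𝕜}
    (hu : σ = 1 → ‖y * θ‖ < 1) :
    HasSum (fun k => (weight σ a k : 𝕜) * (k.choose l : 𝕜) * y ^ k * θ ^ (k - l))
      ((weight σ a l : 𝕜) * y ^ l * partFun σ (shiftParam σ a l) (y * θ)) := by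
  have hinj : Function.Injective fun j : ℕ => l + j := fun i j h => Nat.add_left_cancel h
  refine (hinj.hasSum_iff ?_).1 ?_
  · intro k hk
    have : k < l := by
      by_contra h
      exact hk ⟨k - l, by simp only; omega⟩
    rw [Nat.choose_eq_zero_of_lt this]
    simp
  · have ha' : σ = 1 → 0 < shiftParam σ a l := by
      rintro rfl
      have := cast_shiftParam (σ := 1) (a := a) (l := l) fun h => absurd h (by decide)
      simp at this
      omega
    refine ((hasSum_weight ha' hu).mul_left ((weight σ a l : 𝕜) * y ^ l)).congr_fun fun j => ?_
    have h := congrArg (fun z : ℝ => (z : 𝕜)) (weight_add_mul_choose hl j)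
    push_cast at h
    simp only [Function.comp_apply, Nat.add_sub_cancel_left]
    rw [h, pow_add, mul_pow]
    ring

theorem hasSum_weight_choose_complex {a l : ℕ} (ha : 0 < a) (hl : σ = -1 → l ≤ a) {y θ : ℂ}
    (hu : σ = 1 → ‖y * θ‖ < 1) :
    HasSum (fun k => (weight σ a k : ℂ) * (k.choose l : ℂ) * y ^ k * θ ^ (k - l))
      ((weight σ a l : ℂ) * y ^ l * partFun σ (shiftParam σ a l) (y * θ)) := by
  simpa using hasSum_weight_choose ha hl hu

theorem dualFun_eq (σ : SignType) (a l k : ℕ) : dualFun σ a l k = k.choose l / weight σ a l := by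
  rw [dualFun, weight, Nat.descFactorial_eq_factorial_mul_choose, Nat.cast_mul,
    div_div_eq_mul_div, mul_comm]

theorem weight_mul_dualFun {a l : ℕ} (ha : 0 < a) (hl : σ = -1 → l ≤ a) (k : ℕ) :
    weight σ a l * dualFun σ a l k = k.choose l := by
  rw [dualFun_eq, mul_div_cancel₀ _ (weight_pos ha hl).ne']

theorem marginal_eq {a : ℕ} {θ : ℝ} (hθ : σ = -1 → θ < 1) (hθ' : θ ∈ scaleSet σ) (k : ℕ) :
    marginal σ a θ k
      = weight σ a k * (θ / (1 + σ * θ)) ^ k * (partFun σ a (θ / (1 + σ * θ)))⁻¹ := by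
  have h0 := scaleSet_nonneg hθ'
  rcases sign_cases σ with rfl | rfl | rfl
  · have h1 : (0 : ℝ) < 1 - θ := by linarith [hθ rfl]
    have h2 : 1 + θ / (1 + -θ) = (1 - θ)⁻¹ := by
      rw [← sub_eq_add_neg]
      field_simp
      ring
    simp only [marginal, partFun, if_true, weight_neg_one, SignType.coe_neg, SignType.coe_one,
      neg_mul, one_mul, h2, inv_pow, inv_inv]
    rcases le_or_gt k a with hk | hk
    · rw [← sub_eq_add_neg, div_pow, pow_sub₀ _ h1.ne' hk]
      field_simp
    · simp [Nat.choose_eq_zero_of_lt hk]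
  · simp [marginal, partFun, weight_zero, Real.exp_eq_exp_ℝ, NormedSpace.exp_neg]
    rw [mul_pow]
    field_simp
  · have h1 : (0 : ℝ) < 1 + θ := by linarith
    have h2 : 1 - θ / (1 + θ) = (1 + θ)⁻¹ := by
      field_simp
      ring
    simp only [marginal, partFun, weight_one, SignType.coe_one, one_mul, h2]
    simp

theorem shiftParam_zero (a l : ℕ) : shiftParam 0 a l = a := by simp [shiftParam]

theorem shiftParam_one (a l : ℕ) : shiftParam 1 a l = a + l := by
  have := cast_shiftParam (σ := 1) (a := a) (l := l) fun h => absurd h (by decide)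
  simp at this
  omega

theorem shiftParam_neg_one (a l : ℕ) : shiftParam (-1) a l = a - l := by
  simp [shiftParam]
  omega

/-- The factorial moments of the single-site weights. -/
theorem hasSum_marginal {a l : ℕ} (ha : 0 < a) (hl : σ = -1 → l ≤ a) {θ : ℝ}
    (hθ : θ ∈ scaleSet σ) :
    HasSum (fun k => marginal σ a θ k * dualFun σ a l k) (θ ^ l) := by
  have h0 := scaleSet_nonneg hθ
  by_cases h1 : σ = -1 → θ < 1
  · have hu : σ = 1 → ‖θ / (1 + (σ : ℝ) * θ) * 1‖ < 1 := by
      rintro rfl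
      have : (0 : ℝ) < 1 + θ := by linarith
      simp only [SignType.coe_one, one_mul, mul_one, norm_div, Real.norm_eq_abs,
        abs_of_nonneg h0, abs_of_pos this]
      rw [div_lt_one this]
      linarith
    have h := (hasSum_weight_choose (𝕜 := ℝ) ha hl hu).mul_left
      ((weight σ a l)⁻¹ * (partFun σ a (θ / (1 + σ * θ)))⁻¹)
    have hw := (weight_pos ha hl).ne'
    convert! h using 1
    · funext k
      rw [marginal_eq h1 hθ, dualFun_eq]
      simp
      ring
    · simp only [RCLike.ofReal_real_eq_id, id, mul_one]
      rw [show (weight σ a l)⁻¹ * (partFun σ a (θ / (1 + σ * θ)))⁻¹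
          * (weight σ a l * (θ / (1 + σ * θ)) ^ l * partFun σ (shiftParam σ a l) (θ / (1 + σ * θ)))
        = (θ / (1 + σ * θ)) ^ l * (partFun σ (shiftParam σ a l) (θ / (1 + σ * θ))
          / partFun σ a (θ / (1 + σ * θ))) by field_simp]
      rcases sign_cases σ with rfl | rfl | rfl
      · have h2 : (0 : ℝ) < 1 - θ := by linarith [h1 rfl]
        have h3 : 1 + θ / (1 - θ) = (1 - θ)⁻¹ := by
          field_simp
          ring
        simp only [partFun, shiftParam_neg_one, if_true, SignType.coe_neg, SignType.coe_one,
          neg_mul, one_mul, ← sub_eq_add_neg, h3]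
        rw [pow_sub₀ _ (by positivity) (hl rfl), div_pow, inv_pow, inv_pow]
        field_simp
      · simp only [partFun, shiftParam_zero]
        rw [div_self (by rw [← Real.exp_eq_exp_ℝ]; exact Real.exp_ne_zero _), mul_one]
        simp
      · have h2 : (0 : ℝ) < 1 + θ := by linarith
        have h3 : 1 - θ / (1 + θ) = (1 + θ)⁻¹ := by
          field_simp
          ring
        simp only [partFun, shiftParam_one, SignType.coe_one, one_mul, h3]
        simp only [pow_add, div_pow, inv_pow]
        simp
        field_simp
  · obtain ⟨rfl, h2⟩ := Classical.not_imp.1 h1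
    have h3 : θ = 1 := by
      simp only [scaleSet, if_true] at hθ
      linarith [hθ.2]
    subst h3
    have h4 := hasSum_single (f := fun k => marginal (-1) a 1 k * dualFun (-1) a l k) a
      fun k hk => by
        rcases lt_or_gt_of_ne hk with h | h
        · have : a - k ≠ 0 := by omega
          simp [marginal, this]
        · simp [marginal, Nat.choose_eq_zero_of_lt h]
    have h5 : dualFun (-1) a l a = 1 := by
      rw [dualFun_eq, weight_neg_one, div_self]
      have := Nat.choose_pos (hl rfl)
      positivity
    simpa [marginal, h5] using h4

theorem marginal_nonneg {a : ℕ} {θ : ℝ} (hθ : θ ∈ scaleSet σ) (k : ℕ) :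
    0 ≤ marginal σ a θ k := by
  have h0 := scaleSet_nonneg hθ
  rcases sign_cases σ with rfl | rfl | rfl
  · simp only [scaleSet, if_true] at hθ
    have : 0 ≤ 1 - θ := by linarith [hθ.2]
    simp only [marginal, if_true]
    positivity
  · simp [marginal]
    positivity
  · simp [marginal]
    positivity

theorem marginal_eq_zero {a k : ℕ} {θ : ℝ} (hk : ¬ (σ = -1 → k ≤ a)) : marginal σ a θ k = 0 := by
  obtain ⟨rfl, hlt⟩ := Classical.not_imp.1 hk
  simp [marginal, Nat.choose_eq_zero_of_lt (not_le.1 hlt)]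

end Weights

end BoundaryDriven

namespace BoundaryDriven

open MarkovChain
open scoped Topology

variable {n : ℕ} {σ : SignType} {G : Geometry n}

section Shifted

open MvPolynomial

theorem functional_translate_congr (a : ℝ) (f : DualConfig σ G → ℝ) (l : Poly n →ₗ[ℝ] ℝ)
    (ξ : DualConfig σ G) (h : ∀ ζ : DualConfig σ G, (∀ s, ζ.occ s ≤ ξ.occ s) →
      l (mono ζ.occ) = f ζ) :
    functional f (translate a (mono ξ.occ)) = l (translate a (mono ξ.occ)) := by
  classical
  rw [translate_mono, prod_X_add_C_pow (fun _ => a)]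
  simp only [map_sum, map_smul]
  refine Finset.sum_congr rfl fun e he => ?_
  have hle : ∀ s, e s ≤ ξ.occ s := fun s =>
    Nat.le_of_lt_succ (Finset.mem_range.1 (Fintype.mem_piFinset.1 he s))
  obtain ⟨ζ, hζ⟩ := exists_occ_eq (σ := σ) (G := G) (f := e) fun h x =>
    (hle (.inl x)).trans (ξ.1.2 h x)
  subst hζ
  rw [functional_mono_occ, h ζ hle]

theorem sum_occ (ξ : DualConfig σ G) : ∑ s, ξ.occ s = ξ.size := by
  simp [DualConfig.occ, DualConfig.size, add_assoc]

theorem prodFun_const_mul (c : ℝ) (h : Site n → ℝ) (ξ : DualConfig σ G) :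
    prodFun (fun s => c * h s) ξ = c ^ ξ.size * prodFun h ξ := by
  simp only [prodFun, mul_pow, Finset.prod_mul_distrib, Finset.prod_pow_eq_pow_sum, sum_occ]

theorem aeval_mono_occ (h : Site n → ℝ) (ξ : DualConfig σ G) :
    aeval h (mono ξ.occ : Poly n) = prodFun h ξ := by
  simp [mono, prodFun]

/-- The image of `f` under the scaling by `c` and the translation by `a`. -/
def affineFun (c a : ℝ) (f : DualConfig σ G → ℝ) (ξ : DualConfig σ G) : ℝ :=
  functional (fun ζ => c ^ ζ.size * f ζ) (translate a (mono ξ.occ))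

theorem affineFun_prodFun (c a : ℝ) (h : Site n → ℝ) (ξ : DualConfig σ G) :
    affineFun c a (prodFun h) ξ = prodFun (fun s => a + c * h s) ξ := by
  rw [affineFun, functional_translate_congr a _ (aeval fun s => c * h s).toLinearMap ξ
    fun ζ _ => by
      rw [AlgHom.toLinearMap_apply, aeval_mono_occ, prodFun_const_mul]]
  simp [translate_mono, prodFun, add_comm]

theorem dualAct_affineFun (t c a : ℝ) (f : DualConfig σ G → ℝ) (ξ : DualConfig σ G) :
    dualAct t (affineFun c a f) ξ = affineFun c a (dualAct t f) ξ := by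
  refine (dualAct_translate t a (fun ζ => c ^ ζ.size * f ζ) ξ).trans ?_
  rw [affineFun]
  congr 2
  funext ζ
  exact (hasRates_dual σ G).expAct_size_mul conserves_dual t (fun k => c ^ k) f ζ

theorem dualGenerator_affineFun (c a : ℝ) {f : DualConfig σ G → ℝ}
    (hf : dualGenerator σ G f = 0) : dualGenerator σ G (affineFun c a f) = 0 := by
  have h := hasRates_dual σ G
  have h0 : dualGenerator σ G (fun ζ => c ^ ζ.size * f ζ) = 0 := by
    funext ξ
    have h1 := congrArg (c ^ ξ.size * ·) (congrFun hf ξ)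
    simp only [Pi.zero_apply, mul_zero, h.apply_eq, Finset.mul_sum] at h1 ⊢
    rw [← h1]
    refine Finset.sum_congr rfl fun i _ => ?_
    by_cases hi : dualRate σ G i ξ = 0
    · simp [hi]
    · rw [(conserves_dual (σ := σ) (G := G)).size_eq i ξ hi]
      ring
  funext ξ
  refine (dualGenerator_translate a _ ξ).trans ?_
  rw [h0]
  simp [functional_eq_sum, valueAt]

theorem functional_scale (c : ℝ) (f : DualConfig σ G → ℝ) (P : Poly n) :
    functional (fun ζ => c ^ ζ.size * f ζ) P = functional f (aeval (fun s => C c * X s) P) := by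
  suffices H : functional (fun ζ => c ^ ζ.size * f ζ)
      = functional f ∘ₗ (aeval fun s : Site n => (C c * X s : Poly n)).toLinearMap from
    LinearMap.congr_fun H P
  refine (basisMonomials (Site n) ℝ).ext fun e => ?_
  have h1 : (basisMonomials (Site n) ℝ) e = mono fun s => e s := by
    rw [coe_basisMonomials, mono_eq_monomial]
    congr 1
    ext s
    rfl
  have h2 : aeval (fun s : Site n => (C c * X s : Poly n)) (mono fun s => e s : Poly n)
      = c ^ (∑ s, e s) • mono fun s => e s := by
    simp only [mono, map_prod, map_pow, aeval_X, mul_pow, Finset.prod_mul_distrib,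
      Finset.prod_pow_eq_pow_sum, smul_eq_C_mul]
  rw [h1, LinearMap.comp_apply, AlgHom.toLinearMap_apply, h2, map_smul, functional_mono,
    functional_mono, smul_eq_mul, valueAt, valueAt]
  split_ifs with h
  · congr 2
    simp [DualConfig.size, add_assoc]
  · simp

theorem affineFun_bulk (c a : ℝ) (f : DualConfig σ G → ℝ) (η : Config σ G) :
    affineFun c a f (η, 0, 0) = ∑ e ∈ Fintype.piFinset fun x => Finset.range (η.1 x + 1),
      (∏ x, ((a + c * hitLeft G (.inl x)) ^ (η.1 x - e x) * c ^ e x * ((η.1 x).choose (e x) : ℝ)))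
        * functional f (centred G e) := by
  classical
  have h : aeval (fun s : Site n => (C c * X s : Poly n))
      (translate a (mono (DualConfig.occ ((η, 0, 0) : DualConfig σ G))))
      = ∏ x, (C c * (X (.inl x) - C (hitLeft G (.inl x)))
        + C (a + c * hitLeft G (.inl x)) : Poly n) ^ η.1 x := by
    simp only [translate_mono, map_prod, map_pow, map_add, aeval_X, Fintype.prod_sum_type,
      DualConfig.occ, Sum.elim_inl, Sum.elim_inr, ite_self, pow_zero, Finset.prod_const_one,
      mul_one]
    refine Finset.prod_congr rfl fun x _ => ?_
    congr 1
    simp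
    ring
  rw [affineFun, functional_scale, h, prod_add_pow, map_sum]
  refine Finset.sum_congr rfl fun e _ => ?_
  rw [← smul_eq_mul, ← map_smul, smul_eq_C_mul, centred, map_prod C, ← Finset.prod_mul_distrib]
  congr 1
  refine Finset.prod_congr rfl fun x _ => ?_
  simp only [map_mul, map_pow, map_natCast, mul_pow]
  ring

theorem functional_centred (f : DualConfig σ G → ℝ) (e : Fin (n + 1) → ℕ) :
    functional f (centred G e) = ∑ j ∈ Fintype.piFinset fun x => Finset.range (e x + 1),
      (∏ x, ((-hitLeft G (.inl x)) ^ (e x - j x) * ((e x).choose (j x) : ℝ)))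
        * valueAt f (Sum.elim j 0) := by
  classical
  rw [centred]
  simp only [sub_eq_add_neg, prod_add_pow, map_sum]
  refine Finset.sum_congr rfl fun j _ => ?_
  have hpoly : ∏ x, ((X (.inl x) : Poly n) ^ j x * (-C (hitLeft G (.inl x))) ^ (e x - j x)
        * ((e x).choose (j x) : Poly n))
      = (∏ x, ((-hitLeft G (.inl x)) ^ (e x - j x) * ((e x).choose (j x) : ℝ)))
        • mono (Sum.elim j 0) := by
    rw [smul_eq_C_mul, map_prod, mono, Fintype.prod_sum_type]
    simp only [Sum.elim_inl, Sum.elim_inr, Pi.zero_apply, pow_zero, Finset.prod_const_one, mul_one,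
      ← Finset.prod_mul_distrib]
    refine Finset.prod_congr rfl fun x _ => ?_
    simp
    ring
  rw [hpoly, map_smul, functional_mono, smul_eq_mul]

theorem abs_functional_centred_le {f : DualConfig σ G → ℝ} (h0 : ∀ ξ, 0 ≤ f ξ)
    (h1 : ∀ ξ, f ξ ≤ 1) (η : Config σ G) :
    |functional f (centred G η.1)| ≤ ∏ x, (2 : ℝ) ^ η.1 x := by
  classical
  rw [functional_centred]
  refine (Finset.abs_sum_le_sum_abs _ _).trans ?_
  have h2 : ∏ x, (2 : ℝ) ^ η.1 x = ∏ x, (1 + 1 : ℝ) ^ η.1 x := by norm_num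
  rw [h2, prod_add_pow]
  refine Finset.sum_le_sum fun e he => ?_
  have hv : |valueAt f (Sum.elim e 0)| ≤ 1 := by
    rw [valueAt]
    split_ifs
    · rw [abs_of_nonneg (h0 _)]
      exact h1 _
    · simp
  rw [abs_mul, Finset.abs_prod]
  refine (mul_le_of_le_one_right (Finset.prod_nonneg fun x _ => abs_nonneg _) hv).trans ?_
  refine Finset.prod_le_prod (fun x _ => abs_nonneg _) fun x _ => ?_
  rw [abs_mul, abs_pow, abs_neg, Nat.abs_cast, one_pow, one_pow, one_mul]
  refine mul_le_mul_of_nonneg_right ?_ (Nat.cast_nonneg _)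
  rw [abs_of_nonneg (hitLeft_mem G _).1]
  exact pow_le_one₀ (hitLeft_mem G _).1 (hitLeft_mem G _).2

end Shifted

section Moments

/-- The expectations of the duality functions. -/
def HasMoments (ρ : Measure (Config σ G)) (θL θR : ℝ) (m : DualConfig σ G → ℝ) : Prop :=
  ∀ ξ, ∫⁻ η, ENNReal.ofReal (duality θL θR ξ η) ∂ρ = ENNReal.ofReal (m ξ)

theorem HasMoments.lawAt {ρ : Measure (Config σ G)} {θL θR : ℝ} {m : DualConfig σ G → ℝ}
    (h : HasMoments ρ θL θR m) (hm : ∀ ξ, 0 ≤ m ξ) (hL : θL ∈ scaleSet σ) (hR : θR ∈ scaleSet σ)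
    {t : ℝ} (ht : 0 ≤ t) :
    HasMoments (lawAt (generator σ G θL θR) ρ t) θL θR (dualAct t m) := by
  have h' := hasRates_dual σ G
  have hs := conserves_dual (σ := σ) (G := G)
  intro ξ
  rw [lintegral_lawAt]
  simp_rw [act_duality hL hR ht]
  rw [← h'.act_eq_expAct hs ht hm]
  have h1 : ∀ η : Config σ G, ENNReal.ofReal (dualAct t (fun ξ => duality θL θR ξ η) ξ)
      = act (dualGenerator σ G) t (fun ξ => ENNReal.ofReal (duality θL θR ξ η)) ξ := fun η =>
    (h'.act_eq_expAct hs ht (fun ξ => duality_nonneg (scaleSet_nonneg hL) (scaleSet_nonneg hR)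
      ξ η) ξ).symm
  simp_rw [h1, act]
  rw [lintegral_tsum fun y => (measurable_of_countable _).aemeasurable]
  refine tsum_congr fun ζ => ?_
  rw [lintegral_const_mul _ (measurable_of_countable _), h ζ]

theorem hasSum_config {R : Type*} [AddCommMonoid R] [TopologicalSpace R]
    {f : (Fin (n + 1) → ℕ) → R} {a : R} (h : HasSum f a)
    (hf : ∀ e, ¬ (σ = -1 → ∀ x, e x ≤ G.α x) → f e = 0) :
    HasSum (fun η : Config σ G => f η.1) a := by
  refine (Subtype.val_injective.hasSum_iff fun e he => hf e fun h => he ?_).2 h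
  exact ⟨⟨e, h⟩, rfl⟩

theorem hasMoments_productMeasure {q : Site n → ℝ} (hq : ∀ x, q (.inl x) ∈ scaleSet σ)
    (hL : 0 ≤ q (.inr true)) (hR : 0 ≤ q (.inr false)) :
    HasMoments (productMeasure σ G fun x => q (.inl x)) (q (.inr true)) (q (.inr false))
      (prodFun q) := by
  intro ξ
  rw [productMeasure, lintegral_sum_measure]
  simp_rw [lintegral_smul_measure, lintegral_dirac, smul_eq_mul]
  set c : ℝ := q (.inr true) ^ ξ.2.1 * q (.inr false) ^ ξ.2.2 with hc
  have hc0 : 0 ≤ c := by positivity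
  set f : Fin (n + 1) → ℕ → ℝ := fun x k =>
    marginal σ (G.α x) (q (.inl x)) k * dualFun σ (G.α x) (ξ.1.1 x) k with hf
  have hf0 : ∀ x k, 0 ≤ f x k := fun x k => mul_nonneg (marginal_nonneg (hq x) k)
    (dualFun_nonneg (G.α_pos x) fun h => ξ.1.2 h x)
  have hfs : ∀ x, HasSum (f x) (q (.inl x) ^ ξ.1.1 x) := fun x =>
    hasSum_marginal (G.α_pos x) (fun h => ξ.1.2 h x) (hq x)
  have h1 := hasSum_prod hfs fun x => (hfs x).summable.norm
  have h2 := (hasSum_config (σ := σ) (G := G) h1 fun e he => by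
    obtain ⟨hσ, he⟩ := Classical.not_imp.1 he
    obtain ⟨x, hx⟩ := not_forall.1 he
    refine Finset.prod_eq_zero (Finset.mem_univ x) ?_
    simp only [hf]
    rw [marginal_eq_zero fun h => hx (h hσ), zero_mul]).mul_right c
  have h3 : prodFun q ξ = (∏ x, q (.inl x) ^ ξ.1.1 x) * c := by
    simp [prodFun, DualConfig.occ, hc]
  rw [h3, ← h2.tsum_eq, ENNReal.ofReal_tsum_of_nonneg
    (fun η => mul_nonneg (Finset.prod_nonneg fun x _ => hf0 x _) hc0) h2.summable]
  refine tsum_congr fun η => ?_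
  rw [← ENNReal.ofReal_mul (Finset.prod_nonneg fun x _ => marginal_nonneg (hq x) _)]
  congr 1
  rw [hf, Finset.prod_mul_distrib, duality, mul_assoc]

theorem act_one {θL θR : ℝ} (hL : θL ∈ scaleSet σ) (hR : θR ∈ scaleSet σ) {t : ℝ} (ht : 0 ≤ t)
    (η : Config σ G) : act (generator σ G θL θR) t (fun _ => 1) η = 1 := by
  have h' := hasRates_dual σ G
  have hs := conserves_dual (σ := σ) (G := G)
  obtain ⟨ξ, hξ⟩ : ∃ ξ : DualConfig σ G, ξ = (⟨0, fun _ _ => Nat.zero_le _⟩, 0, 0) := ⟨_, rfl⟩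
  have h1 : ∀ η, duality θL θR ξ η = 1 := fun η => by
    subst hξ
    simp [duality, dualFun]
  have h2 := act_duality hL hR ht ξ η
  simp only [h1, ENNReal.ofReal_one] at h2
  rw [h2, dualAct_of_bulk (by rw [hξ]), h1, ENNReal.ofReal_one]

theorem affineFun_absorbedLeft_bulk {ξ : DualConfig σ G} (hξ : ξ.1.1 = 0) (θL θR : ℝ)
    (η : Config σ G) :
    duality θL θR ξ η = affineFun (θL - θR) θR absorbedLeft ξ := by
  have h1 := affineFun_prodFun (σ := σ) (G := G) (θL - θR) θR (hitLeft G) ξ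
  have h2 : affineFun (θL - θR) θR absorbedLeft ξ
      = affineFun (θL - θR) θR (prodFun (hitLeft G)) ξ := by
    rw [affineFun, affineFun, functional_translate_congr θR _
      (functional fun ζ => (θL - θR) ^ ζ.size * prodFun (hitLeft G) ζ) ξ fun ζ hζ => ?_]
    have h3 : ζ.1.1 = 0 := by
      funext x
      have := hζ (.inl x)
      simpa [DualConfig.occ, hξ] using this
    rw [functional_mono_occ, (absorbedLeft_spec σ G).2.1 ζ h3]
    congr 1
    simp [prodFun, DualConfig.occ, h3, hitLeft_reservoir, zero_pow_eq]
  rw [h2, h1]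
  simp [prodFun, duality, DualConfig.occ, hξ, hitLeft_reservoir, dualFun]

theorem lintegral_duality_le (hω : 0 < G.ωL ∨ 0 < G.ωR) {θL θR : ℝ} (hL : θL ∈ scaleSet σ)
    (hR : θR ∈ scaleSet σ) {μ : Measure (Config σ G)} [IsProbabilityMeasure μ]
    (hμ : IsStationary (generator σ G θL θR) μ) (ξ : DualConfig σ G) :
    ∫⁻ η, ENNReal.ofReal (duality θL θR ξ η) ∂μ
      ≤ ENNReal.ofReal (affineFun (θL - θR) θR absorbedLeft ξ) := by
  set M := affineFun (θL - θR) θR absorbedLeft ξ with hM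
  have hlim : ∀ η : Config σ G, Tendsto (fun k : ℕ => ENNReal.ofReal
      (dualAct (k : ℝ) (fun ξ => duality θL θR ξ η) ξ)) atTop (𝓝 (ENNReal.ofReal M)) := by
    intro η
    refine ENNReal.tendsto_ofReal ((tendsto_dualAct hω (dualGenerator_affineFun _ _
      (absorbedLeft_spec σ G).1) (fun ζ hζ => affineFun_absorbedLeft_bulk hζ θL θR η) ξ).comp
      tendsto_natCast_atTop_atTop)
  have hK : ∀ K : ℕ, ∫⁻ η, min (ENNReal.ofReal (duality θL θR ξ η)) K ∂μ ≤ ENNReal.ofReal M := by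
    intro K
    have h1 : ∀ k : ℕ, ∫⁻ η, min (ENNReal.ofReal (duality θL θR ξ η)) K ∂μ
        ≤ ∫⁻ η, min (ENNReal.ofReal (dualAct (k : ℝ) (fun ξ => duality θL θR ξ η) ξ)) K ∂μ := by
      intro k
      have hk : (0 : ℝ) ≤ k := Nat.cast_nonneg k
      conv_lhs => rw [← hμ k hk]
      rw [lintegral_lawAt]
      refine lintegral_mono fun η => le_min ?_ ?_
      · rw [← act_duality hL hR hk]
        exact act_mono _ _ (fun _ => min_le_left _ _) _
      · calc act (generator σ G θL θR) k (fun η => min (ENNReal.ofReal (duality θL θR ξ η)) K) η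
            ≤ act (generator σ G θL θR) k (fun _ => (K : ENNReal)) η :=
              act_mono _ _ (fun _ => min_le_right _ _) _
          _ = act (generator σ G θL θR) k (fun _ => 1) η * K := by
              simp only [act, mul_one, ENNReal.tsum_mul_right]
          _ = K := by rw [act_one hL hR hk, one_mul]
    have h2 : Tendsto (fun k : ℕ => ∫⁻ η, min (ENNReal.ofReal
        (dualAct (k : ℝ) (fun ξ => duality θL θR ξ η) ξ)) K ∂μ) atTop
        (𝓝 (∫⁻ _, min (ENNReal.ofReal M) K ∂μ)) := by
      refine tendsto_lintegral_of_dominated_convergence (fun _ => (K : ENNReal))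
        (fun k => measurable_of_countable _) (fun k => Eventually.of_forall fun η =>
          min_le_right _ _) ?_ (Eventually.of_forall fun η => ?_)
      · simp
      · exact (hlim η).min tendsto_const_nhds
    refine (ge_of_tendsto' h2 h1).trans ?_
    simp
  have hmono : Tendsto (fun K : ℕ => ∫⁻ η, min (ENNReal.ofReal (duality θL θR ξ η)) K ∂μ) atTop
      (𝓝 (∫⁻ η, ENNReal.ofReal (duality θL θR ξ η) ∂μ)) := by
    refine lintegral_tendsto_of_tendsto_of_monotone
      (fun K => (measurable_of_countable _).aemeasurable)
      (Eventually.of_forall fun η K K' hKK => min_le_min_left _ (by exact_mod_cast hKK))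
      (Eventually.of_forall fun η => ?_)
    refine tendsto_const_nhds.congr' ?_
    obtain ⟨K₀, hK₀⟩ := exists_nat_ge (duality θL θR ξ η)
    filter_upwards [eventually_ge_atTop K₀] with K hK
    rw [min_eq_left]
    refine (ENNReal.ofReal_le_ofReal (hK₀.trans (Nat.cast_le.2 hK))).trans ?_
    rw [ENNReal.ofReal_natCast]
  exact le_of_tendsto' hmono hK

/-- The factorial moments of the stationary measure. -/
theorem hasMoments_stationary (hω : 0 < G.ωL ∨ 0 < G.ωR) {θL θR : ℝ} (hL : θL ∈ scaleSet σ)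
    (hR : θR ∈ scaleSet σ) {μ : Measure (Config σ G)} [IsProbabilityMeasure μ]
    (hμ : IsStationary (generator σ G θL θR) μ) :
    HasMoments μ θL θR (affineFun (θL - θR) θR absorbedLeft) ∧
      ∀ ξ : DualConfig σ G, 0 ≤ affineFun (θL - θR) θR absorbedLeft ξ := by
  obtain ⟨m, hm⟩ : ∃ m : DualConfig σ G → ℝ,
      ∀ ξ, m ξ = (∫⁻ η, ENNReal.ofReal (duality θL θR ξ η) ∂μ).toReal := ⟨_, fun _ => rfl⟩
  have hm0 : ∀ ξ, 0 ≤ m ξ := fun ξ => by rw [hm]; positivity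
  have hmom : HasMoments μ θL θR m := fun ξ => by
    rw [hm, ENNReal.ofReal_toReal]
    exact ((lintegral_duality_le hω hL hR hμ ξ).trans_lt ENNReal.ofReal_lt_top).ne
  have hbulk : ∀ ξ : DualConfig σ G, ξ.1.1 = 0 →
      m ξ = affineFun (θL - θR) θR absorbedLeft ξ := fun ξ hξ => by
    have h0 : 0 ≤ affineFun (θL - θR) θR absorbedLeft ξ := by
      rw [← affineFun_absorbedLeft_bulk hξ θL θR ⟨0, fun _ _ => Nat.zero_le _⟩]
      exact duality_nonneg (scaleSet_nonneg hL) (scaleSet_nonneg hR) _ _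
    rw [hm]
    simp_rw [affineFun_absorbedLeft_bulk hξ θL θR]
    simp [ENNReal.toReal_ofReal h0]
  have heq : m = affineFun (θL - θR) θR absorbedLeft := by
    funext ξ
    refine tendsto_nhds_unique ?_ (tendsto_dualAct hω (dualGenerator_affineFun _ _
      (absorbedLeft_spec σ G).1) hbulk ξ)
    refine tendsto_const_nhds.congr' ?_
    filter_upwards [eventually_ge_atTop 0] with t ht
    have h1 := hmom.lawAt hm0 hL hR ht ξ
    rw [hμ t ht, hmom ξ] at h1
    exact (ENNReal.ofReal_eq_ofReal_iff (hm0 ξ)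
      ((hasRates_dual σ G).expAct_nonneg conserves_dual ht hm0 ξ)).1 h1
  rw [← heq]
  exact ⟨hmom, hm0⟩

theorem affineFun_absorbedLeft_le (hω : 0 < G.ωL ∨ 0 < G.ωR) {θL θR : ℝ} (hL : 0 ≤ θL)
    (hR : 0 ≤ θR) (ξ : DualConfig σ G) :
    affineFun (θL - θR) θR absorbedLeft ξ ≤ max θL θR ^ ξ.size := by
  have h := hasRates_dual σ G
  have hs := conserves_dual (σ := σ) (G := G)
  have h1 : dualGenerator σ G (affineFun (θL - θR) θR absorbedLeft
      + (-1 : ℝ) • fun ξ => max θL θR ^ ξ.size) = 0 := by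
    rw [h.apply_add, h.apply_smul, dualGenerator_affineFun _ _ (absorbedLeft_spec σ G).1,
      h.apply_size hs fun k => max θL θR ^ k]
    simp
  have := nonpos_of_harmonic hω h1 (fun ζ hζ => by
    have h2 := affineFun_absorbedLeft_bulk hζ θL θR ⟨0, fun _ _ => Nat.zero_le _⟩
    have h3 : θL ^ ζ.2.1 * θR ^ ζ.2.2 ≤ max θL θR ^ ζ.size := by
      have : ζ.size = ζ.2.1 + ζ.2.2 := by simp [DualConfig.size, hζ]
      rw [this, pow_add]
      have hmax : 0 ≤ max θL θR := hL.trans (le_max_left _ _)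
      gcongr
      · exact le_max_left _ _
      · exact le_max_right _ _
    simp only [Pi.add_apply, Pi.smul_apply, ← h2]
    simp [duality, hζ, dualFun]
    linarith) ξ
  simp at this
  linarith

theorem affineFun_single {f : DualConfig σ G → ℝ} (c a : ℝ) (x : Fin (n + 1))
    {ξ : DualConfig σ G} (hξ : ξ.occ = Pi.single (.inl x) 1)
    (h0 : ∀ ζ : DualConfig σ G, ζ.size = 0 → f ζ = 1) :
    affineFun c a f ξ = a + c * functional f (MvPolynomial.X (.inl x)) := by
  classical
  rw [affineFun, functional_scale, hξ, ← X_eq_mono]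
  have h1 : functional f (1 : Poly n) = 1 := by
    obtain ⟨ζ, hζ⟩ := exists_occ_eq (σ := σ) (G := G) (f := 0) fun _ _ => Nat.zero_le _
    have h2 : (1 : Poly n) = mono ζ.occ := by simp [mono, hζ]
    rw [h2, functional_mono_occ, h0]
    rw [← sum_occ, hζ]
    simp
  have h3 : MvPolynomial.aeval (fun s : Site n => (MvPolynomial.C c * MvPolynomial.X s : Poly n))
      (translate a (MvPolynomial.X (.inl x))) = c • MvPolynomial.X (.inl x) + a • 1 := by
    simp [translate, MvPolynomial.smul_eq_C_mul]
  rw [h3, map_add, map_smul, map_smul, h1]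
  simp [add_comm]

theorem profile_eq (hω : 0 < G.ωL ∨ 0 < G.ωR) {θL θR : ℝ} (hL : θL ∈ scaleSet σ)
    (hR : θR ∈ scaleSet σ) {μ : Measure (Config σ G)} [IsProbabilityMeasure μ]
    (hμ : IsStationary (generator σ G θL θR) μ) (x : Fin (n + 1)) :
    profile μ x = θR + (θL - θR) * hitLeft G (.inl x) := by
  classical
  obtain ⟨ξ, hξ⟩ := exists_occ_single σ G (.inl x)
  obtain ⟨hmom, h0⟩ := hasMoments_stationary hω hL hR hμ
  have h1 : affineFun (θL - θR) θR absorbedLeft ξ = θR + (θL - θR) * hitLeft G (.inl x) := by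
    rw [affineFun_single _ _ x hξ fun ζ hζ => ?_, functional_absorbedLeft_X hω]
    have h2 : ζ.1.1 = 0 := by
      funext y
      have := ζ.1.le_total y
      have hle : ζ.1.total ≤ ζ.size := by
        rw [DualConfig.size, Config.total]
        omega
      simp only [Pi.zero_apply]
      omega
    rw [(absorbedLeft_spec σ G).2.1 ζ h2, if_pos]
    simp only [DualConfig.size] at hζ
    omega
  have h2 : ∀ η : Config σ G, duality θL θR ξ η = (η.1 x : ℝ) / G.α x := by
    intro η
    have e1 : ξ.1.1 = Pi.single x 1 := by
      funext y
      have := congrFun hξ (.inl y)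
      simpa [DualConfig.occ, Pi.single_apply] using this
    have e2 : ξ.2.1 = 0 := by simpa [DualConfig.occ] using congrFun hξ (.inr true)
    have e3 : ξ.2.2 = 0 := by simpa [DualConfig.occ] using congrFun hξ (.inr false)
    rw [duality, e1, e2, e3, Finset.prod_eq_single x]
    · simp [dualFun, poch]
    · intro y _ hy
      simp [hy, dualFun]
    · simp
  have h3 := hmom ξ
  simp only [h2] at h3
  rw [profile, integral_eq_lintegral_of_nonneg_ae (Eventually.of_forall fun η => by positivity)
    (measurable_of_countable _).aestronglyMeasurable, h3, ENNReal.toReal_ofReal (h0 ξ), h1]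

/-- The factorial moments at time `t` of the process started from the local equilibrium. -/
theorem hasMoments_localEquilibrium {θL θR : ℝ} (hL : θL ∈ scaleSet σ) (hR : θR ∈ scaleSet σ)
    {h : Site n → ℝ} (hh : ∀ s, θR + (θL - θR) * h s ∈ scaleSet σ) (h1 : h (.inr true) = 1)
    (h0 : h (.inr false) = 0) {t : ℝ} (ht : 0 ≤ t) :
    HasMoments (lawAt (generator σ G θL θR)
        (productMeasure σ G fun x => θR + (θL - θR) * h (.inl x)) t) θL θR
        (affineFun (θL - θR) θR (dualAct t (prodFun h))) := by
  have hm := hasMoments_productMeasure (σ := σ) (G := G) (q := fun s => θR + (θL - θR) * h s)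
    (fun x => hh _) (scaleSet_nonneg (hh _)) (scaleSet_nonneg (hh _))
  simp only [h1, h0, mul_one, mul_zero, add_zero, add_sub_cancel] at hm
  have h2 := hm.lawAt (prodFun_nonneg fun s => scaleSet_nonneg (hh s)) hL hR ht
  intro ξ
  rw [h2 ξ, ← dualAct_affineFun]
  rw [show affineFun (θL - θR) θR (prodFun h) = prodFun (G := G) (σ := σ) _ from
    funext (affineFun_prodFun _ _ _)]

end Moments

end BoundaryDriven

namespace BoundaryDriven

open MarkovChain
open scoped Topology

variable {n : ℕ} {σ : SignType} {G : Geometry n}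

section Series

theorem integrable_and_hasSum_integral {S ι : Type*} [Countable S] [Countable ι]
    [MeasurableSpace S] [MeasurableSingletonClass S] {ρ : Measure S} {F : ι → S → ℂ} {b : ι → ℝ}
    {f : S → ℂ} (hb0 : ∀ i, 0 ≤ b i) (hb : Summable b)
    (hF : ∀ i, ∫⁻ s, ‖F i s‖ₑ ∂ρ ≤ ENNReal.ofReal (b i)) (hf : ∀ s, HasSum (fun i => F i s) (f s)) :
    Integrable f ρ ∧ HasSum (fun i => ∫ s, F i s ∂ρ) (∫ s, f s ∂ρ) := by
  have hm : ∀ g : S → ℂ, AEStronglyMeasurable g ρ := fun g =>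
    (measurable_of_countable g).aestronglyMeasurable
  have hint : ∀ i, Integrable (F i) ρ := fun i =>
    ⟨hm _, (hF i).trans_lt ENNReal.ofReal_lt_top⟩
  have hnorm : ∀ i, ∫ s, ‖F i s‖ ∂ρ ≤ b i := fun i => by
    rw [integral_norm_eq_lintegral_enorm (hm _)]
    exact ENNReal.toReal_le_of_le_ofReal (hb0 i) (hF i)
  have hfe : f = fun s => ∑' i, F i s := funext fun s => (hf s).tsum_eq.symm
  constructor
  · refine ⟨hm _, ?_⟩
    calc ∫⁻ s, ‖f s‖ₑ ∂ρ ≤ ∫⁻ s, ∑' i, ‖F i s‖ₑ ∂ρ := by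
          refine lintegral_mono fun s => ?_
          rw [hfe]
          exact enorm_tsum_le_tsum_enorm
      _ = ∑' i, ∫⁻ s, ‖F i s‖ₑ ∂ρ := lintegral_tsum fun i =>
          (measurable_of_countable _).aemeasurable
      _ ≤ ∑' i, ENNReal.ofReal (b i) := ENNReal.tsum_le_tsum hF
      _ = ENNReal.ofReal (∑' i, b i) := (ENNReal.ofReal_tsum_of_nonneg hb0 hb).symm
      _ < ⊤ := ENNReal.ofReal_lt_top
  · rw [hfe]
    exact hasSum_integral_of_summable_integral_norm hint (Summable.of_nonneg_of_le
      (fun i => integral_nonneg fun s => norm_nonneg _) hnorm hb)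

theorem weight_mul_dualFun_of_le {a m : ℕ} (ha : 0 < a) (hm : σ = -1 → m ≤ a) (l : ℕ) :
    weight σ a l * dualFun σ a l m = m.choose l := by
  by_cases hl : σ = -1 → l ≤ a
  · exact weight_mul_dualFun ha hl m
  · rw [weight_eq_zero hl, zero_mul]
    obtain ⟨hσ, hl⟩ := Classical.not_imp.1 hl
    rw [Nat.choose_eq_zero_of_lt ((hm hσ).trans_lt (not_le.1 hl)), Nat.cast_zero]

theorem exists_site_of_not_config {e : Fin (n + 1) → ℕ} (he : ¬ (σ = -1 → ∀ x, e x ≤ G.α x)) :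
    ∃ x, ¬ (σ = -1 → e x ≤ G.α x) := by
  obtain ⟨hσ, he⟩ := Classical.not_imp.1 he
  obtain ⟨x, hx⟩ := not_forall.1 he
  exact ⟨x, fun h => hx (h hσ)⟩

theorem hasSum_choose_mul_pow (m : ℕ) (y : ℂ) :
    HasSum (fun k => (m.choose k : ℂ) * y ^ k) ((1 + y) ^ m) := by
  have h := hasSum_weight_complex (σ := -1) (a := m) (u := y) (fun h => absurd h (by decide))
    fun h => absurd h (by decide)
  simpa [weight_neg_one, partFun] using h

theorem hasSum_prod_one_add_pow (η : Config σ G) (y : Fin (n + 1) → ℂ) :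
    HasSum (fun l : Config σ G => (∏ x, (weight σ (G.α x) (l.1 x) : ℂ) * y x ^ l.1 x)
      * ((∏ x, dualFun σ (G.α x) (l.1 x) (η.1 x) : ℝ) : ℂ)) (∏ x, (1 + y x) ^ η.1 x) := by
  have h0 := fun x => hasSum_choose_mul_pow (η.1 x) (y x)
  have h1 := hasSum_prod h0 fun x => (h0 x).summable.norm
  refine (hasSum_config h1 fun e he => ?_).congr_fun fun l => ?_
  · obtain ⟨x, hx⟩ := exists_site_of_not_config he
    obtain ⟨hσ, hx⟩ := Classical.not_imp.1 hx
    refine Finset.prod_eq_zero (Finset.mem_univ x) ?_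
    rw [Nat.choose_eq_zero_of_lt ((η.2 hσ x).trans_lt (not_le.1 hx))]
    simp
  · rw [Complex.ofReal_prod, ← Finset.prod_mul_distrib]
    refine Finset.prod_congr rfl fun x _ => ?_
    have h := congrArg (fun r : ℝ => (r : ℂ))
      (weight_mul_dualFun_of_le (σ := σ) (G.α_pos x) (fun h => η.2 h x) (l.1 x))
    simp only [Complex.ofReal_mul, Complex.ofReal_natCast] at h
    rw [← h]
    ring

theorem summable_prod_weight {u : Fin (n + 1) → ℝ} (hu0 : ∀ x, 0 ≤ u x)
    (hu : σ = 1 → ∀ x, u x < 1) :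
    HasSum (fun l : Config σ G => ∏ x, weight σ (G.α x) (l.1 x) * u x ^ l.1 x)
      (∏ x, partFun σ (G.α x) (u x)) := by
  have hu' : ∀ x, σ = 1 → |u x| < 1 := fun x h => by
    rw [abs_of_nonneg (hu0 x)]
    exact hu h x
  obtain ⟨f, hf⟩ : ∃ f : Fin (n + 1) → ℕ → ℝ, ∀ x k, f x k = weight σ (G.α x) k * u x ^ k :=
    ⟨_, fun _ _ => rfl⟩
  have h0 : ∀ x, HasSum (f x) (partFun σ (G.α x) (u x)) := fun x =>
    (hasSum_weight_real (fun _ => G.α_pos x) (hu' x)).congr_fun (hf x)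
  have h1 := hasSum_prod h0 fun x => (h0 x).summable.norm
  have h2 := hasSum_config (σ := σ) (G := G) h1 fun e he => by
    obtain ⟨x, hx⟩ := exists_site_of_not_config he
    exact Finset.prod_eq_zero (Finset.mem_univ x) (by rw [hf, weight_eq_zero hx, zero_mul])
  simp only [hf] at h2
  exact h2

/-- The generating function in terms of the factorial moments. -/
theorem genFun_moments {ρ : Measure (Config σ G)} {M : Config σ G → ℝ} {T : ℝ} (hT : 0 ≤ T)
    (hmom : ∀ l : Config σ G, ∫⁻ η, ENNReal.ofReal (∏ x, dualFun σ (G.α x) (l.1 x) (η.1 x)) ∂ρ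
      = ENNReal.ofReal (M l))
    (hM0 : ∀ l, 0 ≤ M l) (hMT : ∀ l, M l ≤ T ^ l.total) {y : Fin (n + 1) → ℂ}
    (hy : σ = 1 → ∀ x, ‖y x‖ * T < 1) :
    Integrable (fun η : Config σ G => ∏ x, (1 + y x) ^ η.1 x) ρ ∧
      HasSum (fun l : Config σ G => (∏ x, (weight σ (G.α x) (l.1 x) : ℂ) * y x ^ l.1 x) * M l)
        (∫ η, ∏ x, (1 + y x) ^ η.1 x ∂ρ) := by
  have hd0 : ∀ l η : Config σ G, 0 ≤ ∏ x, dualFun σ (G.α x) (l.1 x) (η.1 x) := fun l η =>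
    Finset.prod_nonneg fun x _ => dualFun_nonneg (G.α_pos x) fun h => l.2 h x
  have hw0 : ∀ l : Config σ G, 0 ≤ ∏ x, weight σ (G.α x) (l.1 x) * ‖y x‖ ^ l.1 x := fun l =>
    Finset.prod_nonneg fun x _ => mul_nonneg (weight_nonneg _ _ _) (by positivity)
  have hnorm : ∀ l : Config σ G, ‖∏ x, (weight σ (G.α x) (l.1 x) : ℂ) * y x ^ l.1 x‖
      = ∏ x, weight σ (G.α x) (l.1 x) * ‖y x‖ ^ l.1 x := fun l => by
    rw [norm_prod]
    refine Finset.prod_congr rfl fun x _ => ?_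
    rw [norm_mul, norm_pow, Complex.norm_real, Real.norm_of_nonneg (weight_nonneg _ _ _)]
  have hb : Summable fun l : Config σ G =>
      (∏ x, weight σ (G.α x) (l.1 x) * ‖y x‖ ^ l.1 x) * M l := by
    refine Summable.of_nonneg_of_le (fun l => mul_nonneg (hw0 l) (hM0 l)) (fun l => ?_)
      (summable_prod_weight (σ := σ) (G := G) (u := fun x => ‖y x‖ * T)
        (fun x => by positivity) hy).summable
    refine (mul_le_mul_of_nonneg_left (hMT l) (hw0 l)).trans_eq ?_
    rw [Config.total, ← Finset.prod_pow_eq_pow_sum, ← Finset.prod_mul_distrib]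
    exact Finset.prod_congr rfl fun x _ => by rw [mul_pow, mul_assoc]
  have hle : ∀ l : Config σ G, ∫⁻ η, ‖(∏ x, (weight σ (G.α x) (l.1 x) : ℂ) * y x ^ l.1 x)
      * ((∏ x, dualFun σ (G.α x) (l.1 x) (η.1 x) : ℝ) : ℂ)‖ₑ ∂ρ
      ≤ ENNReal.ofReal ((∏ x, weight σ (G.α x) (l.1 x) * ‖y x‖ ^ l.1 x) * M l) := fun l => by
    rw [ENNReal.ofReal_mul (hw0 l), ← hmom, ← lintegral_const_mul _ (measurable_of_countable _)]
    refine lintegral_mono fun η => ?_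
    rw [← ofReal_norm, norm_mul, hnorm, Complex.norm_real, Real.norm_of_nonneg (hd0 l η),
      ENNReal.ofReal_mul (hw0 l)]
  obtain ⟨h1, h2⟩ := integrable_and_hasSum_integral
    (fun l => mul_nonneg (hw0 l) (hM0 l)) hb hle fun η => hasSum_prod_one_add_pow η y
  refine ⟨h1, h2.congr_fun fun l => ?_⟩
  rw [integral_const_mul, integral_complex_ofReal, integral_eq_lintegral_of_nonneg_ae
    (Eventually.of_forall fun η => hd0 l η) (measurable_of_countable _).aestronglyMeasurable,
    hmom, ENNReal.toReal_ofReal (hM0 l)]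

end Series

section Rearrangement

/-- The single-site contributions to the double series of the generating function. -/
def siteTerm (σ : SignType) (a : ℕ) (c θ : ℝ) (y : ℂ) (p : ℕ × ℕ) : ℂ :=
  (weight σ a p.2 : ℂ) * (p.2.choose p.1 : ℂ) * y ^ p.2 * (θ : ℂ) ^ (p.2 - p.1) * (c : ℂ) ^ p.1

theorem norm_siteTerm (a : ℕ) (c : ℝ) {θ : ℝ} (hθ : 0 ≤ θ) (y : ℂ) (p : ℕ × ℕ) :
    ‖siteTerm σ a c θ y p‖
      = weight σ a p.2 * p.2.choose p.1 * ‖y‖ ^ p.2 * θ ^ (p.2 - p.1) * |c| ^ p.1 := by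
  simp only [siteTerm, norm_mul, norm_pow, Complex.norm_real, Complex.norm_natCast,
    Real.norm_of_nonneg (weight_nonneg _ _ _), Real.norm_of_nonneg hθ, Real.norm_eq_abs c]

theorem siteTerm_eq_zero {a : ℕ} {c θ : ℝ} {y : ℂ} {p : ℕ × ℕ} (hp : ¬ (σ = -1 → p.1 ≤ a)) :
    siteTerm σ a c θ y p = 0 := by
  rw [siteTerm]
  rcases lt_or_ge p.2 p.1 with h | h
  · rw [Nat.choose_eq_zero_of_lt h]
    simp
  · rw [weight_eq_zero fun h' => hp fun hσ => h.trans (h' hσ)]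
    simp

theorem hasSum_siteTerm_right {a l : ℕ} (ha : 0 < a) (hl : σ = -1 → l ≤ a) {c θ : ℝ} {y : ℂ}
    (hu : σ = 1 → ‖y * θ‖ < 1) :
    HasSum (fun k => siteTerm σ a c θ y (l, k))
      ((weight σ a l : ℂ) * (c * y) ^ l * partFun σ (shiftParam σ a l) (y * θ)) := by
  have h := (hasSum_weight_choose_complex ha hl hu).mul_right ((c : ℂ) ^ l)
  convert! h using 1
  simp only [mul_pow]
  ring

theorem summable_siteTerm {a : ℕ} (ha : 0 < a) {c θ : ℝ} (hθ : 0 ≤ θ) {y : ℂ}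
    (hu : σ = 1 → ‖y‖ * (θ + 2 * |c|) < 1) :
    Summable fun p : ℕ × ℕ => ‖siteTerm σ a c θ y p‖ * 2 ^ p.1 := by
  rw [← (Equiv.prodComm ℕ ℕ).summable_iff, summable_prod_of_nonneg fun p => by
    simp only [Function.comp_apply, Pi.zero_apply]
    positivity]
  have hrow : ∀ k, HasSum (fun j => ‖siteTerm σ a c θ y (j, k)‖ * (2 : ℝ) ^ j)
      (weight σ a k * (‖y‖ * (θ + 2 * |c|)) ^ k) := by
    intro k
    have h := hasSum_sum_of_ne_finset_zero (L := .unconditional ℕ)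
      (f := fun j => ‖siteTerm σ a c θ y (j, k)‖ * (2 : ℝ) ^ j)
      (s := Finset.range (k + 1)) fun j hj => by
        rw [norm_siteTerm a c hθ]
        simp only
        rw [Nat.choose_eq_zero_of_lt (by simpa using hj)]
        simp
    convert! h using 1
    rw [mul_pow, add_comm θ, add_pow, Finset.mul_sum, Finset.mul_sum]
    refine Finset.sum_congr rfl fun j _ => ?_
    rw [norm_siteTerm a c hθ, mul_pow]
    simp only
    ring
  refine ⟨fun k => (hrow k).summable, ?_⟩
  have h1 := (hasSum_weight_real (σ := σ) (a := a) (fun _ => ha)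
    (u := ‖y‖ * (θ + 2 * |c|)) fun h => by
      rw [abs_of_nonneg (by positivity)]
      exact hu h).summable
  exact h1.congr fun k => (hrow k).tsum_eq.symm

/-- The generating function in terms of the correlation functions `ψ`. -/
theorem genFun_hasSum {ρ : Measure (Config σ G)} {f : DualConfig σ G → ℝ} {T c a : ℝ} (hT : 0 ≤ T)
    (hmom : ∀ l : Config σ G, ∫⁻ η, ENNReal.ofReal (∏ x, dualFun σ (G.α x) (l.1 x) (η.1 x)) ∂ρ
      = ENNReal.ofReal (affineFun c a f (l, 0, 0)))
    (hM0 : ∀ l : Config σ G, 0 ≤ affineFun c a f (l, 0, 0))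
    (hMT : ∀ l : Config σ G, affineFun c a f (l, 0, 0) ≤ T ^ l.total)
    (hψ : ∀ l : Config σ G, |functional f (centred G l.1)| ≤ ∏ x, (2 : ℝ) ^ l.1 x)
    {θ : Fin (n + 1) → ℝ} (hθ : ∀ x, θ x = a + c * hitLeft G (.inl x)) (hθ0 : ∀ x, 0 ≤ θ x)
    {y : Fin (n + 1) → ℂ} (hy : σ = 1 → ∀ x, ‖y x‖ * T < 1)
    (hy' : σ = 1 → ∀ x, ‖y x‖ * (θ x + 2 * |c|) < 1) :
    HasSum (fun e : Config σ G => (∏ x, (weight σ (G.α x) (e.1 x) : ℂ) * (c * y x) ^ e.1 x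
        * partFun σ (shiftParam σ (G.α x) (e.1 x)) (y x * θ x))
        * (functional f (centred G e.1) : ℂ))
      (∫ η, ∏ x, (1 + y x) ^ η.1 x ∂ρ) := by
  classical
  have hgen := (genFun_moments hT hmom hM0 hMT hy).2
  obtain ⟨u, hu⟩ : ∃ u : Fin (n + 1) → ℕ × ℕ → ℂ,
      ∀ x p, u x p = siteTerm σ (G.α x) c (θ x) (y x) p := ⟨_, fun _ _ => rfl⟩
  obtain ⟨Ψ, hΨ⟩ : ∃ Ψ : (Fin (n + 1) → ℕ) → ℂ,
      ∀ e, Ψ e = (functional f (centred G e) : ℂ) := ⟨_, fun _ => rfl⟩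
  obtain ⟨U, hU⟩ : ∃ U : (Fin (n + 1) → ℕ) × (Fin (n + 1) → ℕ) → ℂ,
      ∀ p, U p = (∏ x, u x (p.1 x, p.2 x)) * Ψ p.1 := ⟨_, fun _ => rfl⟩
  have hnc : ∀ e l : Fin (n + 1) → ℕ, ¬ (σ = -1 → ∀ x, e x ≤ G.α x) →
      ∏ x, u x (e x, l x) = 0 := by
    intro e l he
    obtain ⟨x, hx⟩ := exists_site_of_not_config he
    exact Finset.prod_eq_zero (Finset.mem_univ x) (by rw [hu, siteTerm_eq_zero hx])
  have hbound : Summable fun p : (Fin (n + 1) → ℕ) × (Fin (n + 1) → ℕ) =>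
      ∏ x, ‖u x (p.1 x, p.2 x)‖ * (2 : ℝ) ^ p.1 x := by
    obtain ⟨v, hv⟩ : ∃ v : Fin (n + 1) → ℕ × ℕ → ℝ, ∀ x p, v x p = ‖u x p‖ * (2 : ℝ) ^ p.1 :=
      ⟨_, fun _ _ => rfl⟩
    have hvs : ∀ x, Summable (v x) := fun x => by
      refine (summable_siteTerm (σ := σ) (G.α_pos x) (hθ0 x) fun h => hy' h x).congr fun p => ?_
      rw [hv, hu]
    have h := (summable_norm_prod_and_hasSum v fun x => (hvs x).norm).2.summable
    have h2 : Summable ((fun q : Fin (n + 1) → ℕ × ℕ => ∏ x, v x (q x)) ∘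
        (Equiv.arrowProdEquivProdArrow (Fin (n + 1)) (fun _ => ℕ) fun _ => ℕ).symm) :=
      (Equiv.summable_iff _).2 h
    refine h2.congr fun p => ?_
    rw [Function.comp_apply]
    exact Finset.prod_congr rfl fun x _ => hv x _
  have hsum : Summable U := by
    refine Summable.of_norm_bounded hbound fun p => ?_
    rw [hU, norm_mul, norm_prod, Finset.prod_mul_distrib]
    by_cases hp : σ = -1 → ∀ x, p.1 x ≤ G.α x
    · refine mul_le_mul_of_nonneg_left ?_ (Finset.prod_nonneg fun x _ => norm_nonneg _)
      rw [hΨ, Complex.norm_real]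
      exact hψ ⟨p.1, hp⟩
    · rw [← norm_prod, hnc _ _ hp]
      simp
  have hrow : ∀ l : Fin (n + 1) → ℕ, HasSum (fun e => U (e, l))
      (∑ e ∈ Fintype.piFinset fun x => Finset.range (l x + 1), U (e, l)) := by
    intro l
    refine hasSum_sum_of_ne_finset_zero fun e he => ?_
    rw [Fintype.mem_piFinset, not_forall] at he
    obtain ⟨x, hx⟩ := he
    rw [hU, Finset.prod_eq_zero (Finset.mem_univ x), zero_mul]
    rw [hu, siteTerm]
    simp only
    rw [Nat.choose_eq_zero_of_lt (by simpa using hx)]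
    simp
  have hcol : ∀ e : Config σ G, HasSum (fun l => U (e.1, l))
      ((∏ x, (weight σ (G.α x) (e.1 x) : ℂ) * (c * y x) ^ e.1 x
        * partFun σ (shiftParam σ (G.α x) (e.1 x)) (y x * θ x)) * Ψ e.1) := by
    intro e
    have h0 : ∀ x, HasSum (fun k => u x (e.1 x, k)) ((weight σ (G.α x) (e.1 x) : ℂ)
        * (c * y x) ^ e.1 x * partFun σ (shiftParam σ (G.α x) (e.1 x)) (y x * θ x)) := by
      intro x
      simp only [hu]
      refine hasSum_siteTerm_right (G.α_pos x) (fun h => e.2 h x) fun h => ?_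
      rw [norm_mul, Complex.norm_real, Real.norm_of_nonneg (hθ0 x)]
      refine lt_of_le_of_lt (mul_le_mul_of_nonneg_left ?_ (norm_nonneg _)) (hy' h x)
      linarith [abs_nonneg c]
    have h1 := hasSum_prod h0 fun x => (h0 x).summable.norm
    refine (h1.mul_right (Ψ e.1)).congr_fun fun l => ?_
    rw [hU]
  have hA : HasSum (fun l : Fin (n + 1) → ℕ =>
      ∑ e ∈ Fintype.piFinset fun x => Finset.range (l x + 1), U (e, l)) (∑' p, U p) :=
    ((Equiv.prodComm _ _).hasSum_iff.2 hsum.hasSum).prod_fiberwise fun l => hrow l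
  have hA' := hasSum_config (σ := σ) (G := G) hA fun l hl => by
    refine Finset.sum_eq_zero fun e _ => ?_
    rw [hU]
    obtain ⟨x, hx⟩ := exists_site_of_not_config hl
    rw [Finset.prod_eq_zero (Finset.mem_univ x), zero_mul]
    rw [hu, siteTerm, weight_eq_zero hx]
    simp
  have hS : ∑' p, U p = ∫ η, ∏ x, (1 + y x) ^ η.1 x ∂ρ := by
    refine hA'.unique (hgen.congr_fun fun l => ?_)
    rw [affineFun_bulk, Complex.ofReal_sum, Finset.mul_sum]
    refine Finset.sum_congr rfl fun e _ => ?_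
    rw [hU, hΨ, Complex.ofReal_mul, ← mul_assoc, Complex.ofReal_prod, ← Finset.prod_mul_distrib]
    congr 1
    refine Finset.prod_congr rfl fun x _ => ?_
    rw [hu, siteTerm, hθ]
    push_cast
    ring
  rw [← hS]
  have hB : HasSum (fun e => ∑' l, U (e, l)) (∑' p, U p) :=
    hsum.hasSum.prod_fiberwise fun e => (hsum.prod_factor e).hasSum
  refine (hasSum_config (σ := σ) (G := G) hB fun e he => ?_).congr_fun fun e => ?_
  · simp only [hU, hnc e _ he, zero_mul, tsum_zero]
  · rw [(hcol e).tsum_eq, hΨ]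

end Rearrangement

end BoundaryDriven

namespace BoundaryDriven

open MarkovChain
open scoped Topology

variable {n : ℕ}

section CauchyEstimate

theorem norm_coeff_le {c : ℕ → ℂ} {g : ℂ → ℂ}
    (h : ∀ z : ℂ, ‖z‖ < 1 → HasSum (fun k => c k * z ^ k) (g z)) {r B : ℝ} (hr0 : 0 < r)
    (hr1 : r < 1) (hB : ∀ z : ℂ, ‖z‖ = r → ‖g z‖ ≤ B) (k : ℕ) : ‖c k‖ ≤ B / r ^ k := by
  set p : FormalMultilinearSeries ℂ ℂ ℂ := .ofScalars ℂ c with hp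
  have hpn : ∀ k (z : ℂ), p k (fun _ => z) = c k * z ^ k := fun k z => by
    simp [hp, FormalMultilinearSeries.ofScalars, smul_eq_mul]
  have hrad : (1 : ENNReal) ≤ p.radius := by
    refine ENNReal.le_of_forall_nnreal_lt fun ρ hρ => ?_
    refine p.le_radius_of_summable ?_
    have hρ' : ‖((ρ : ℝ) : ℂ)‖ < 1 := by
      rw [Complex.norm_real, Real.norm_of_nonneg (NNReal.coe_nonneg ρ)]
      exact_mod_cast hρ
    have h1 := (h _ hρ').summable.norm
    refine Summable.of_nonneg_of_le (fun k => by positivity) (fun k => ?_) h1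
    rw [norm_mul, norm_pow, Complex.norm_real, Real.norm_of_nonneg (NNReal.coe_nonneg ρ)]
    refine mul_le_mul_of_nonneg_right ?_ (by positivity)
    exact (FormalMultilinearSeries.ofScalars_norm ℂ c k).le
  have hg : HasFPowerSeriesOnBall g p 0 1 :=
    { r_le := hrad
      r_pos := one_pos
      hasSum := fun {y} hy => by
        rw [zero_add]
        refine (h y ?_).congr_fun fun k => hpn k y
        rw [Metric.mem_eball, edist_zero_right, ← ofReal_norm] at hy
        exact ENNReal.ofReal_lt_one.1 hy }
  have hd : DifferentiableOn ℂ g (Metric.eball 0 1) := hg.differentiableOn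
  have hsub : Metric.closedBall (0 : ℂ) r ⊆ Metric.eball 0 1 := fun z hz => by
    rw [Metric.mem_eball, edist_zero_right]
    have : ‖z‖ < 1 := (mem_closedBall_zero_iff.1 hz).trans_lt hr1
    rw [← ofReal_norm]
    exact ENNReal.ofReal_lt_one.2 this
  have hcl : DiffContOnCl ℂ g (Metric.ball 0 r) := by
    refine DifferentiableOn.diffContOnCl ?_
    rw [closure_ball _ hr0.ne']
    exact hd.mono hsub
  have h1 := Complex.norm_iteratedDeriv_le_of_forall_mem_sphere_norm_le k hr0 hcl
    fun z hz => hB z (mem_sphere_zero_iff_norm.1 hz)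
  have h2 := hg.factorial_smul 1 k
  rw [hpn, one_pow, mul_one] at h2
  rw [iteratedDeriv_eq_iteratedFDeriv, ← h2, nsmul_eq_mul, norm_mul, Complex.norm_natCast,
    mul_div_assoc] at h1
  exact le_of_mul_le_mul_left h1 (by positivity)

theorem one_sub_le_norm {z : ℂ} {r p : ℝ} (hz : ‖z‖ ≤ r) (hp0 : 0 ≤ p) (hp1 : p ≤ 1) :
    1 - r ≤ ‖1 + z * p‖ := by
  have h1 : ‖z * (p : ℂ)‖ ≤ r := by
    rw [norm_mul, Complex.norm_real, Real.norm_of_nonneg hp0]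
    exact (mul_le_of_le_one_right (norm_nonneg z) hp1).trans hz
  have h2 := norm_sub_norm_le (1 : ℂ) (-(z * p))
  rw [norm_neg, sub_neg_eq_add, norm_one] at h2
  linarith

theorem re_div_le {z : ℂ} {r p : ℝ} (hz : ‖z‖ = r) (hr1 : r < 1) (hp0 : 0 ≤ p) (hp1 : p ≤ 1) :
    (z / (1 + z * p)).re ≤ r := by
  have hr0 : 0 ≤ r := hz ▸ norm_nonneg z
  have hpos : 0 < Complex.normSq (1 + z * p) := by
    rw [Complex.normSq_pos]
    intro h
    have := one_sub_le_norm hz.le hp0 hp1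
    rw [h, norm_zero] at this
    linarith
  have hsq : z.re * z.re + z.im * z.im = r ^ 2 := by
    rw [← hz, ← Complex.normSq_eq_norm_sq, Complex.normSq_apply]
  have hx : |z.re| ≤ r := hz ▸ Complex.abs_re_le_norm z
  obtain ⟨hx1, hx2⟩ := abs_le.1 hx
  rw [Complex.div_re, ← add_div, div_le_iff₀ hpos, Complex.normSq_apply]
  simp only [Complex.add_re, Complex.one_re, Complex.mul_re, Complex.ofReal_re, Complex.ofReal_im,
    mul_zero, sub_zero, Complex.add_im, Complex.one_im, Complex.mul_im, zero_add]
  have him : z.im * z.im = r ^ 2 - z.re * z.re := by linarith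
  have hpr : p * r ≤ 1 := by nlinarith
  have hpr0 : 0 ≤ p * r := by positivity
  have e1 : z.re * (1 + z.re * p) + z.im * (z.im * p) = z.re + p * r ^ 2 := by
    linear_combination p * him
  have e2 : (1 + z.re * p) * (1 + z.re * p) + z.im * p * (z.im * p)
      = 1 + 2 * p * z.re + p ^ 2 * r ^ 2 := by
    linear_combination p ^ 2 * him
  rw [e1, e2]
  nlinarith [mul_nonneg (sub_nonneg.2 hx2) (sub_nonneg.2 hpr), mul_nonneg hpr0 hpr0,
    mul_nonneg (mul_nonneg hr0 (sub_nonneg.2 hpr)) (sub_nonneg.2 hpr),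
    mul_nonneg (by linarith : 0 ≤ z.re + r) hpr0,
    mul_nonneg (mul_nonneg hr0 hpr0) hpr0]

theorem norm_one_add_div_le {z : ℂ} {r p θ : ℝ} (hz : ‖z‖ = r) (hr1 : r < 1) (hp0 : 0 ≤ p)
    (hp1 : p ≤ 1) (hθ0 : 0 < θ) (hθ : 1 ≤ θ * (1 - r) ^ 3) :
    ‖1 + z / θ / (1 + z * p)‖ ≤ 1 + (1 + r) / 2 / θ := by
  have hr0 : 0 ≤ r := hz ▸ norm_nonneg z
  have hr1' : 0 < 1 - r := by linarith
  set w := z / (1 + z * p) with hw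
  have hre : w.re ≤ r := re_div_le hz hr1 hp0 hp1
  have hden := one_sub_le_norm hz.le hp0 hp1
  have hnw : ‖w‖ ≤ (1 - r)⁻¹ := by
    rw [hw, norm_div, hz, div_le_iff₀ (by linarith)]
    calc r ≤ 1 := hr1.le
      _ = (1 - r)⁻¹ * (1 - r) := (inv_mul_cancel₀ hr1'.ne').symm
      _ ≤ _ := mul_le_mul_of_nonneg_left hden (by positivity)
  have e1 : z / θ / (1 + z * p) = w * ((θ⁻¹ : ℝ) : ℂ) := by
    rw [hw]
    push_cast
    ring
  rw [e1]
  refine abs_le_of_sq_le_sq' ?_ (by positivity) |>.2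
  rw [← Complex.normSq_eq_norm_sq, Complex.normSq_apply]
  simp only [Complex.add_re, Complex.one_re, Complex.mul_re, Complex.ofReal_re, Complex.ofReal_im,
    mul_zero, sub_zero, Complex.add_im, Complex.one_im, Complex.mul_im, zero_add]
  have hsq : w.re * w.re + w.im * w.im ≤ ((1 - r)⁻¹) ^ 2 := by
    rw [← Complex.normSq_apply, Complex.normSq_eq_norm_sq]
    gcongr
  set u := θ⁻¹ with hu
  have hu0 : 0 < u := by positivity
  have hkey : ((1 - r)⁻¹) ^ 2 * u ≤ 1 - r := by
    rw [hu, inv_pow, ← mul_inv, inv_le_iff_one_le_mul₀ (by positivity)]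
    nlinarith
  have h1 : (w.re * w.re + w.im * w.im) * u ≤ 1 - r :=
    (mul_le_mul_of_nonneg_right hsq hu0.le).trans hkey
  have h2 : (w.re * w.re + w.im * w.im) * u * u ≤ (1 - r) * u :=
    mul_le_mul_of_nonneg_right h1 hu0.le
  have h3 : w.re * u ≤ r * u := mul_le_mul_of_nonneg_right hre hu0.le
  have h4 : (1 + r) / 2 / θ = (1 + r) / 2 * u := by rw [hu]; ring
  rw [h4]
  nlinarith [mul_nonneg hu0.le hu0.le, mul_nonneg (mul_nonneg hu0.le hu0.le) (sq_nonneg (1 + r))]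

/-- The polynomials whose products have the expectations `weight · ψ`. -/
def centredDual (a : ℕ) (p θ : ℝ) (k m : ℕ) : ℝ :=
  weight 1 a k * ∑ j ∈ Finset.range (k + 1),
    (-p) ^ (k - j) * (k.choose j : ℝ) * ((θ⁻¹) ^ j * dualFun 1 a j m)

theorem hasSum_centredDual {a : ℕ} (ha : 0 < a) {p : ℝ} (hp0 : 0 ≤ p) (hp1 : p ≤ 1) (θ : ℝ) (m : ℕ)
    {z : ℂ} (hz : ‖z‖ < 1) :
    HasSum (fun k => (centredDual a p θ k m : ℂ) * z ^ k)
      (((1 + z * p) ^ a)⁻¹ * (1 + z / θ / (1 + z * p)) ^ m) := by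
  have h0 : ‖z * ((-p : ℝ) : ℂ)‖ < 1 := by
    rw [norm_mul, Complex.norm_real, norm_neg, Real.norm_of_nonneg hp0]
    exact (mul_le_of_le_one_right (norm_nonneg z) hp1).trans_lt hz
  have hne : (1 : ℂ) + z * p ≠ 0 := by
    intro h
    have := one_sub_le_norm le_rfl hp0 hp1 (z := z)
    rw [h, norm_zero] at this
    linarith
  have h1 : ∀ j, HasSum (fun k => (weight 1 a k : ℂ) * (k.choose j : ℂ) * z ^ k
        * ((-p : ℝ) : ℂ) ^ (k - j) * (((θ⁻¹) ^ j * dualFun 1 a j m : ℝ) : ℂ))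
      ((m.choose j : ℂ) * (z / θ / (1 + z * p)) ^ j * ((1 + z * p) ^ a)⁻¹) := by
    intro j
    have h := (hasSum_weight_choose_complex (σ := 1) (l := j) ha (fun h => absurd h (by decide))
      fun _ => h0).mul_right (((θ⁻¹) ^ j * dualFun 1 a j m : ℝ) : ℂ)
    convert! h using 1
    have hw := congrArg (fun x : ℝ => (x : ℂ)) (weight_mul_dualFun_of_le (σ := 1) (m := m) ha
      (fun h => absurd h (by decide)) j)
    simp only [Complex.ofReal_mul, Complex.ofReal_natCast] at hw
    rw [← hw, shiftParam_one, partFun, if_neg (by decide), if_neg (by decide), pow_add]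
    push_cast
    rw [mul_neg, sub_neg_eq_add]
    generalize (1 : ℂ) + z * p = D
    rw [div_pow, div_pow, inv_pow, mul_inv]
    ring
  have h2 := hasSum_sum (s := Finset.range (m + 1)) fun j _ => h1 j
  have h3 : ∑ j ∈ Finset.range (m + 1),
      (m.choose j : ℂ) * (z / θ / (1 + z * p)) ^ j * ((1 + z * p) ^ a)⁻¹
      = ((1 + z * p) ^ a)⁻¹ * (1 + z / θ / (1 + z * p)) ^ m := by
    rw [add_comm 1 (z / θ / (1 + z * p)), add_pow (z / θ / (1 + z * p)) 1, Finset.mul_sum]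
    refine Finset.sum_congr rfl fun j _ => ?_
    rw [one_pow]
    ring
  rw [h3] at h2
  refine h2.congr_fun fun k => ?_
  have hext : ∀ N M : ℕ, (∀ j, N ≤ j → j < M → (k.choose j : ℂ) * ((dualFun 1 a j m : ℝ) : ℂ) = 0) →
      N ≤ M → ∑ j ∈ Finset.range N, (weight 1 a k : ℂ) * (k.choose j : ℂ) * z ^ k
        * ((-p : ℝ) : ℂ) ^ (k - j) * (((θ⁻¹) ^ j * dualFun 1 a j m : ℝ) : ℂ)
      = ∑ j ∈ Finset.range M, (weight 1 a k : ℂ) * (k.choose j : ℂ) * z ^ k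
        * ((-p : ℝ) : ℂ) ^ (k - j) * (((θ⁻¹) ^ j * dualFun 1 a j m : ℝ) : ℂ) := by
    intro N M h hNM
    refine Finset.sum_subset (Finset.range_mono hNM) fun j hj hj' => ?_
    have := h j (by simpa using hj') (Finset.mem_range.1 hj)
    rw [Complex.ofReal_mul]
    linear_combination ((weight 1 a k : ℂ) * z ^ k * ((-p : ℝ) : ℂ) ^ (k - j)
      * ((θ⁻¹ ^ j : ℝ) : ℂ)) * this
  have hA : ∑ j ∈ Finset.range (m + 1), (weight 1 a k : ℂ) * (k.choose j : ℂ) * z ^ k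
        * ((-p : ℝ) : ℂ) ^ (k - j) * (((θ⁻¹) ^ j * dualFun 1 a j m : ℝ) : ℂ)
      = ∑ j ∈ Finset.range (k + 1), (weight 1 a k : ℂ) * (k.choose j : ℂ) * z ^ k
        * ((-p : ℝ) : ℂ) ^ (k - j) * (((θ⁻¹) ^ j * dualFun 1 a j m : ℝ) : ℂ) := by
    rcases le_total m k with hmk | hmk
    · refine hext _ _ (fun j hj _ => ?_) (by omega)
      rw [dualFun, Nat.descFactorial_of_lt (by omega)]
      simp
    · refine (hext _ _ (fun j hj _ => ?_) (by omega)).symm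
      rw [Nat.choose_eq_zero_of_lt (by omega)]
      simp
  rw [hA, centredDual]
  push_cast
  rw [Finset.mul_sum, Finset.sum_mul]
  refine Finset.sum_congr rfl fun j _ => ?_
  ring

theorem abs_centredDual_le {a : ℕ} (ha : 0 < a) {p r θ : ℝ} (hp0 : 0 ≤ p) (hp1 : p ≤ 1)
    (hr0 : 0 < r) (hr1 : r < 1) (hθ0 : 0 < θ) (hθ : 1 ≤ θ * (1 - r) ^ 3) (k m : ℕ) :
    |centredDual a p θ k m|
      ≤ ((1 - r) ^ a)⁻¹ * (1 + (1 + r) / 2 / θ) ^ m * (r⁻¹) ^ k := by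
  have h := norm_coeff_le (fun z hz => hasSum_centredDual ha hp0 hp1 θ m hz) hr0 hr1
    (B := ((1 - r) ^ a)⁻¹ * (1 + (1 + r) / 2 / θ) ^ m) (fun z hz => ?_) k
  · rw [Complex.norm_real, Real.norm_eq_abs] at h
    rwa [inv_pow, ← div_eq_mul_inv]
  · have hr : 0 < 1 - r := by linarith
    rw [norm_mul, norm_inv, norm_pow, norm_pow]
    gcongr
    · exact one_sub_le_norm hz.le hp0 hp1
    · exact norm_one_add_div_le hz hr1 hp0 hp1 hθ0 hθ

end CauchyEstimate

section Bound

variable {G : Geometry n}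

theorem weight_mul_functional_centred {ρ : Measure (Config 1 G)} {f : DualConfig 1 G → ℝ} {θ : ℝ}
    (hθ : 0 < θ) (hf : ∀ ξ, 0 ≤ f ξ)
    (hmom : ∀ l : Config 1 G, ∫⁻ η, ENNReal.ofReal (∏ x, dualFun 1 (G.α x) (l.1 x) (η.1 x)) ∂ρ
      = ENNReal.ofReal (θ ^ l.total * f (l, 0, 0))) (e : Fin (n + 1) → ℕ) :
    (∏ x, weight 1 (G.α x) (e x)) * functional f (centred G e)
      = ∫ η : Config 1 G, ∏ x, centredDual (G.α x) (hitLeft G (.inl x)) θ (e x) (η.1 x) ∂ρ := by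
  classical
  have hd0 : ∀ l η : Config 1 G, 0 ≤ ∏ x, dualFun 1 (G.α x) (l.1 x) (η.1 x) := fun l η =>
    Finset.prod_nonneg fun x _ => dualFun_nonneg (G.α_pos x) fun h => l.2 h x
  have hint : ∀ l : Config 1 G,
      Integrable (fun η : Config 1 G => ∏ x, dualFun 1 (G.α x) (l.1 x) (η.1 x)) ρ := fun l => by
    refine ⟨(measurable_of_countable _).aestronglyMeasurable, ?_⟩
    rw [hasFiniteIntegral_iff_ofReal (Eventually.of_forall fun η => hd0 l η), hmom]
    exact ENNReal.ofReal_lt_top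
  have hval : ∀ l : Config 1 G, ∫ η, ∏ x, dualFun 1 (G.α x) (l.1 x) (η.1 x) ∂ρ
      = θ ^ l.total * f (l, 0, 0) := fun l => by
    rw [integral_eq_lintegral_of_nonneg_ae (Eventually.of_forall fun η => hd0 l η)
      (hint l).1, hmom, ENNReal.toReal_ofReal (mul_nonneg (by positivity) (hf _))]
  have hexp : ∀ η : Config 1 G,
      ∏ x, centredDual (G.α x) (hitLeft G (.inl x)) θ (e x) (η.1 x)
      = (∏ x, weight 1 (G.α x) (e x)) * ∑ j ∈ Fintype.piFinset fun x => Finset.range (e x + 1),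
        ((∏ x, ((-hitLeft G (.inl x)) ^ (e x - j x) * ((e x).choose (j x) : ℝ)))
          * ∏ x, (θ⁻¹) ^ j x) * ∏ x, dualFun 1 (G.α x) (j x) (η.1 x) := by
    intro η
    simp only [centredDual, Finset.prod_mul_distrib, Finset.prod_univ_sum]
    congr 1
    refine Finset.sum_congr rfl fun j _ => ?_
    ring
  simp only [hexp]
  rw [integral_const_mul, integral_finsetSum _ fun j _ => (hint ⟨j, fun h => absurd h (by decide)⟩).const_mul _,
    functional_centred]
  congr 1
  refine Finset.sum_congr rfl fun j _ => ?_
  have hj := hval ⟨j, fun h => absurd h (by decide)⟩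
  rw [integral_const_mul, hj, valueAt, dif_pos fun h => absurd h (by decide), mul_assoc]
  congr 1
  rw [Config.total, ← Finset.prod_pow_eq_pow_sum, ← mul_assoc, ← Finset.prod_mul_distrib]
  simp [hθ.ne']

theorem affineFun_zero {σ : SignType} (c : ℝ) (f : DualConfig σ G → ℝ) (ξ : DualConfig σ G) :
    affineFun c 0 f ξ = c ^ ξ.size * f ξ := by
  have h : translate 0 (mono ξ.occ : Poly n) = mono ξ.occ := by
    rw [translate_mono]
    simp [mono]
  rw [affineFun, h, functional_mono_occ]

theorem HasMoments.bulk {σ : SignType} {ρ : Measure (Config σ G)} {θL θR : ℝ}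
    {m : DualConfig σ G → ℝ} (h : HasMoments ρ θL θR m) (l : Config σ G) :
    ∫⁻ η, ENNReal.ofReal (∏ x, dualFun σ (G.α x) (l.1 x) (η.1 x)) ∂ρ
      = ENNReal.ofReal (m (l, 0, 0)) := by
  rw [← h]
  simp [duality]

theorem size_bulk {σ : SignType} (l : Config σ G) :
    DualConfig.size ((l, 0, 0) : DualConfig σ G) = l.total := rfl

theorem dualAct_mem {σ : SignType} {h : Site n → ℝ} (hh : ∀ s, 0 ≤ h s ∧ h s ≤ 1) {t : ℝ}
    (ht : 0 ≤ t) (ξ : DualConfig σ G) :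
    0 ≤ dualAct t (prodFun h) ξ ∧ dualAct t (prodFun h) ξ ≤ 1 := by
  have h' := hasRates_dual σ G
  have hs := conserves_dual (σ := σ) (G := G)
  refine ⟨h'.expAct_nonneg hs ht (prodFun_nonneg fun s => (hh s).1) ξ, ?_⟩
  refine (h'.expAct_mono hs ht fun ζ _ => ?_).trans_eq (h'.expAct_size hs t (fun _ => 1) ξ)
  exact Finset.prod_le_one (fun s _ => pow_nonneg (hh s).1 _) fun s _ =>
    pow_le_one₀ (hh s).1 (hh s).2

/-- The exponential bound on `ψ_t`, uniform in time and in the function evolved. -/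
theorem exists_bound_dualAct (G : Geometry n) {r : ℝ} (hr0 : 0 < r) (hr1 : r < 1) :
    ∃ C : ℝ, ∀ h : Site n → ℝ, (∀ s, 0 ≤ h s ∧ h s ≤ 1) → h (.inr true) = 1 →
      h (.inr false) = 0 → ∀ t : ℝ, 0 ≤ t → ∀ e : Fin (n + 1) → ℕ,
        (∏ x, weight 1 (G.α x) (e x))
            * |functional (dualAct (σ := 1) (G := G) t (prodFun h)) (centred G e)|
          ≤ C * ∏ x, (r⁻¹) ^ e x := by
  set s : ℝ := (1 + r) / 2 with hs
  obtain ⟨θ, hθ0, hθ⟩ : ∃ θ : ℝ, 0 < θ ∧ 1 ≤ θ * (1 - r) ^ 3 := by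
    have : 0 < 1 - r := by linarith
    exact ⟨((1 - r) ^ 3)⁻¹, by positivity, (inv_mul_cancel₀ (by positivity)).ge⟩
  refine ⟨(∏ x, ((1 - r) ^ G.α x)⁻¹) * ∏ x, partFun 1 (G.α x) s, fun h hh hL hR t ht e => ?_⟩
  have hsc : ∀ u : ℝ, 0 ≤ u → u ∈ scaleSet 1 := fun u hu => by
    rw [scaleSet, if_neg (by decide)]
    exact hu
  set f := dualAct (σ := 1) (G := G) t (prodFun h) with hf
  obtain ⟨ρ, hmom⟩ : ∃ ρ : Measure (Config 1 G), ∀ l : Config 1 G,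
      ∫⁻ η, ENNReal.ofReal (∏ x, dualFun 1 (G.α x) (l.1 x) (η.1 x)) ∂ρ
        = ENNReal.ofReal (θ ^ l.total * f (l, 0, 0)) := by
    have hm := hasMoments_localEquilibrium (G := G) (hsc θ hθ0.le) (hsc 0 le_rfl) (h := h)
      (fun s => hsc _ (by
        have := (hh s).1
        rw [sub_zero, zero_add]
        positivity)) hL hR ht
    refine ⟨_, fun l => (hm.bulk l).trans ?_⟩
    rw [affineFun_zero, sub_zero, size_bulk]
  have hf01 := fun ξ => dualAct_mem (σ := 1) (G := G) hh ht ξ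
  have hM0 : ∀ l : Config 1 G, 0 ≤ θ ^ l.total * f (l, 0, 0) := fun l =>
    mul_nonneg (by positivity) (hf01 _).1
  have hMT : ∀ l : Config 1 G, θ ^ l.total * f (l, 0, 0) ≤ θ ^ l.total := fun l =>
    mul_le_of_le_one_right (by positivity) (hf01 _).2
  have hs0 : 0 ≤ s := by positivity
  have hs1 : s < 1 := by
    rw [hs]
    linarith
  have hyT : ‖((s / θ : ℝ) : ℂ)‖ * θ = s := by
    rw [Complex.norm_real, Real.norm_of_nonneg (by positivity)]
    field_simp
  obtain ⟨hint, hsum⟩ := genFun_moments hθ0.le hmom hM0 hMT (y := fun _ => ((s / θ : ℝ) : ℂ))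
    fun _ _ => by rw [hyT]; exact hs1
  have hcast : (fun η : Config 1 G => ∏ x : Fin (n + 1), (1 + ((s / θ : ℝ) : ℂ)) ^ η.1 x)
      = fun η => ((∏ x : Fin (n + 1), (1 + s / θ) ^ η.1 x : ℝ) : ℂ) := by
    funext η
    push_cast
    rfl
  rw [hcast] at hint
  simp only [hcast] at hsum
  have hint' : Integrable (fun η : Config 1 G => ∏ x : Fin (n + 1), (1 + s / θ) ^ η.1 x) ρ := by
    exact hint.re.congr (Eventually.of_forall fun η => Complex.ofReal_re _)
  have hI : ∫ η : Config 1 G, ∏ x : Fin (n + 1), (1 + s / θ) ^ η.1 x ∂ρ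
      ≤ ∏ x, partFun 1 (G.α x) s := by
    have hw := summable_prod_weight (σ := 1) (G := G) (u := fun _ => s) (fun _ => hs0)
      fun _ _ => hs1
    have h1 := tsum_of_norm_bounded hw (f := fun l : Config 1 G =>
      (∏ x, (weight 1 (G.α x) (l.1 x) : ℂ) * ((s / θ : ℝ) : ℂ) ^ l.1 x)
        * ((θ ^ l.total * f (l, 0, 0) : ℝ) : ℂ)) fun l => by
      rw [norm_mul, norm_prod, Complex.norm_real, Real.norm_of_nonneg (hM0 l)]
      refine (mul_le_mul_of_nonneg_left (hMT l)
        (Finset.prod_nonneg fun x _ => norm_nonneg _)).trans_eq ?_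
      rw [Config.total, ← Finset.prod_pow_eq_pow_sum, ← Finset.prod_mul_distrib]
      refine Finset.prod_congr rfl fun x _ => ?_
      rw [norm_mul, norm_pow, mul_assoc, ← mul_pow, hyT, Complex.norm_real,
        Real.norm_of_nonneg (weight_nonneg _ _ _)]
    rw [hsum.tsum_eq, integral_complex_ofReal, Complex.norm_real] at h1
    exact (Real.le_norm_self _).trans h1
  have hwn : 0 ≤ ∏ x, weight 1 (G.α x) (e x) := Finset.prod_nonneg fun x _ => weight_nonneg _ _ _
  rw [← abs_of_nonneg hwn, ← abs_mul,
    weight_mul_functional_centred hθ0 (fun ξ => (hf01 ξ).1) hmom e]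
  calc |∫ η : Config 1 G, ∏ x, centredDual (G.α x) (hitLeft G (.inl x)) θ (e x) (η.1 x) ∂ρ|
      ≤ ∫ η : Config 1 G, (∏ x, ((1 - r) ^ G.α x)⁻¹) * (∏ x, (r⁻¹) ^ e x)
          * ∏ x : Fin (n + 1), (1 + s / θ) ^ η.1 x ∂ρ := by
        rw [← Real.norm_eq_abs]
        refine norm_integral_le_of_norm_le (hint'.const_mul _) (Eventually.of_forall fun η => ?_)
        rw [Real.norm_eq_abs, Finset.abs_prod, ← Finset.prod_mul_distrib, ← Finset.prod_mul_distrib]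
        refine Finset.prod_le_prod (fun x _ => abs_nonneg _) fun x _ => ?_
        refine (abs_centredDual_le (G.α_pos x) (hitLeft_mem G _).1 (hitLeft_mem G _).2 hr0 hr1 hθ0
          hθ (e x) (η.1 x)).trans_eq ?_
        ring
    _ ≤ (∏ x, ((1 - r) ^ G.α x)⁻¹) * (∏ x, (r⁻¹) ^ e x) * ∏ x, partFun 1 (G.α x) s := by
        rw [integral_const_mul]
        refine mul_le_mul_of_nonneg_left hI (mul_nonneg ?_ ?_)
        · have : 0 < 1 - r := by linarith
          exact Finset.prod_nonneg fun x _ => by positivity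
        · exact Finset.prod_nonneg fun x _ => by positivity
    _ = _ := by ring

theorem tendsto_functional {σ : SignType} {f : ℝ → DualConfig σ G → ℝ} {g : DualConfig σ G → ℝ}
    (h : ∀ ξ, Tendsto (fun t => f t ξ) atTop (𝓝 (g ξ))) (P : Poly n) :
    Tendsto (fun t => functional (f t) P) atTop (𝓝 (functional g P)) := by
  simp only [functional_eq_sum]
  refine tendsto_finsetSum _ fun e _ => Tendsto.const_mul _ ?_
  simp only [valueAt]
  split_ifs
  · exact h _
  · exact tendsto_const_nhds

theorem exists_bound_absorbedLeft (hω : 0 < G.ωL ∨ 0 < G.ωR) {r : ℝ} (hr0 : 0 < r)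
    (hr1 : r < 1) :
    ∃ C : ℝ, ∀ e : Fin (n + 1) → ℕ, (∏ x, weight 1 (G.α x) (e x))
      * |functional (absorbedLeft (σ := 1) (G := G)) (centred G e)| ≤ C * ∏ x, (r⁻¹) ^ e x := by
  obtain ⟨C, hC⟩ := exists_bound_dualAct G hr0 hr1
  refine ⟨C, fun e => ?_⟩
  set h : Site n → ℝ := Sum.elim 0 fun b => if b then 1 else 0 with hh
  have hlim : ∀ ξ : DualConfig 1 G,
      Tendsto (fun t => dualAct t (prodFun h) ξ) atTop (𝓝 (absorbedLeft ξ)) := fun ξ => by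
    refine tendsto_dualAct hω (absorbedLeft_spec 1 G).1 (fun ζ hζ => ?_) ξ
    rw [(absorbedLeft_spec 1 G).2.1 ζ hζ]
    simp [prodFun, hh, DualConfig.occ, hζ, zero_pow_eq]
  refine le_of_tendsto ((tendsto_functional hlim (centred G e)).abs.const_mul _) ?_
  filter_upwards [eventually_ge_atTop 0] with t ht
  refine hC h ?_ rfl rfl t ht e
  rintro (x | _ | _) <;> simp [hh]

end Bound

end BoundaryDriven

namespace BoundaryDriven

open MarkovChain
open scoped Topology

variable {n : ℕ} {G : Geometry n}

section Continuation

theorem hasSum_integral_countable {S E : Type*} [Countable S] [MeasurableSpace S]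
    [MeasurableSingletonClass S] [NormedAddCommGroup E] [NormedSpace ℝ E] [CompleteSpace E]
    {ρ : Measure S} {f : S → E} (hf : Integrable f ρ) :
    HasSum (fun s => ρ.real {s} • f s) (∫ s, f s ∂ρ) := by
  have h := hasSum_integral_measure (μ := fun s => ρ {s} • Measure.dirac s) (f := f)
    (by rwa [Measure.sum_smul_dirac])
  rw [Measure.sum_smul_dirac] at h
  refine h.congr_fun fun s => ?_
  rw [integral_smul_measure, integral_dirac]
  rfl

theorem exists_uniform_lt_one {ι : Type*} [Finite ι] {f : ι → ℝ} (hf : ∀ i, f i < 1) :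
    ∃ r, 0 < r ∧ r < 1 ∧ ∀ i, f i < r := by
  have h1 : ∀ᶠ r in 𝓝[<] (1 : ℝ), ∀ i, f i < r := by
    rw [eventually_all]
    exact fun i => mem_nhdsWithin_of_mem_nhds (lt_mem_nhds (hf i))
  have h2 : ∀ᶠ r in 𝓝[<] (1 : ℝ), 0 < r := mem_nhdsWithin_of_mem_nhds (lt_mem_nhds one_pos)
  obtain ⟨r, hr1, hr2, hr3⟩ := (h1.and (h2.and self_mem_nhdsWithin)).exists
  exact ⟨r, hr2, hr3, hr1⟩

theorem convexCombination_pos {A B s : ℝ} (hA : 0 < A) (hB : 0 < B) (h0 : 0 ≤ s) (h1 : s ≤ 1) :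
    0 < (1 - s) * A + s * B := by
  rcases h0.eq_or_lt with rfl | h
  · simpa using hA
  · exact add_pos_of_nonneg_of_pos (mul_nonneg (by linarith) hA.le) (mul_pos h hB)

theorem exists_pos_lt {z T : ℝ} (hT : 0 ≤ T) (hz : z * T < 1) :
    ∃ y, 0 < y ∧ z < y ∧ y * T < 1 := by
  have h : max z 0 * T < 1 := by
    rcases max_cases z 0 with ⟨h, -⟩ | ⟨h, -⟩ <;> rw [h] <;> linarith
  have h0 : 0 ≤ max z 0 := le_max_right _ _
  refine ⟨max z 0 + (1 - max z 0 * T) / (T + 1), ?_, ?_, ?_⟩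
  · have : 0 < (1 - max z 0 * T) / (T + 1) := div_pos (by linarith) (by linarith)
    linarith
  · have : 0 < (1 - max z 0 * T) / (T + 1) := div_pos (by linarith) (by linarith)
    linarith [le_max_left z 0]
  · have h3 : (1 - max z 0 * T) / (T + 1) * T < 1 - max z 0 * T := by
      rw [div_mul_eq_mul_div, div_lt_iff₀ (by linarith)]
      nlinarith
    linarith

/-- The analytic continuation of the identity for the generating function, for `σ = 1`. -/
theorem genFun_hasSum_one {ρ : Measure (Config 1 G)} {f : DualConfig 1 G → ℝ} {T c a : ℝ}
    (hT : 0 ≤ T)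
    (hmom : ∀ l : Config 1 G, ∫⁻ η, ENNReal.ofReal (∏ x, dualFun 1 (G.α x) (l.1 x) (η.1 x)) ∂ρ
      = ENNReal.ofReal (affineFun c a f (l, 0, 0)))
    (hM0 : ∀ l : Config 1 G, 0 ≤ affineFun c a f (l, 0, 0))
    (hMT : ∀ l : Config 1 G, affineFun c a f (l, 0, 0) ≤ T ^ l.total)
    (hψ : ∀ l : Config 1 G, |functional f (centred G l.1)| ≤ ∏ x, (2 : ℝ) ^ l.1 x)
    (hbound : ∀ r : ℝ, 0 < r → r < 1 → ∃ C : ℝ, ∀ e : Fin (n + 1) → ℕ,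
      (∏ x, weight 1 (G.α x) (e x)) * |functional f (centred G e)| ≤ C * ∏ x, (r⁻¹) ^ e x)
    {θ : Fin (n + 1) → ℝ} (hθ : ∀ x, θ x = a + c * hitLeft G (.inl x)) (hθ0 : ∀ x, 0 ≤ θ x)
    {z : Fin (n + 1) → ℝ} (hz0 : ∀ x, 0 ≤ 1 + z x) (hzT : ∀ x, z x * T < 1)
    (hzθ : ∀ x, z x * θ x < 1) (hzc : ∀ x, 0 ≤ z x * c) (hzθc : ∀ x, z x * (θ x + c) < 1) :
    Integrable (fun η : Config 1 G => ∏ x, (1 + (z x : ℂ)) ^ η.1 x) ρ ∧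
      HasSum (fun e : Config 1 G => (∏ x, (weight 1 (G.α x) (e.1 x) : ℂ) * (c * z x) ^ e.1 x
        * partFun 1 (shiftParam 1 (G.α x) (e.1 x)) ((z x : ℂ) * θ x))
        * (functional f (centred G e.1) : ℂ))
      (∫ η, ∏ x, (1 + (z x : ℂ)) ^ η.1 x ∂ρ) := by
  choose y hy0 hyz hyT using fun x => exists_pos_lt hT (hzT x)
  obtain ⟨δ', hδ0', hδ1', hδ'⟩ := exists_uniform_lt_one hzθ
  obtain ⟨r₀, hr0, hr1, hr⟩ := exists_uniform_lt_one (f := fun x => z x * c / (1 - z x * θ x))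
    fun x => by
      rw [div_lt_one (by linarith [hzθ x])]
      linarith [hzθc x, mul_add (z x) (θ x) c]
  obtain ⟨δ, hδ⟩ : ∃ δ, δ = 1 - δ' := ⟨_, rfl⟩
  have hδ0 : 0 < δ := by linarith
  have hr' : ∀ x, z x * c < r₀ * (1 - z x * θ x) := fun x =>
    (div_lt_iff₀ (by linarith [hzθ x])).1 (hr x)
  -- the domain of the continuation
  set U : Set ℂ := {s | ∀ x, ‖1 + s * z x‖ < 1 + y x ∧ δ < ‖1 - s * z x * θ x‖ ∧
    ‖c * (s * z x)‖ < r₀ * ‖1 - s * z x * θ x‖} with hU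
  have hUo : IsOpen U := by
    have h1 : ∀ x, IsOpen {s : ℂ | ‖1 + s * z x‖ < 1 + y x} := fun x =>
      isOpen_lt (by fun_prop) (by fun_prop)
    have h2 : ∀ x, IsOpen {s : ℂ | δ < ‖1 - s * z x * θ x‖} := fun x =>
      isOpen_lt (by fun_prop) (by fun_prop)
    have h3 : ∀ x, IsOpen {s : ℂ | ‖c * (s * z x)‖ < r₀ * ‖1 - s * z x * θ x‖} := fun x =>
      isOpen_lt (by fun_prop) (by fun_prop)
    have h4 : U = ⋂ x, {s : ℂ | ‖1 + s * z x‖ < 1 + y x} ∩ ({s : ℂ | δ < ‖1 - s * z x * θ x‖} ∩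
        {s : ℂ | ‖c * (s * z x)‖ < r₀ * ‖1 - s * z x * θ x‖}) := by
      ext s
      simp only [hU, Set.mem_iInter]
      rfl
    rw [h4]
    exact isOpen_iInter_of_finite fun x => (h1 x).inter ((h2 x).inter (h3 x))
  set K : Set ℂ := segment ℝ (0 : ℂ) 1 with hK
  have hKU : K ⊆ U := by
    rw [hK, segment_eq_image]
    rintro _ ⟨s, ⟨hs0, hs1⟩, rfl⟩ x
    simp only [smul_zero, zero_add, Complex.real_smul, mul_one]
    have e1 : (1 : ℂ) + s * z x = ((1 + s * z x : ℝ) : ℂ) := by push_cast; rfl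
    have e2 : (1 : ℂ) - s * z x * θ x = ((1 - s * z x * θ x : ℝ) : ℂ) := by push_cast; rfl
    have e3 : (c : ℂ) * (s * z x) = ((s * (z x * c) : ℝ) : ℂ) := by push_cast; ring
    have h1 : 0 ≤ 1 + s * z x := by nlinarith [hz0 x]
    have h2 : δ < 1 - s * z x * θ x := by
      have := convexCombination_pos hδ0' (sub_pos.2 (hδ' x)) hs0 hs1
      linarith
    rw [e1, e2, e3, Complex.norm_real, Complex.norm_real, Complex.norm_real,
      Real.norm_of_nonneg h1, Real.norm_of_nonneg (hδ0.trans h2).le,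
      Real.norm_of_nonneg (mul_nonneg hs0 (hzc x))]
    refine ⟨?_, h2, ?_⟩
    · rcases le_or_gt (z x) 0 with h | h
      · linarith [mul_nonpos_of_nonneg_of_nonpos hs0 h, hy0 x]
      · linarith [mul_le_of_le_one_left h.le hs1, hyz x]
    · have := convexCombination_pos hr0 (sub_pos.2 (hr' x)) hs0 hs1
      linarith
  have hKc : IsCompact K := by
    rw [hK, segment_eq_image]
    exact isCompact_Icc.image (by fun_prop)
  obtain ⟨ε, hε, hεU⟩ := hKc.exists_thickening_subset_open hUo hKU
  set V := Metric.thickening ε K with hV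
  have hKV : K ⊆ V := Metric.self_subset_thickening hε K
  have hVo : IsOpen V := Metric.isOpen_thickening
  have hVp : IsPreconnected V := ((convex_segment (𝕜 := ℝ) (0 : ℂ) 1).thickening ε).isPreconnected
  -- integrability
  have hmoments := fun (w : Fin (n + 1) → ℂ) (hw : ∀ x, ‖w x‖ * T < 1) =>
    genFun_moments hT hmom hM0 hMT (y := w) fun _ => hw
  have hyint : Integrable (fun η : Config 1 G => ∏ x, (1 + y x) ^ η.1 x) ρ := by
    have h := (hmoments (fun x => (y x : ℂ)) fun x => by
      rw [Complex.norm_real, Real.norm_of_nonneg (hy0 x).le]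
      exact hyT x).1
    refine h.re.congr (Eventually.of_forall fun η => ?_)
    have : ∏ x, (1 + (y x : ℂ)) ^ η.1 x = ((∏ x, (1 + y x) ^ η.1 x : ℝ) : ℂ) := by
      push_cast
      rfl
    simp only [this]
    exact Complex.ofReal_re _
  have hnorm : ∀ s ∈ U, ∀ η : Config 1 G,
      ‖∏ x, (1 + s * z x) ^ η.1 x‖ ≤ ∏ x, (1 + y x) ^ η.1 x := fun s hs η => by
    rw [norm_prod]
    refine Finset.prod_le_prod (fun x _ => norm_nonneg _) fun x _ => ?_
    rw [norm_pow]
    exact pow_le_pow_left₀ (norm_nonneg _) (hs x).1.le _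
  have hsint : ∀ s ∈ U, Integrable (fun η : Config 1 G => ∏ x, (1 + s * z x) ^ η.1 x) ρ :=
    fun s hs => hyint.mono' (measurable_of_countable _).aestronglyMeasurable
      (Eventually.of_forall (hnorm s hs))
  -- the two sides are analytic
  obtain ⟨L, hL⟩ : ∃ L : ℂ → ℂ, ∀ s, L s
      = ∑' η : Config 1 G, ρ.real {η} • ∏ x, (1 + s * z x) ^ η.1 x := ⟨_, fun _ => rfl⟩
  have hLint : ∀ s ∈ U, L s = ∫ η, ∏ x, (1 + s * z x) ^ η.1 x ∂ρ := fun s hs => by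
    rw [hL, (hasSum_integral_countable (hsint s hs)).tsum_eq]
  have hLd : DifferentiableOn ℂ L V := by
    have h := Complex.differentiableOn_tsum_of_summable_norm
      (F := fun (η : Config 1 G) s => ρ.real {η} • ∏ x, (1 + s * z x) ^ η.1 x)
      (hasSum_integral_countable hyint).summable (fun η => by fun_prop) hVo
      fun η s hs => by
        rw [norm_smul, Real.norm_of_nonneg measureReal_nonneg, smul_eq_mul]
        exact mul_le_mul_of_nonneg_left (hnorm s (hεU hs) η) measureReal_nonneg
    exact h.congr fun s _ => hL s
  obtain ⟨F, hF⟩ : ∃ F : Config 1 G → ℂ → ℂ, ∀ e s, F e s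
      = (∏ x, (weight 1 (G.α x) (e.1 x) : ℂ) * (c * (s * z x)) ^ e.1 x
        * partFun 1 (shiftParam 1 (G.α x) (e.1 x)) (s * z x * θ x))
        * (functional f (centred G e.1) : ℂ) := ⟨_, fun _ _ => rfl⟩
  have hpart : ∀ (m : ℕ) (u : ℂ), partFun 1 m u = ((1 - u) ^ m)⁻¹ := fun m u => by
    rw [partFun, if_neg (by decide), if_neg (by decide)]
  have hne : ∀ s ∈ U, ∀ x, (1 : ℂ) - s * z x * θ x ≠ 0 := fun s hs x h => by
    have := (hs x).2.1
    rw [h, norm_zero] at this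
    linarith
  obtain ⟨r, hr⟩ : ∃ r, r = (1 + r₀) / 2 := ⟨_, rfl⟩
  obtain ⟨C, hC⟩ := hbound r (by linarith) (by linarith)
  have hFb : ∀ e : Config 1 G, ∀ s ∈ V, ‖F e s‖
      ≤ (∏ x, (δ ^ G.α x)⁻¹) * C * ∏ x, (r₀ * r⁻¹) ^ e.1 x := by
    intro e s hs
    have hsU := hεU hs
    have h1 : ∀ x, ‖(weight 1 (G.α x) (e.1 x) : ℂ) * (c * (s * z x)) ^ e.1 x
        * partFun 1 (shiftParam 1 (G.α x) (e.1 x)) (s * z x * θ x)‖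
        ≤ weight 1 (G.α x) (e.1 x) * (r₀ ^ e.1 x * (δ ^ G.α x)⁻¹) := by
      intro x
      obtain ⟨-, h2, h3⟩ := hsU x
      have hpos : 0 < ‖1 - s * z x * θ x‖ := hδ0.trans h2
      rw [hpart, shiftParam_one, norm_mul, norm_mul, Complex.norm_real,
        Real.norm_of_nonneg (weight_nonneg _ _ _), mul_assoc, norm_pow, norm_inv, norm_pow,
        pow_add, mul_inv, mul_comm (‖_‖ ^ G.α x)⁻¹,
        ← mul_assoc (‖_‖ ^ e.1 x), ← inv_pow (‖_‖) (e.1 x), ← mul_pow]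
      refine mul_le_mul_of_nonneg_left (mul_le_mul ?_ ?_ (by positivity) (by positivity))
        (weight_nonneg _ _ _)
      · refine pow_le_pow_left₀ (by positivity) ?_ _
        rw [← div_eq_mul_inv, div_le_iff₀ hpos]
        exact h3.le
      · gcongr
    rw [hF, norm_mul, norm_prod, Complex.norm_real, Real.norm_eq_abs]
    refine (mul_le_mul_of_nonneg_right (Finset.prod_le_prod (fun x _ => norm_nonneg _)
      fun x _ => h1 x) (abs_nonneg _)).trans ?_
    rw [Finset.prod_mul_distrib, Finset.prod_mul_distrib]
    have h4 : 0 ≤ (∏ x, r₀ ^ e.1 x) * ∏ x, (δ ^ G.α x)⁻¹ := by positivity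
    calc (∏ x, weight 1 (G.α x) (e.1 x)) * ((∏ x, r₀ ^ e.1 x) * ∏ x, (δ ^ G.α x)⁻¹)
          * |functional f (centred G e.1)|
        = ((∏ x, r₀ ^ e.1 x) * ∏ x, (δ ^ G.α x)⁻¹) * ((∏ x, weight 1 (G.α x) (e.1 x))
          * |functional f (centred G e.1)|) := by ring
      _ ≤ ((∏ x, r₀ ^ e.1 x) * ∏ x, (δ ^ G.α x)⁻¹) * (C * ∏ x, (r⁻¹) ^ e.1 x) :=
        mul_le_mul_of_nonneg_left (hC e.1) h4
      _ = _ := by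
        simp only [mul_pow, Finset.prod_mul_distrib]
        ring
  have hbs : Summable fun e : Config 1 G =>
      (∏ x, (δ ^ G.α x)⁻¹) * C * ∏ x, (r₀ * r⁻¹) ^ e.1 x := by
    refine Summable.mul_left _ ?_
    have hrr : |r₀ * r⁻¹| < 1 := by
      rw [abs_of_nonneg (by rw [hr]; positivity), ← div_eq_mul_inv, div_lt_one (by linarith)]
      linarith
    have h := hasSum_prod (fun _ : Fin (n + 1) => hasSum_geometric_of_abs_lt_one hrr)
      fun _ => (hasSum_geometric_of_abs_lt_one hrr).summable.norm
    exact (hasSum_config (σ := 1) (G := G) h fun e he =>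
      absurd (fun h => absurd h (by decide)) he).summable
  have hRd : DifferentiableOn ℂ (fun s : ℂ => ∑' e, F e s) V := by
    refine Complex.differentiableOn_tsum_of_summable_norm hbs (fun e => ?_) hVo hFb
    have h1 : F e = fun s : ℂ => (∏ x, (weight 1 (G.α x) (e.1 x) : ℂ) * (c * (s * z x)) ^ e.1 x
        * ((1 - s * z x * θ x) ^ (shiftParam 1 (G.α x) (e.1 x)))⁻¹)
        * (functional f (centred G e.1) : ℂ) := by
      funext s
      simp only [hF, hpart]
    rw [h1]
    refine DifferentiableOn.mul_const (DifferentiableOn.fun_finsetProd fun x _ => ?_) _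
    refine DifferentiableOn.mul (by fun_prop) (DifferentiableOn.inv (by fun_prop) fun s hs => ?_)
    exact pow_ne_zero _ (hne s (hεU hs) x)
  have h0V : (0 : ℂ) ∈ V := hKV (left_mem_segment ℝ 0 1)
  have h1V : (1 : ℂ) ∈ V := hKV (right_mem_segment ℝ 0 1)
  have hnear : L =ᶠ[𝓝 (0 : ℂ)] fun s => ∑' e, F e s := by
    have hsmall : ∀ B : ℝ, ∀ x, ∀ᶠ s : ℂ in 𝓝 0, ‖s * z x‖ * B < 1 := by
      intro B x
      have hc : Continuous fun s : ℂ => ‖s * z x‖ * B := by fun_prop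
      refine hc.continuousAt.eventually_lt continuousAt_const ?_
      simp
    have h1 := eventually_all.2 (hsmall T)
    have h2 := eventually_all.2 fun x => hsmall (θ x + 2 * |c|) x
    filter_upwards [h1, h2, hUo.mem_nhds (hεU h0V)] with s hs1 hs2 hs3
    have h := genFun_hasSum hT hmom hM0 hMT hψ hθ hθ0 (y := fun x => s * z x) (fun _ => hs1)
      fun _ => hs2
    rw [hLint s hs3, ← h.tsum_eq]
    exact tsum_congr fun e => (hF e s).symm
  have hEq := (hLd.analyticOnNhd hVo).eqOn_of_preconnected_of_eventuallyEq
    (hRd.analyticOnNhd hVo) hVp h0V hnear h1V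
  have hsum1 : HasSum (fun e => F e 1) (L 1) := by
    rw [hEq]
    exact (Summable.of_norm_bounded hbs fun e => hFb e 1 h1V).hasSum
  rw [hLint 1 (hεU h1V)] at hsum1
  have hint1 := hsint 1 (hεU h1V)
  simp only [hF, one_mul] at hsum1 hint1
  exact ⟨hint1, hsum1⟩

end Continuation

section Termwise

variable {σ : SignType}

theorem partFun_ofReal (σ : SignType) (a : ℕ) (u : ℝ) :
    ((partFun σ a u : ℝ) : ℂ) = partFun σ a (u : ℂ) := by
  simp only [partFun]
  split_ifs
  · push_cast
    rfl
  · simp [← Real.exp_eq_exp_ℝ, ← Complex.exp_eq_exp_ℂ]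
  · push_cast
    rfl

theorem factorJ_ne_zero {θL θR θ l : ℝ} (a : ℕ) (h1 : 1 + (σ : ℝ) * l * (1 + θ) ≠ 0)
    (h2 : 1 + (σ : ℝ) * l * (1 - (θL - θR)) ≠ 0) : factorJ σ θL θR a θ l ≠ 0 := by
  rw [factorJ]
  split_ifs
  · exact Real.exp_ne_zero _
  · exact zpow_ne_zero _ (div_ne_zero h1 h2)

theorem factorJ_mul_marginal {θL θR θ l : ℝ} {a k : ℕ} (hk : σ = -1 → k ≤ a)
    (h1 : 1 + (σ : ℝ) * l * (1 + θ) ≠ 0) (h2 : 1 + (σ : ℝ) * l * (1 - (θL - θR)) ≠ 0)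
    (h3 : σ = 1 → 1 + l ≠ 0) :
    factorJ σ θL θR a θ l * marginal σ a (kappa σ θL θR l) k
      = weight σ a k * ((θL - θR) * (bigLambda σ θ l - 1)) ^ k
        * partFun σ (shiftParam σ a k) ((bigLambda σ θ l - 1) * θ) := by
  generalize hc : θL - θR = c at *
  rw [factorJ, kappa, bigLambda, hc, add_sub_cancel_left]
  rcases sign_cases σ with rfl | rfl | rfl
  · simp only [SignType.coe_neg, SignType.coe_one, neg_mul, one_mul, marginal, partFun, if_true,
      weight_neg_one, shiftParam_neg_one] at h1 h2 ⊢
    rw [if_neg (by decide)]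
    generalize hD : 1 + -(l * (1 + θ)) = D at *
    generalize hE : 1 + -(l * (1 - c)) = E at *
    have e1 : 1 - l * c / E = (1 - l) / E := by
      field_simp
      linarith
    have e2 : 1 + l / D * θ = (1 - l) / D := by
      field_simp
      linarith
    rw [e1, e2]
    have e3 : (D / E) ^ (-(a : ℤ)) = E ^ a / D ^ a := by
      rw [zpow_neg, zpow_natCast, div_pow, inv_div]
    obtain ⟨j, rfl⟩ := Nat.exists_eq_add_of_le (hk rfl)
    rw [e3, Nat.add_sub_cancel_left, div_pow, div_pow, div_pow, mul_pow, mul_pow, div_pow,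
      pow_add, pow_add]
    field_simp
  · simp only [SignType.coe_zero, zero_mul, add_zero, div_one, marginal, partFun, if_true,
      weight_zero, shiftParam_zero]
    rw [if_neg (by decide), if_neg (by decide), ← Real.exp_eq_exp_ℝ]
    have e1 : Real.exp (a * (l * θ)) = Real.exp (a * l * (θ + c)) * Real.exp (-(a * (l * c))) := by
      rw [← Real.exp_add]
      congr 1
      ring
    rw [e1]
    ring
  · simp only [SignType.coe_one, one_mul, marginal, partFun, weight_one, shiftParam_one] at h1 h2 ⊢
    rw [if_neg (by decide), if_neg (by decide), if_neg (by decide), if_neg (by decide),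
      if_neg (by decide)]
    have h4 := h3 rfl
    generalize hD : 1 + l * (1 + θ) = D at *
    generalize hE : 1 + l * (1 - c) = E at *
    have e1 : 1 + l * c / E = (1 + l) / E := by
      field_simp
      linarith
    have e2 : 1 - l / D * θ = (1 + l) / D := by
      field_simp
      linarith
    rw [e1, e2]
    have e3 : (D / E) ^ (a : ℤ) = D ^ a / E ^ a := by
      rw [zpow_natCast, div_pow]
    have e4 : l * c / E / ((1 + l) / E) = l * c / (1 + l) := by
      field_simp
    rw [e3, e4]
    simp only [div_pow, mul_pow, one_div, inv_pow, pow_add]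
    field_simp

end Termwise

section Conclusion

variable {σ : SignType}

theorem integrable_productMeasure {κ : Fin (n + 1) → ℝ} (hκ : ∀ x, κ x ∈ scaleSet σ)
    {g : Config σ G → ℝ} {S : ℝ}
    (h : HasSum (fun e : Config σ G => (∏ x, marginal σ (G.α x) (κ x) (e.1 x)) * g e) S) :
    Integrable g (productMeasure σ G κ) ∧ ∫ e, g e ∂(productMeasure σ G κ) = S := by
  have hm0 : ∀ e : Config σ G, 0 ≤ ∏ x, marginal σ (G.α x) (κ x) (e.1 x) := fun e =>
    Finset.prod_nonneg fun x _ => marginal_nonneg (hκ x) _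
  have hint : Integrable g (productMeasure σ G κ) := by
    refine ⟨(measurable_of_countable _).aestronglyMeasurable, ?_⟩
    rw [HasFiniteIntegral, productMeasure, lintegral_sum_measure]
    simp_rw [lintegral_smul_measure, lintegral_dirac, smul_eq_mul]
    have h1 : ∀ e : Config σ G, ENNReal.ofReal (∏ x, marginal σ (G.α x) (κ x) (e.1 x)) * ‖g e‖ₑ
        = ENNReal.ofReal ‖(∏ x, marginal σ (G.α x) (κ x) (e.1 x)) * g e‖ := fun e => by
      rw [norm_mul, Real.norm_of_nonneg (hm0 e), ENNReal.ofReal_mul (hm0 e), ofReal_norm]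
    simp_rw [h1]
    rw [← ENNReal.ofReal_tsum_of_nonneg (fun e => norm_nonneg _) h.summable.norm]
    exact ENNReal.ofReal_lt_top
  refine ⟨hint, (hasSum_integral_measure hint).unique (h.congr_fun fun e => ?_)⟩
  rw [integral_smul_measure, integral_dirac, ENNReal.toReal_ofReal (hm0 e), smul_eq_mul]

/-- The identity between the generating functions, for a measure with given factorial moments. -/
theorem generating_identity {θL θR : ℝ} (hL : θL ∈ scaleSet σ) (hR : θR ∈ scaleSet σ)
    {ρ : Measure (Config σ G)} {f : DualConfig σ G → ℝ}
    (hmom : HasMoments ρ θL θR (affineFun (θL - θR) θR f))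
    (hM0 : ∀ l : Config σ G, 0 ≤ affineFun (θL - θR) θR f (l, 0, 0))
    (hMT : ∀ l : Config σ G, affineFun (θL - θR) θR f (l, 0, 0) ≤ max θL θR ^ l.total)
    (hψ : ∀ l : Config σ G, |functional f (centred G l.1)| ≤ ∏ x, (2 : ℝ) ^ l.1 x)
    (hbound : σ = 1 → ∀ r : ℝ, 0 < r → r < 1 → ∃ C : ℝ, ∀ e : Fin (n + 1) → ℕ,
      (∏ x, weight 1 (G.α x) (e x)) * |functional f (centred G e)| ≤ C * ∏ x, (r⁻¹) ^ e x)
    {θ lam : Fin (n + 1) → ℝ} (hθ : ∀ x, θ x = θR + (θL - θR) * hitLeft G (.inl x))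
    (hD : ∀ x, 1 + (σ : ℝ) * lam x * (1 + θ x) ≠ 0)
    (hE : ∀ x, 1 + (σ : ℝ) * lam x * (1 - (θL - θR)) ≠ 0)
    (hLam : ∀ x, 0 ≤ bigLambda σ (θ x) (lam x))
    (hκ : ∀ x, kappa σ θL θR (lam x) ∈ scaleSet σ)
    (hconv : σ = 1 → ∀ x, 0 < (1 + lam x) * (1 + lam x * (1 + θ x))) :
    Integrable (fun η : Config σ G => ∏ x, bigLambda σ (θ x) (lam x) ^ η.1 x) ρ ∧
      Integrable (fun e : Config σ G => functional f (centred G e.1))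
        (productMeasure σ G fun x => kappa σ θL θR (lam x)) ∧
      ∫ η, ∏ x, bigLambda σ (θ x) (lam x) ^ η.1 x ∂ρ
        = (∏ x, factorJ σ θL θR (G.α x) (θ x) (lam x))
          * ∫ e, functional f (centred G e.1)
            ∂(productMeasure σ G fun x => kappa σ θL θR (lam x)) := by
  have hL0 := scaleSet_nonneg hL
  have hR0 := scaleSet_nonneg hR
  have hT : 0 ≤ max θL θR := hL0.trans (le_max_left _ _)
  have hθ0 : ∀ x, 0 ≤ θ x := fun x => by
    obtain ⟨h0, h1⟩ := hitLeft_mem G (.inl x)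
    rw [hθ]
    nlinarith
  obtain ⟨z, hz⟩ : ∃ z : Fin (n + 1) → ℝ, ∀ x, z x = bigLambda σ (θ x) (lam x) - 1 :=
    ⟨_, fun _ => rfl⟩
  obtain ⟨hint, hsum⟩ : Integrable (fun η : Config σ G => ∏ x, (1 + (z x : ℂ)) ^ η.1 x) ρ ∧
      HasSum (fun e : Config σ G => (∏ x, (weight σ (G.α x) (e.1 x) : ℂ)
        * (((θL - θR : ℝ) : ℂ) * z x) ^ e.1 x
        * partFun σ (shiftParam σ (G.α x) (e.1 x)) ((z x : ℂ) * θ x))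
        * (functional f (centred G e.1) : ℂ))
      (∫ η, ∏ x, (1 + (z x : ℂ)) ^ η.1 x ∂ρ) := by
    by_cases hσ : σ = 1
    · subst hσ
      simp only [SignType.coe_one, one_mul] at hD hE
      have hpos : ∀ x, 0 < 1 - z x * θ x ∧ 0 ≤ z x * (θL - θR) ∧
          0 < 1 - z x * (θ x + (θL - θR)) := by
        intro x
        have h1 := hconv rfl x
        have h2 : 0 ≤ kappa 1 θL θR (lam x) := scaleSet_nonneg (hκ x)
        have hDx := hD x
        have hEx := hE x
        have hzx : z x = lam x / (1 + lam x * (1 + θ x)) := by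
          rw [hz, bigLambda]
          simp
        simp only [kappa, SignType.coe_one, one_mul] at h2
        rw [hzx]
        generalize hDe : 1 + lam x * (1 + θ x) = D at *
        generalize hEe : 1 + lam x * (1 - (θL - θR)) = E at *
        have hDD : 0 < D ^ 2 := by positivity
        have e1 : 1 - lam x / D * θ x = (1 + lam x) / D := by
          field_simp
          linarith
        have e2 : 1 - lam x / D * (θ x + (θL - θR)) = E / D := by
          field_simp
          linarith
        have p1 : 0 < (1 + lam x) / D := by
          have : (1 + lam x) / D = (1 + lam x) * D / D ^ 2 := by
            field_simp
          rw [this]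
          positivity
        have p2 : 0 < (1 + lam x) / E := by
          have : (1 + lam x) / E = 1 + lam x * (θL - θR) / E := by
            field_simp
            linarith
          rw [this]
          linarith
        have p3 : 0 < E / D := by
          have h4 : 1 + lam x ≠ 0 := fun h => by simp [h] at h1
          have : E / D = (1 + lam x) / D / ((1 + lam x) / E) := by
            field_simp
          rw [this]
          positivity
        refine ⟨by rw [e1]; exact p1, ?_, by rw [e2]; exact p3⟩
        have : lam x / D * (θL - θR) = lam x * (θL - θR) / E * (E / D) := by
          field_simp
        rw [this]
        positivity
      refine genFun_hasSum_one hT hmom.bulk hM0 hMT hψ (hbound rfl) hθ hθ0 (fun x => ?_)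
        (fun x => ?_) (fun x => by linarith [(hpos x).1]) (fun x => (hpos x).2.1)
        fun x => by linarith [(hpos x).2.2]
      · rw [hz]
        linarith [hLam x]
      · obtain ⟨-, h1, h2⟩ := hpos x
        rcases le_or_gt (z x) 0 with h | h
        · exact lt_of_le_of_lt (mul_nonpos_of_nonpos_of_nonneg h hT) one_pos
        · have h3 : 0 ≤ θL - θR := nonneg_of_mul_nonneg_right h1 h
          have h4 : max θL θR = θL := max_eq_left (by linarith)
          have h5 : θL ≤ θ x + (θL - θR) := by
            rw [hθ]
            nlinarith [(hitLeft_mem G (.inl x)).1]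
          rw [h4]
          nlinarith
    · have h1 : ∀ P : Prop, σ = 1 → P := fun P h => absurd h hσ
      exact ⟨(genFun_moments hT hmom.bulk hM0 hMT (h1 _)).1,
        genFun_hasSum hT hmom.bulk hM0 hMT hψ hθ hθ0 (h1 _) (h1 _)⟩
  have hcast : ∀ η : Config σ G, ∏ x, (1 + (z x : ℂ)) ^ η.1 x
      = ((∏ x, bigLambda σ (θ x) (lam x) ^ η.1 x : ℝ) : ℂ) := fun η => by
    push_cast
    refine Finset.prod_congr rfl fun x _ => ?_
    rw [hz]
    push_cast
    ring
  simp only [hcast] at hint hsum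
  rw [integral_complex_ofReal] at hsum
  have hJ : ∏ x, factorJ σ θL θR (G.α x) (θ x) (lam x) ≠ 0 :=
    Finset.prod_ne_zero_iff.2 fun x _ => factorJ_ne_zero _ (hD x) (hE x)
  have hterm : ∀ e : Config σ G, (∏ x, (weight σ (G.α x) (e.1 x) : ℂ)
        * (((θL - θR : ℝ) : ℂ) * z x) ^ e.1 x
        * partFun σ (shiftParam σ (G.α x) (e.1 x)) ((z x : ℂ) * θ x))
        * (functional f (centred G e.1) : ℂ)
      = (((∏ x, factorJ σ θL θR (G.α x) (θ x) (lam x))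
        * ((∏ x, marginal σ (G.α x) (kappa σ θL θR (lam x)) (e.1 x))
          * functional f (centred G e.1)) : ℝ) : ℂ) := by
    intro e
    rw [← mul_assoc, ← Finset.prod_mul_distrib, Complex.ofReal_mul, Complex.ofReal_prod]
    congr 1
    refine Finset.prod_congr rfl fun x _ => ?_
    rw [factorJ_mul_marginal (fun h => e.2 h x) (hD x) (hE x)
      (fun h hl => by simpa [hl] using hconv h x), ← hz, Complex.ofReal_mul, partFun_ofReal]
    push_cast
    rfl
  have hsumR := Complex.hasSum_ofReal.1 (hsum.congr_fun fun e => (hterm e).symm)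
  have hfin := hsumR.mul_left (∏ x, factorJ σ θL θR (G.α x) (θ x) (lam x))⁻¹
  simp only [inv_mul_cancel_left₀ hJ] at hfin
  obtain ⟨h1, h2⟩ := integrable_productMeasure hκ hfin
  refine ⟨hint.re.congr (Eventually.of_forall fun η => Complex.ofReal_re _), h1, ?_⟩
  rw [h2, mul_inv_cancel_left₀ hJ]

theorem integrable_dualProductMeasure {κ : Fin (n + 1) → ℝ} {g : DualConfig σ G → ℝ}
    {g' : Config σ G → ℝ} (hg : ∀ η : Config σ G, g (η, 0, 0) = g' η)
    (h : Integrable g' (productMeasure σ G κ)) :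
    Integrable g (dualProductMeasure σ G κ) ∧
      ∫ ξ, g ξ ∂(dualProductMeasure σ G κ) = ∫ η, g' η ∂(productMeasure σ G κ) := by
  have hm : Measurable fun η : Config σ G => ((η, 0, 0) : DualConfig σ G) :=
    measurable_of_countable _
  have hgm : AEStronglyMeasurable g (dualProductMeasure σ G κ) :=
    (measurable_of_countable _).aestronglyMeasurable
  have hcomp : g ∘ (fun η : Config σ G => ((η, 0, 0) : DualConfig σ G)) = g' := funext hg
  constructor
  · rw [dualProductMeasure, integrable_map_measure hgm hm.aemeasurable, hcomp]
    exact h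
  · rw [dualProductMeasure, integral_map hm.aemeasurable hgm]
    simp only [hg]

end Conclusion

end BoundaryDriven

namespace BoundaryDriven

open MarkovChain

variable {n : ℕ} {G : Geometry n} {σ : SignType}

theorem scaleSet_convexCombination {θL θR p : ℝ} (hL : θL ∈ scaleSet σ) (hR : θR ∈ scaleSet σ)
    (h0 : 0 ≤ p) (h1 : p ≤ 1) : θR + (θL - θR) * p ∈ scaleSet σ := by
  have hc : Convex ℝ (scaleSet σ) := by
    rw [scaleSet]
    split_ifs
    · exact convex_Icc _ _
    · exact convex_Ici _
  have h := hc hR hL (sub_nonneg.2 h1) h0 (by ring)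
  convert h using 1
  simp only [smul_eq_mul]
  ring

theorem affineFun_dualAct_mem {θL θR : ℝ} (hL : 0 ≤ θL) (hR : 0 ≤ θR) {t : ℝ} (ht : 0 ≤ t)
    {h : Site n → ℝ} (hh : ∀ s, 0 ≤ h s ∧ h s ≤ 1) (ξ : DualConfig σ G) :
    0 ≤ affineFun (θL - θR) θR (dualAct t (prodFun h)) ξ ∧
      affineFun (θL - θR) θR (dualAct t (prodFun h)) ξ ≤ max θL θR ^ ξ.size := by
  have hr := hasRates_dual σ G
  have hs := conserves_dual (σ := σ) (G := G)
  have h0 : ∀ s, 0 ≤ θR + (θL - θR) * h s := fun s => by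
    nlinarith [(hh s).1, (hh s).2]
  have h1 : ∀ s, θR + (θL - θR) * h s ≤ max θL θR := fun s => by
    nlinarith [(hh s).1, (hh s).2, le_max_left θL θR, le_max_right θL θR]
  have h2 : affineFun (θL - θR) θR (prodFun h)
      = prodFun (σ := σ) (G := G) fun s => θR + (θL - θR) * h s :=
    funext fun ζ => affineFun_prodFun _ _ _ _
  rw [← dualAct_affineFun, h2]
  refine ⟨hr.expAct_nonneg hs ht (prodFun_nonneg h0) ξ, ?_⟩
  refine (hr.expAct_mono hs ht (g := fun ζ => max θL θR ^ ζ.size) fun ζ _ => ?_).trans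
    (hr.expAct_size hs t (fun k => max θL θR ^ k) ξ).le
  rw [prodFun, ← sum_occ, ← Finset.prod_pow_eq_pow_sum]
  exact Finset.prod_le_prod (fun s _ => pow_nonneg (h0 s) _)
    fun s _ => pow_le_pow_left₀ (h0 s) (h1 s) _

variable {θL θR : ℝ} {θ lam : Fin (n + 1) → ℝ}

theorem stationary_identity (hω : 0 < G.ωL ∨ 0 < G.ωR) (hL : θL ∈ scaleSet σ)
    (hR : θR ∈ scaleSet σ) {μ : Measure (Config σ G)} [IsProbabilityMeasure μ]
    (hμ : IsStationary (generator σ G θL θR) μ) (hθ : θ = profile μ)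
    (hD : ∀ x, 1 + (σ : ℝ) * lam x * (1 + θ x) ≠ 0)
    (hE : ∀ x, 1 + (σ : ℝ) * lam x * (1 - (θL - θR)) ≠ 0)
    (hLam : ∀ x, 0 ≤ bigLambda σ (θ x) (lam x))
    (hκ : ∀ x, kappa σ θL θR (lam x) ∈ scaleSet σ)
    (hconv : σ = 1 → ∀ x, 0 < (1 + lam x) * (1 + lam x * (1 + θ x))) :
    Integrable (fun η : Config σ G => ∏ x, bigLambda σ (θ x) (lam x) ^ η.1 x) μ ∧
      Integrable psi (dualProductMeasure σ G fun x => kappa σ θL θR (lam x)) ∧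
      ∫ η, ∏ x, bigLambda σ (θ x) (lam x) ^ η.1 x ∂μ
        = (∏ x, factorJ σ θL θR (G.α x) (θ x) (lam x))
          * ∫ ξ, psi ξ ∂(dualProductMeasure σ G fun x => kappa σ θL θR (lam x)) := by
  obtain ⟨hmom, h0⟩ := hasMoments_stationary hω hL hR hμ
  have hmem := (absorbedLeft_spec σ G).2.2
  obtain ⟨h1, h2, h3⟩ := generating_identity hL hR hmom (fun l => h0 _)
    (fun l => by
      rw [← size_bulk]
      exact affineFun_absorbedLeft_le hω (scaleSet_nonneg hL) (scaleSet_nonneg hR) _)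
    (abs_functional_centred_le (fun ξ => (hmem ξ).1) fun ξ => (hmem ξ).2)
    (fun h r hr0 hr1 => by
      subst h
      exact exists_bound_absorbedLeft hω hr0 hr1)
    (fun x => by rw [hθ, profile_eq hω hL hR hμ]) hD hE hLam hκ hconv
  obtain ⟨h4, h5⟩ := integrable_dualProductMeasure (psi_eq hω) h2
  exact ⟨h1, h4, by rw [h3, h5]⟩

theorem localEquilibrium_identity (hω : 0 < G.ωL ∨ 0 < G.ωR) (hL : θL ∈ scaleSet σ)
    (hR : θR ∈ scaleSet σ) {t : ℝ} (ht : 0 ≤ t)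
    (hθ : ∀ x, θ x = θR + (θL - θR) * hitLeft G (.inl x))
    (hD : ∀ x, 1 + (σ : ℝ) * lam x * (1 + θ x) ≠ 0)
    (hE : ∀ x, 1 + (σ : ℝ) * lam x * (1 - (θL - θR)) ≠ 0)
    (hLam : ∀ x, 0 ≤ bigLambda σ (θ x) (lam x))
    (hκ : ∀ x, kappa σ θL θR (lam x) ∈ scaleSet σ)
    (hconv : σ = 1 → ∀ x, 0 < (1 + lam x) * (1 + lam x * (1 + θ x))) :
    Integrable (fun η : Config σ G => ∏ x, bigLambda σ (θ x) (lam x) ^ η.1 x)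
        (lawAt (generator σ G θL θR) (productMeasure σ G θ) t) ∧
      Integrable (psiAt t) (dualProductMeasure σ G fun x => kappa σ θL θR (lam x)) ∧
      ∫ η, ∏ x, bigLambda σ (θ x) (lam x) ^ η.1 x
          ∂(lawAt (generator σ G θL θR) (productMeasure σ G θ) t)
        = (∏ x, factorJ σ θL θR (G.α x) (θ x) (lam x))
          * ∫ ξ, psiAt t ξ ∂(dualProductMeasure σ G fun x => kappa σ θL θR (lam x)) := by
  have hmom := hasMoments_localEquilibrium (σ := σ) (G := G) hL hR (h := hitLeft G)
    (fun s => scaleSet_convexCombination hL hR (hitLeft_mem G s).1 (hitLeft_mem G s).2)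
    (by simp [hitLeft_reservoir]) (by simp [hitLeft_reservoir]) ht
  rw [← funext hθ] at hmom
  have hb := affineFun_dualAct_mem (σ := σ) (G := G) (scaleSet_nonneg hL) (scaleSet_nonneg hR) ht
    (hitLeft_mem G)
  have hmem := fun ξ : DualConfig σ G => dualAct_mem (hitLeft_mem G) ht ξ
  obtain ⟨h1, h2, h3⟩ := generating_identity hL hR hmom (fun l => (hb _).1)
    (fun l => by
      rw [← size_bulk]
      exact (hb _).2)
    (abs_functional_centred_le (fun ξ => (hmem ξ).1) fun ξ => (hmem ξ).2)
    (fun h r hr0 hr1 => by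
      subst h
      obtain ⟨C, hC⟩ := exists_bound_dualAct G hr0 hr1
      exact ⟨C, hC _ (hitLeft_mem G) (by simp [hitLeft_reservoir]) (by simp [hitLeft_reservoir])
        t ht⟩) hθ hD hE hLam hκ hconv
  obtain ⟨h4, h5⟩ := integrable_dualProductMeasure (psiAt_eq hω ht) h2
  exact ⟨h1, h4, by rw [h3, h5]⟩

end BoundaryDriven

end

theorem mainTheorem6 (σ : SignType) {n : ℕ} (G : BoundaryDriven.Geometry n)
    (hω : 0 < G.ωL ∨ 0 < G.ωR)
    (θL θR : ℝ) (hθL : θL ∈ BoundaryDriven.scaleSet σ) (hθR : θR ∈ BoundaryDriven.scaleSet σ)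
    (μ : MeasureTheory.Measure (BoundaryDriven.Config σ G)) [MeasureTheory.IsProbabilityMeasure μ]
    (hμ : MarkovChain.IsStationary (BoundaryDriven.generator σ G θL θR) μ)
    (θbar : Fin (n + 1) → ℝ) (hθbar : θbar = BoundaryDriven.profile μ)
    (lam Lam κ : Fin (n + 1) → ℝ)
    (hLam : Lam = fun x => BoundaryDriven.bigLambda σ (θbar x) (lam x))
    (hκ : κ = fun x => BoundaryDriven.kappa σ θL θR (lam x))
    (hden_Lam : ∀ x, 1 + (σ : ℝ) * lam x * (1 + θbar x) ≠ 0)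
    (hden_κ : ∀ x, 1 + (σ : ℝ) * lam x * (1 - (θL - θR)) ≠ 0)
    (hLam_nonneg : ∀ x, 0 ≤ Lam x)
    (hκ_mem : ∀ x, κ x ∈ BoundaryDriven.scaleSet σ)
    (hconv : σ = 1 → ∀ x, 0 < (1 + lam x) * (1 + lam x * (1 + θbar x))) :
    (MeasureTheory.Integrable (fun η => ∏ x, Lam x ^ η.1 x) μ ∧
      MeasureTheory.Integrable BoundaryDriven.psi (BoundaryDriven.dualProductMeasure σ G κ) ∧
      ∫ η, ∏ x, Lam x ^ η.1 x ∂μ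
        = (∏ x, BoundaryDriven.factorJ σ θL θR (G.α x) (θbar x) (lam x))
          * ∫ ξ, BoundaryDriven.psi ξ ∂(BoundaryDriven.dualProductMeasure σ G κ)) ∧
    ∀ t : ℝ, 0 ≤ t →
      (MeasureTheory.Integrable (fun η => ∏ x, Lam x ^ η.1 x)
          (MarkovChain.lawAt (BoundaryDriven.generator σ G θL θR)
            (BoundaryDriven.productMeasure σ G θbar) t) ∧
        MeasureTheory.Integrable (BoundaryDriven.psiAt t)
          (BoundaryDriven.dualProductMeasure σ G κ) ∧
        ∫ η, ∏ x, Lam x ^ η.1 x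
            ∂(MarkovChain.lawAt (BoundaryDriven.generator σ G θL θR)
              (BoundaryDriven.productMeasure σ G θbar) t)
          = (∏ x, BoundaryDriven.factorJ σ θL θR (G.α x) (θbar x) (lam x))
            * ∫ ξ, BoundaryDriven.psiAt t ξ ∂(BoundaryDriven.dualProductMeasure σ G κ)) := by
  subst hLam hκ
  exact ⟨BoundaryDriven.stationary_identity hω hθL hθR hμ hθbar hden_Lam hden_κ hLam_nonneg hκ_mem
    hconv, fun t ht => BoundaryDriven.localEquilibrium_identity hω hθL hθR ht
      (fun x => by rw [hθbar, BoundaryDriven.profile_eq hω hθL hθR hμ]) hden_Lam hden_κ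
      hLam_nonneg hκ_mem hconv⟩
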